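/- **Setting.** Let $E$ be a smooth (Hausdorff, second countable) manifold of dimension $n+m$ with a smooth torsion-free linear connection $\Gamma$ on $TE$, and let $M$ be a smooth $n$-dimensional manifold with a smooth torsion-free linear connection $\Theta$ on $TM$. For a manifold $F$ let $J^r(F,n)$ be the space of $r$-jets $[L]^r_p$ of embedded $n$-dimensional submanifolds $L\subset F$ at points $p\in L$, and $L^{(r)}=\{[L]^r_p : p\in L\}$. A point $\theta_{r+1}=[L]^{r+1}_p$ determines the $R$-plane $R_{\theta_{r+1}}=T_{[L]^r_p}L^{(r)}$; the Cartan plane $\mathcal C^r_{\theta_r}$ is the span of the $R$-planes at $\theta_r$. Consider one of the following situations. (a) $F=E$, with the connection $\Gamma$, and $J^r=J^r(E,n)$; (b) $F=M\times E$, with the connection $\Theta\oplus\Gamma$, and $J^r=J^r\mathrm{pr}_M\subset J^r(M\times E,n)$, the jets of the images of local sections of $\mathrm{pr}_M\colon M\times E\to M$; (b$'$) as in (b), with $J^r=\operatorname{Imm}J^r\mathrm{pr}_M$, the jets of the local sections $x\mapsto (x,s(x))$ with $s$ an immersion. Let $\nabla$ be the given connection on $F$. The equation $\mathcal S\subset J^2$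 of totally geodesic submanifolds (denoted by $\mathcal S_{\mathrm{pr}_M}$ in cases (b), (b$'$)) is the set of the $[L]^2_p$ such that the second fundamental form of $L$ with respect to $\nabla$ vanishes at $p$. The connection $\nabla$ induces a connection on the bundle of $n$-planes $J^1\to F$, and the section $\ddot\Gamma\colon J^1\to J^2$ is characterized by the property that, for $\theta_1=[L]^1_p$, the $R$-plane $R_{\ddot\Gamma(\theta_1)}$ is the horizontal lift of $T_pL$ to $\theta_1$. This defines a distribution $R\circ\ddot\Gamma\colon\theta_1\mapsto R_{\ddot\Gamma(\theta_1)}$ of rank $n$ on $J^1$. One calls $\mathcal S$ *integrable* if this distribution is integrable, i.e. has an integral manifold through each point of $J^1$. Let $\mathcal H$ be the module of vector fields on $J^1$ lying in $R\circ\ddot\Gamma$, let $D_{R\circ\ddot\Gamma}$ be the Lie algebra of vector fields $X$ on $J^1$ preserving $R\circ\ddot\Gamma$ (i.e. $[X,\mathcal H]\subset\mathcal H$), and let $\mathcal W$ be the projection of vector fields on $J^1$ to sections of the quotient bundle $TJ^1/(R\circ\ddot\Gamma)$. The first prolongation of an equation $\mathcal E\subset J^r$ is $\mathcal E^1=\{\theta_{r+1}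 : \theta_r\in\mathcal E,\ R_{\theta_{r+1}}\subset T_{\theta_r}\mathcal E\}$; iterating one gets $\mathcal S^l\subset J^{2+l}$ and $\mathcal S^\infty\subset J^\infty=\varprojlim J^r$. Smooth functions on $\mathcal S^\infty$ are the restrictions of smooth functions on the spaces $J^l$, $l\ge 0$, and vector fields on $\mathcal S^\infty$ are the derivations of this algebra. The Cartan distribution $\mathcal C(\mathcal S^\infty)$ consists of the tangent vectors at $\theta=(\theta_l)_l$ whose projection to $J^l$ lies in $R_{\theta_{l+1}}$ for every $l$, and $\mathcal C(\mathcal S)=\mathcal C^2\cap T\mathcal S$. A *higher internal symmetry* of $\mathcal S$ is a vector field on $\mathcal S^\infty$ preserving $\mathcal C(\mathcal S^\infty)$; it is *trivial* if it lies in $\mathcal C(\mathcal S^\infty)$; the *non-trivial* higher internal symmetries are the quotient of the former by the latter. A *classical internal symmetry* of $\mathcal S$ is a vector field on $\mathcal S$ preserving $\mathcal C(\mathcal S)$. **Statement.** In each of the situations (a), (b), (b$'$), let $\mathcal S$ be integrable. Then the projections $\mathcal S^\infty\to J^1$ and $\mathcal S\to J^1$ induce isomorphisms of Lie algebras $\Phi$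 and $\Psi$ from the vector fields on $\mathcal S^\infty$, respectively on $\mathcal S$, onto the vector fields on $J^1$ (corresponding vector fields being related by the projection), such that: 1. every vector field lying in $\mathcal C(\mathcal S^\infty)$ is a symmetry, and $\Phi$ maps the trivial internal symmetries of $\mathcal S$ onto $\mathcal H$; 2. $\Phi$ maps the Lie algebra of higher internal symmetries of $\mathcal S$ onto $D_{R\circ\ddot\Gamma}$, and $\Psi$ maps the Lie algebra of classical internal symmetries of $\mathcal S$ onto $D_{R\circ\ddot\Gamma}$; so these three algebras are isomorphic; 3. $[X]\mapsto\mathcal W(\Phi X)$ is a well-defined linear isomorphism of the algebra of non-trivial higher internal symmetries of $\mathcal S$ onto the projection $\mathcal W(D_{R\circ\ddot\Gamma})$. -/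

import Mathlib

open Set Filter Topology
open scoped Manifold ContDiff

namespace GeodesicJets

/-! ## Spaces given by their algebra of smooth functions

A (finite- or infinite-dimensional) smooth space is handled through its algebra `O` of smooth
real functions: tangent vectors at `z` are the derivations of `O` at `z`, vector fields are the
derivations of `O`, with the commutator as Lie bracket. -/

section FunctionAlgebra

variable {Z : Type*}

instance dualAddCommGroup (O : Subalgebra ℝ (Z → ℝ)) : AddCommGroup (Module.Dual ℝ O) :=
  LinearMap.addCommGroup

/-- The tangent space at `z`: linear forms on `O` satisfying the Leibniz rule at `z`. -/
def tangentAt (O : Subalgebra ℝ (Z → ℝ)) (z : Z) : Submodule ℝ (Module.Dual ℝ O) where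
  carrier := {D | ∀ f g : O, D (f * g) = f.1 z * D g + g.1 z * D f}
  add_mem' := by
    intro a b ha hb f g
    simp only [mem_ofPred_eq, LinearMap.add_apply] at *
    rw [ha, hb]; ring
  zero_mem' := by intro f g; simp
  smul_mem' := by
    intro c a ha f g
    simp only [mem_ofPred_eq, LinearMap.smul_apply, smul_eq_mul] at *
    rw [ha]; ring

/-- Vector fields. -/
abbrev VField (O : Subalgebra ℝ (Z → ℝ)) := Derivation ℝ O O

/-- The value at `z` of a vector field. -/
def valueAt (O : Subalgebra ℝ (Z → ℝ)) (z : Z) : VField O →ₗ[ℝ] tangentAt O z where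
  toFun X :=
    ⟨{ toFun := fun f => (X f).1 z
       map_add' := by intro f g; simp
       map_smul' := by intro c f; simp },
     by intro f g; simp [Derivation.leibniz]⟩
  map_add' := by intro X Y; ext f; simp
  map_smul' := by intro c X; ext f; simp

/-- A distribution: a subspace of each tangent space (as spaces of linear forms on `O`). -/
abbrev Distribution (O : Subalgebra ℝ (Z → ℝ)) := Z → Submodule ℝ (Module.Dual ℝ O)

/-- The module (over the algebra of functions) of the vector fields lying in a distribution. -/
def fieldsIn {O : Subalgebra ℝ (Z → ℝ)} (D : Distribution O) : Submodule O (VField O) where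
  carrier := {X | ∀ z, (valueAt O z X).1 ∈ D z}
  add_mem' := by
    intro X Y hX hY z
    have := (D z).add_mem (hX z) (hY z)
    simpa using this
  zero_mem' := by intro z; simp
  smul_mem' := by
    intro f X hX z
    have h := (D z).smul_mem (f.1 z) (hX z)
    have e : (valueAt O z (f • X)).1 = f.1 z • (valueAt O z X).1 := by
      ext g; rfl
    rw [e]; exact h

/-- The Lie algebra of the vector fields `X` preserving a distribution: `[X, Y]` lies in the
distribution whenever `Y` does. -/
def symmetries {O : Subalgebra ℝ (Z → ℝ)} (D : Distribution O) : LieSubalgebra ℝ (VField O) where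
  carrier := {X | ∀ Y ∈ fieldsIn D, ⁅X, Y⁆ ∈ fieldsIn D}
  add_mem' := by
    intro X X' hX hX' Y hY
    have e : ⁅X + X', Y⁆ = ⁅X, Y⁆ + ⁅X', Y⁆ := add_lie X X' Y
    rw [e]; exact add_mem (hX Y hY) (hX' Y hY)
  zero_mem' := by 
    intro Y hY
    have e : ⁅(0 : VField O), Y⁆ = 0 := by ext f; simp [Derivation.commutator_apply]
    rw [e]; exact zero_mem _
  smul_mem' := by
    intro c X hX Y hY
    have h : ⁅c • X, Y⁆ = (algebraMap ℝ O c) • ⁅X, Y⁆ := by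
      rw [algebraMap_smul]; exact smul_lie c X Y
    rw [h]
    exact (fieldsIn D).smul_mem _ (hX Y hY)
  lie_mem' := by
    intro X X' hX hX' Y hY
    have e : ⁅⁅X, X'⁆, Y⁆ = ⁅X, ⁅X', Y⁆⁆ - ⁅X', ⁅X, Y⁆⁆ := by
      ext f : 1
      simp only [Derivation.commutator_apply, Derivation.sub_apply, map_sub]
      abel
    rw [e]
    intro z
    have h := (D z).sub_mem (hX _ (hX' Y hY) z) (hX' _ (hX Y hY) z)
    have e' (A B : VField O) :
        (valueAt O z (A - B)).1 = (valueAt O z A).1 - (valueAt O z B).1 := by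
      ext g; rfl
    rw [e']
    exact h

/-- The ideal of the trivial symmetries: those lying in the distribution. -/
def trivialIdeal {O : Subalgebra ℝ (Z → ℝ)} (D : Distribution O) :
    LieIdeal ℝ (symmetries D) where
  carrier := {X | X.1 ∈ fieldsIn D}
  add_mem' := by intro X Y hX hY; exact (fieldsIn D).add_mem hX hY
  zero_mem' := zero_mem (fieldsIn D)
  smul_mem' := by
    intro c X hX
    have h : (c • X).1 = (algebraMap ℝ O c) • X.1 := by
      rw [algebraMap_smul]; rfl
    change (c • X).1 ∈ fieldsIn D
    rw [h]
    exact (fieldsIn D).smul_mem _ hX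
  lie_mem := by
    intro X Y hY
    exact X.2 _ hY

/-- The Lie algebra of non-trivial symmetries of a distribution. -/
abbrev NontrivialSymmetries {O : Subalgebra ℝ (Z → ℝ)} (D : Distribution O) :=
  symmetries D ⧸ trivialIdeal D

/-- The projection of vector fields to sections `z ↦ X_z mod D_z` of the quotient bundle
`T / D`. -/
def quotientProj {O : Subalgebra ℝ (Z → ℝ)} (D : Distribution O) :
    VField O →ₗ[ℝ] ((z : Z) → tangentAt O z ⧸ (D z).submoduleOf (tangentAt O z)) :=
  LinearMap.pi fun z => ((D z).submoduleOf (tangentAt O z)).mkQ ∘ₗ valueAt O z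

/-- A distribution of rank `dim V` is integrable if through every point there passes an integral
manifold, that is, an immersed piece `j : U → Z` of `V` whose tangent spaces are the planes of
the distribution. -/
def IsIntegrable (V : Type*) [NormedAddCommGroup V] [NormedSpace ℝ V]
    {O : Subalgebra ℝ (Z → ℝ)} (D : Distribution O) : Prop :=
  ∀ z : Z, ∃ (j : V → Z) (U : Set V), IsOpen U ∧ (0 : V) ∈ U ∧ j 0 = z ∧
    (∀ f : O, ContDiffOn ℝ ∞ (fun x => f.1 (j x)) U) ∧
    ∀ x ∈ U, ∃ T : V ≃ₗ[ℝ] D (j x), ∀ (v : V) (f : O),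
      (T v).1 f = fderiv ℝ (fun y => f.1 (j y)) x v

/-- Pull-back of functions along a map. -/
def pullback {Z Z' : Type*} (h : Z' → Z) : (Z → ℝ) →ₐ[ℝ] (Z' → ℝ) where
  toFun f := f ∘ h
  map_one' := rfl
  map_mul' _ _ := rfl
  map_zero' := rfl
  map_add' _ _ := rfl
  commutes' _ := rfl

end FunctionAlgebra

/-! ## Jets of submanifolds

`F` is a manifold modelled on `V × W`, and `n = dim V`. -/

section Jets

variable {V W : Type*} [NormedAddCommGroup V] [NormedSpace ℝ V]
  [NormedAddCommGroup W] [NormedSpace ℝ W]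
  {H : Type*} [TopologicalSpace H]

/-- A divided chart: a diffeomorphism of an open set of `F` onto an open set of `V × W`. -/
structure DividedChart (I : ModelWithCorners ℝ (V × W) H) (F : Type*) [TopologicalSpace F]
    [ChartedSpace H F] extends OpenPartialHomeomorph F (V × W) where
  contMDiffOn_to : ContMDiffOn I 𝓘(ℝ, V × W) ∞ toFun source
  contMDiffOn_inv : ContMDiffOn 𝓘(ℝ, V × W) I ∞ invFun target

variable {I : ModelWithCorners ℝ (V × W) H} {F : Type*} [TopologicalSpace F] [ChartedSpace H F]

/-- The divided chart `φ` is concordant to `L` at `p`: near `p`, `L` is the graph of the smooth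
map `u`. -/
structure IsGraphAt (φ : DividedChart I F) (L : Set F) (p : F) (u : V → W) : Prop where
  mem_source : p ∈ φ.source
  smooth : ∃ U ∈ 𝓝 (φ.toFun p).1, ContDiffOn ℝ ∞ u U
  graph : ∀ᶠ q in 𝓝 p, (q ∈ L ↔ (φ.toFun q).2 = u (φ.toFun q).1)

variable (I) in
/-- `L` is an embedded submanifold of `F` of dimension `dim V`. -/
def IsSubmanifold (L : Set F) : Prop :=
  ∀ p ∈ L, ∃ (φ : DividedChart I F) (u : V → W), IsGraphAt φ L p u

variable (I) in
/-- A pointed submanifold `(L, p)`, with `L` in the class `A` of submanifolds. -/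
structure PointedSub (A : Set (Set F)) where
  carrier : Set F
  isSubmanifold : IsSubmanifold I carrier
  mem_class : carrier ∈ A
  pt : F
  pt_mem : pt ∈ carrier

/-- The same submanifold with another distinguished point. -/
def PointedSub.move {A : Set (Set F)} (s : PointedSub I A) (q : F) (hq : q ∈ s.carrier) :
    PointedSub I A :=
  { s with pt := q, pt_mem := hq }

/-- The tangent vectors of `L` at `p`, as elements of `TF`: velocities of the smooth curves of `F`
with values in `L`. -/
def PointedSub.tangentVectors {A : Set (Set F)} (s : PointedSub I A) : Set (TangentBundle I F) :=
  {X | ∃ γ : ℝ → F, ContMDiff 𝓘(ℝ, ℝ) I ∞ γ ∧ (∀ t, γ t ∈ s.carrier) ∧ γ 0 = s.pt ∧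
    X = tangentMap 𝓘(ℝ, ℝ) I γ ⟨0, 1⟩}

variable (V W) in
/-- The space of jet coordinates `(x, u_σ)`, `|σ| ≤ r` (derivatives of order `k` being `k`-linear
maps). -/
abbrev JetCoords (r : ℕ) :=
  V × ((k : Fin (r + 1)) → ContinuousMultilinearMap ℝ (fun _ : Fin (k : ℕ) => V) W)

/-- The coordinates in `φ` of the `r`-jet at `p` of the graph of `u`. -/
noncomputable def jetCoords (r : ℕ) (φ : DividedChart I F) (u : V → W) (p : F) :
    JetCoords V W r :=
  ((φ.toFun p).1, fun k => iteratedFDeriv ℝ (k : ℕ) u (φ.toFun p).1)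

/-- Contact of order `r`. -/
def HasContact {A : Set (Set F)} (r : ℕ) (s t : PointedSub I A) : Prop :=
  ∃ (φ : DividedChart I F) (u u' : V → W), IsGraphAt φ s.carrier s.pt u ∧
    IsGraphAt φ t.carrier t.pt u' ∧ jetCoords r φ u s.pt = jetCoords r φ u' t.pt

variable (I) in
/-- The space of the `r`-jets `[L]^r_p` of the submanifolds `L ∈ A` of dimension `dim V`. -/
def Jet (A : Set (Set F)) (r : ℕ) := Quot (HasContact (I := I) (A := A) r)

/-- The jet `[L]^r_p`. -/
def Jet.mk {A : Set (Set F)} (r : ℕ) (s : PointedSub I A) : Jet I A r := Quot.mk _ s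

theorem HasContact.of_le {A : Set (Set F)} {k r : ℕ} (h : k ≤ r) {s t : PointedSub I A}
    (hc : HasContact r s t) : HasContact k s t := by
  obtain ⟨φ, u, u', hu, hu', he⟩ := hc
  refine ⟨φ, u, u', hu, hu', Prod.ext (congrArg (fun c => c.1) he) ?_⟩
  funext i
  exact congrFun (congrArg (fun c => c.2) he) (Fin.castLE (by omega) i)

/-- The projection `[L]^r_p ↦ [L]^k_p`, `k ≤ r`. -/
def Jet.proj {A : Set (Set F)} {k r : ℕ} (h : k ≤ r) : Jet I A r → Jet I A k :=
  Quot.map id fun _ _ hc => hc.of_le h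

theorem HasContact.pt_eq {A : Set (Set F)} {r : ℕ} {s t : PointedSub I A}
    (hc : HasContact r s t) : s.pt = t.pt := by
  obtain ⟨φ, u, u', hu, hu', he⟩ := hc
  have h1 : (φ.toFun s.pt).1 = (φ.toFun t.pt).1 := congrArg (fun c => c.1) he
  have h2 := congrArg (fun m => m (fun _ => 0)) (congrFun (congrArg (fun c => c.2) he) (0 : Fin (r + 1)))
  have h3 : u (φ.toFun s.pt).1 = u' (φ.toFun t.pt).1 := h2
  have e1 := (hu.graph.self_of_nhds).1 s.pt_mem
  have e2 := (hu'.graph.self_of_nhds).1 t.pt_mem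
  exact φ.injOn hu.mem_source hu'.mem_source
    (Prod.ext h1 (by rw [e1, e2, h3] : (φ.toFun s.pt).2 = (φ.toFun t.pt).2))

/-- The base point `p` of `[L]^r_p`. -/
def Jet.base {A : Set (Set F)} {r : ℕ} : Jet I A r → F :=
  Quot.lift PointedSub.pt fun _ _ hc => hc.pt_eq

/-- A function on the jet space is smooth if in the jet coordinates of every divided chart it is
locally a smooth function of the coordinates. -/
def IsSmoothFun {A : Set (Set F)} {r : ℕ} (f : Jet I A r → ℝ) : Prop :=
  ∀ (s : PointedSub I A) (φ : DividedChart I F) (u : V → W), IsGraphAt φ s.carrier s.pt u →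
    ∃ (g : JetCoords V W r → ℝ), ∃ N ∈ 𝓝 (jetCoords r φ u s.pt), ContDiffOn ℝ ∞ g N ∧
      ∀ (t : PointedSub I A) (u' : V → W), IsGraphAt φ t.carrier t.pt u' →
        jetCoords r φ u' t.pt ∈ N → f (Jet.mk r t) = g (jetCoords r φ u' t.pt)

variable (I) in
/-- The algebra of smooth functions on the jet space. -/
def smoothFun (A : Set (Set F)) (r : ℕ) : Subalgebra ℝ (Jet I A r → ℝ) where
  carrier := {f | IsSmoothFun f}
  mul_mem' := by
    intro f f' hf hf' s φ u hu
    obtain ⟨g, N, hN, hg, h⟩ := hf s φ u hu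
    obtain ⟨g', N', hN', hg', h'⟩ := hf' s φ u hu
    refine ⟨fun c => g c * g' c, N ∩ N', inter_mem hN hN',
      (hg.mono inter_subset_left).mul (hg'.mono inter_subset_right), fun t u' hu' hm => ?_⟩
    simp [h t u' hu' hm.1, h' t u' hu' hm.2]
  add_mem' := by
    intro f f' hf hf' s φ u hu
    obtain ⟨g, N, hN, hg, h⟩ := hf s φ u hu
    obtain ⟨g', N', hN', hg', h'⟩ := hf' s φ u hu
    refine ⟨fun c => g c + g' c, N ∩ N', inter_mem hN hN',
      (hg.mono inter_subset_left).add (hg'.mono inter_subset_right), fun t u' hu' hm => ?_⟩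
    simp [h t u' hu' hm.1, h' t u' hu' hm.2]
  algebraMap_mem' := by
    intro c s φ u hu
    exact ⟨fun _ => c, univ, univ_mem, contDiffOn_const, fun t u' hu' hm => rfl⟩

/-- The `R`-plane `T_{[L]^r_p} L^{(r)}` determined by `[L]^{r+1}_p`: the span of the velocities of
the curves `t ↦ [L]^r_{γ t}`, for smooth curves `γ` in `L` through `p`. -/
def RPlane {A : Set (Set F)} {r : ℕ} (ϑ : Jet I A (r + 1)) :
    Submodule ℝ (Module.Dual ℝ (smoothFun I A r)) :=
  Submodule.span ℝ {D | ∃ s : PointedSub I A, Jet.mk (r + 1) s = ϑ ∧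
    ∃ (γ : ℝ → F) (hγ : ∀ t, γ t ∈ s.carrier), ContMDiff 𝓘(ℝ, ℝ) I ∞ γ ∧ γ 0 = s.pt ∧
      ∀ f : smoothFun I A r,
        HasDerivAt (fun t => f.1 (Jet.mk r (s.move (γ t) (hγ t)))) (D f) 0}

/-- The Cartan plane at `θ`: the span of the `R`-planes at `θ`. -/
def cartanPlane {A : Set (Set F)} {r : ℕ} (θ : Jet I A r) :
    Submodule ℝ (Module.Dual ℝ (smoothFun I A r)) :=
  ⨆ (ϑ : Jet I A (r + 1)) (_ : Jet.proj (Nat.le_succ r) ϑ = θ), RPlane ϑ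

/-! ## Differential equations, their prolongations and infinitesimal symmetries -/

/-- Smooth functions on an equation (a closed submanifold of a jet space): restrictions of the
smooth functions on the jet space. -/
def equationFun {A : Set (Set F)} {r : ℕ} (S : Set (Jet I A r)) : Subalgebra ℝ (S → ℝ) :=
  (smoothFun I A r).map (pullback Subtype.val)

/-- Restriction of functions to an equation. -/
def restrictEq {A : Set (Set F)} {r : ℕ} (S : Set (Jet I A r)) :
    smoothFun I A r →ₐ[ℝ] equationFun S :=
  (pullback Subtype.val).subalgebraMap (smoothFun I A r)

/-- The tangent space of an equation at `θ`, inside that of the jet space: the tangent vectors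
annihilating the functions that vanish on the equation. -/
def equationTangent {A : Set (Set F)} {r : ℕ} (S : Set (Jet I A r)) (θ : Jet I A r) :
    Submodule ℝ (Module.Dual ℝ (smoothFun I A r)) :=
  tangentAt (smoothFun I A r) θ ⊓
    Submodule.dualAnnihilator
      { carrier := {f : smoothFun I A r | ∀ ϑ ∈ S, f.1 ϑ = 0}
        add_mem' := by
          intro f g hf hg ϑ h
          simp [hf ϑ h, hg ϑ h]
        zero_mem' := by intro ϑ _; rfl
        smul_mem' := by
          intro c f hf ϑ h
          simp [hf ϑ h] }

/-- The induced Cartan distribution `C^r ∩ TS` of an equation: the tangent vectors of `S` whose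
push-forward to the jet space is in the Cartan plane. -/
def equationCartan {A : Set (Set F)} {r : ℕ} (S : Set (Jet I A r)) :
    Distribution (equationFun S) :=
  fun z => (cartanPlane z.1).comap (Module.Dual.transpose (R := ℝ) (restrictEq S).toLinearMap)

/-- The first prolongation of an equation. -/
def prolongOne {A : Set (Set F)} {r : ℕ} (S : Set (Jet I A r)) : Set (Jet I A (r + 1)) :=
  {ϑ | Jet.proj (Nat.le_succ r) ϑ ∈ S ∧
    RPlane ϑ ≤ equationTangent S (Jet.proj (Nat.le_succ r) ϑ)}

/-- The `l`-th prolongation. -/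
def prolong {A : Set (Set F)} {r : ℕ} (S : Set (Jet I A r)) : (l : ℕ) → Set (Jet I A (r + l))
  | 0 => S
  | l + 1 => prolongOne (prolong S l)

variable (I) in
/-- The infinite jet space, as inverse limit of the finite ones. -/
def JetInf (A : Set (Set F)) :=
  {θ : (r : ℕ) → Jet I A r // ∀ r, Jet.proj (Nat.le_succ r) (θ (r + 1)) = θ r}

/-- The infinite prolongation of an equation. -/
def prolongInf {A : Set (Set F)} {r : ℕ} (S : Set (Jet I A r)) : Set (JetInf I A) :=
  {θ | ∀ l, θ.1 (r + l) ∈ prolong S l}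

/-- The projection of the infinite prolongation to the space of `l`-jets. -/
def projInf {A : Set (Set F)} {r : ℕ} (S : Set (Jet I A r)) (l : ℕ) :
    prolongInf S → Jet I A l :=
  fun θ => θ.1.1 l

/-- Smooth functions on the infinite prolongation: the increasing union of the algebras of smooth
functions of the `l`-jet, `l = 0, 1, 2, …`. -/
def infFun {A : Set (Set F)} {r : ℕ} (S : Set (Jet I A r)) :
    Subalgebra ℝ (prolongInf S → ℝ) :=
  ⨆ l, (smoothFun I A l).map (pullback (projInf S l))

/-- Pull-back to the infinite prolongation of functions on the space of `l`-jets. -/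
def pullInf {A : Set (Set F)} {r : ℕ} (S : Set (Jet I A r)) (l : ℕ) :
    smoothFun I A l →ₐ[ℝ] infFun S :=
  (Subalgebra.inclusion (le_iSup
    (fun l => (smoothFun I A l).map (pullback (projInf S l))) l)).comp
    ((pullback (projInf S l)).subalgebraMap (smoothFun I A l))

/-- The Cartan distribution of the infinite prolongation: a tangent vector at `θ` is in it if for
every `l` its push-forward to the space of `l`-jets is in the `R`-plane of `θ_{l+1}`. -/
def infCartan {A : Set (Set F)} {r : ℕ} (S : Set (Jet I A r)) : Distribution (infFun S) :=
  fun θ => ⨅ l, (RPlane (θ.1.1 (l + 1))).comap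
    (Module.Dual.transpose (R := ℝ) (pullInf S l).toLinearMap)

/-! ## Totally geodesic submanifolds

`nabla` is a linear connection on `TF`; `nabla Y p v` is the covariant derivative of `Y` at `p` in
the direction `v`. -/

/-- A linear connection on the tangent bundle. -/
abbrev LinearConnection {V : Type*} [NormedAddCommGroup V] [NormedSpace ℝ V]
    (I : ModelWithCorners ℝ V H) (F : Type*) [TopologicalSpace F] [ChartedSpace H F]
    [IsManifold I ∞ F] :=
  CovariantDerivative I V (TangentSpace I : F → Type _)

variable [IsManifold I ∞ F]

/-- The vector field `Y` is smooth at `p`. -/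
def SmoothFieldAt (Y : (q : F) → TangentSpace I q) (p : F) : Prop :=
  ContMDiffAt I I.tangent ∞ (fun q => (⟨q, Y q⟩ : TangentBundle I F)) p

/-- The second fundamental form of `L` vanishes at `p`: if `X ∈ T_p L` and `Y` is a vector field
tangent to `L`, then `∇_X Y ∈ T_p L`. -/
def SecondFormVanishes (nabla : LinearConnection I F) {A : Set (Set F)} (s : PointedSub I A) :
    Prop :=
  ∀ X ∈ s.tangentVectors, ∀ Y : (q : F) → TangentSpace I q, SmoothFieldAt Y s.pt →
    (∀ᶠ q in 𝓝 s.pt, ∀ hq : q ∈ s.carrier,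
      (⟨q, Y q⟩ : TangentBundle I F) ∈ (s.move q hq).tangentVectors) →
    (⟨X.proj, nabla Y X.proj X.snd⟩ : TangentBundle I F) ∈ s.tangentVectors

/-- The equation of totally geodesic submanifolds, as a set of second order jets. -/
def geodesicEquation (nabla : LinearConnection I F) (A : Set (Set F)) : Set (Jet I A 2) :=
  {θ | ∃ s : PointedSub I A, Jet.mk 2 s = θ ∧ SecondFormVanishes nabla s}

/-- The tangent `n`-plane `T_p L` corresponding to `[L]^1_p`. -/
def Jet.plane {A : Set (Set F)} (θ : Jet I A 1) : Set (TangentBundle I F) :=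
  {X | ∃ s : PointedSub I A, Jet.mk 1 s = θ ∧ X ∈ s.tangentVectors}

/-- `v` is the horizontal lift of `X ∈ TF` to `θ`, with respect to the connection induced by
`nabla` on the bundle of first order jets (the Grassmann bundle) over `F`: `v` is the image of `X`
under the differential of a local section `σ` (a field of `n`-planes) through `θ` whose vertical
part vanishes, that is, `∇_X Y` is in the plane of `θ` for all vector fields `Y` with values in the
planes of `σ`. -/
def IsHorizontalLift (nabla : LinearConnection I F) {A : Set (Set F)} (θ : Jet I A 1)
    (X : TangentBundle I F) (v : Module.Dual ℝ (smoothFun I A 1)) : Prop :=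
  ∃ (σ : F → Jet I A 1) (U : Set F), IsOpen U ∧ X.proj ∈ U ∧ (∀ q ∈ U, (σ q).base = q) ∧
    (∀ f : smoothFun I A 1, ContMDiffOn I 𝓘(ℝ, ℝ) ∞ (fun q => f.1 (σ q)) U) ∧
    σ X.proj = θ ∧
    (∀ f : smoothFun I A 1,
      v f = mvfderiv I (fun q => f.1 (σ q)) X.proj X.snd) ∧
    ∀ Y : (q : F) → TangentSpace I q, SmoothFieldAt Y X.proj →
      (∀ᶠ q in 𝓝 X.proj, (⟨q, Y q⟩ : TangentBundle I F) ∈ (σ q).plane) →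
      (⟨X.proj, nabla Y X.proj X.snd⟩ : TangentBundle I F) ∈ θ.plane

/-- The Grassmannian structure associated with `nabla`: `θ` is mapped to the unique second order
jet over it whose `R`-plane is the horizontal lift of the plane of `θ`. -/
noncomputable def grassmannStructure (nabla : LinearConnection I F) (A : Set (Set F))
    (θ : Jet I A 1) : Jet I A 2 :=
  @Classical.epsilon (Jet I A 2) (Quot.exists_rep θ |>.elim fun s _ => ⟨Jet.mk 2 s⟩) fun ϑ =>
    Jet.proj (Nat.le_succ 1) ϑ = θ ∧
      ∀ v, v ∈ RPlane ϑ ↔ ∃ X ∈ θ.plane, IsHorizontalLift nabla θ X v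

/-- The distribution on the space of first order jets given by the `R`-planes of the Grassmannian
structure. -/
noncomputable def geodesicDistribution (nabla : LinearConnection I F) (A : Set (Set F)) :
    Distribution (smoothFun I A 1) :=
  fun θ => RPlane (grassmannStructure nabla A θ)

/-- The description of the symmetries of the equation `S` of totally geodesic submanifolds, with
infinite prolongation `S^∞`, through the distribution `R` on the space `J^1` of first order jets.
`Φ` and `Ψ` are the isomorphisms induced by the projections `S^∞ → J^1` and `S → J^1`. -/
def SymmetryDescription (nabla : LinearConnection I F) (A : Set (Set F)) : Prop :=
  let S := geodesicEquation nabla A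
  let R := geodesicDistribution nabla A
  ∃ (Φ : VField (infFun S) ≃ₗ⁅ℝ⁆ VField (smoothFun I A 1))
    (Ψ : VField (equationFun S) ≃ₗ⁅ℝ⁆ VField (smoothFun I A 1)),
    -- `X` and `Φ X` are related by the projection `S^∞ → J^1`
    (∀ (X : VField (infFun S)) (f : smoothFun I A 1) (θ : prolongInf S),
      (Φ X f).1 (projInf S 1 θ) = (X (pullInf S 1 f)).1 θ) ∧
    -- `X` and `Ψ X` are related by the projection `S → J^1`
    (∀ (X : VField (equationFun S)) (f : smoothFun I A 1) (g : smoothFun I A 2),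
      (∀ θ : Jet I A 2, g.1 θ = f.1 (Jet.proj (Nat.le_succ 1) θ)) →
      ∀ θ : S, (Ψ X f).1 (Jet.proj (Nat.le_succ 1) θ.1) = (X (restrictEq S g)).1 θ) ∧
    -- trivial symmetries are symmetries, and they correspond to the sections of `R`
    (∀ X ∈ fieldsIn (infCartan S), X ∈ symmetries (infCartan S)) ∧
    (∀ X, X ∈ fieldsIn (infCartan S) ↔ Φ X ∈ fieldsIn R) ∧
    -- higher internal symmetries and classical internal symmetries both correspond to the
    -- vector fields on `J^1` preserving `R`
    (∀ X, X ∈ symmetries (infCartan S) ↔ Φ X ∈ symmetries R) ∧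
    (∀ X, X ∈ symmetries (equationCartan S) ↔ Ψ X ∈ symmetries R) ∧
    -- non-trivial higher internal symmetries are the projection of the latter
    ∃ e : NontrivialSymmetries (infCartan S) ≃ₗ[ℝ]
        (symmetries R).toSubmodule.map (quotientProj R),
      ∀ X : symmetries (infCartan S),
        (e (LieSubmodule.Quotient.mk X)).1 = quotientProj R (Φ X.1)

end Jets

/-! ## The product `M × E` -/

section Product

set_option linter.unusedSectionVars false

variable {V₁ V₂ : Type*} [NormedAddCommGroup V₁] [NormedSpace ℝ V₁]
  [NormedAddCommGroup V₂] [NormedSpace ℝ V₂]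
  {H₁ H₂ : Type*} [TopologicalSpace H₁] [TopologicalSpace H₂]
  {I₁ : ModelWithCorners ℝ V₁ H₁} {I₂ : ModelWithCorners ℝ V₂ H₂}
  {M E : Type*} [TopologicalSpace M] [ChartedSpace H₁ M] [IsManifold I₁ ∞ M]
  [TopologicalSpace E] [ChartedSpace H₂ E] [IsManifold I₂ ∞ E]

theorem mdiff_fst_section {σ : (q : M × E) → TangentSpace (I₁.prod I₂) q} {p : M × E}
    (hσ : MDifferentiableAt (I₁.prod I₂) (I₁.prod I₂).tangent
      (fun q => (⟨q, σ q⟩ : TangentBundle (I₁.prod I₂) (M × E))) p) :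
    MDifferentiableAt (I₁.prod I₂) I₁.tangent
      (fun q => (⟨q.1, (σ q).1⟩ : TangentBundle I₁ M)) p := by
  have h : ContMDiff (I₁.prod I₂).tangent I₁.tangent 1
      (tangentMap (I₁.prod I₂) I₁ (Prod.fst : M × E → M)) :=
    (contMDiff_fst (n := 2)).contMDiff_tangentMap (by norm_num)
  have h2 := ((h _).mdifferentiableAt one_ne_zero).comp p hσ
  refine h2.congr_of_eventuallyEq (Eventually.of_forall fun q => ?_)
  simp [tangentMap, mfderiv_fst]
  rfl

theorem mdiff_snd_section {σ : (q : M × E) → TangentSpace (I₁.prod I₂) q} {p : M × E}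
    (hσ : MDifferentiableAt (I₁.prod I₂) (I₁.prod I₂).tangent
      (fun q => (⟨q, σ q⟩ : TangentBundle (I₁.prod I₂) (M × E))) p) :
    MDifferentiableAt (I₁.prod I₂) I₂.tangent
      (fun q => (⟨q.2, (σ q).2⟩ : TangentBundle I₂ E)) p := by
  have h : ContMDiff (I₁.prod I₂).tangent I₂.tangent 1
      (tangentMap (I₁.prod I₂) I₂ (Prod.snd : M × E → E)) :=
    (contMDiff_snd (n := 2)).contMDiff_tangentMap (by norm_num)
  have h2 := ((h _).mdifferentiableAt one_ne_zero).comp p hσ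
  refine h2.congr_of_eventuallyEq (Eventually.of_forall fun q => ?_)
  simp [tangentMap, mfderiv_snd]
  rfl

theorem mdiff_left (p : M × E) : MDifferentiableAt I₁ (I₁.prod I₂) (fun x => (x, p.2)) p.1 :=
  mdifferentiableAt_id.prodMk mdifferentiableAt_const

theorem mdiff_right (p : M × E) : MDifferentiableAt I₂ (I₁.prod I₂) (fun e => (p.1, e)) p.2 :=
  mdifferentiableAt_const.prodMk mdifferentiableAt_id

/-- A map into a fixed tangent space is differentiable if it is so as a map into `TM`. -/
theorem mdiff_fixed {x : M} {e : E} {v : E → TangentSpace I₁ x}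
    (h : MDifferentiableAt I₂ I₁.tangent (fun y => (⟨x, v y⟩ : TangentBundle I₁ M)) e) :
    MDifferentiableAt I₂ 𝓘(ℝ, V₁) (M' := V₁) v e := by
  have h2 := ((mdifferentiableAt_totalSpace (E := (TangentSpace I₁ : M → Type _)) I₁ _).1 h).2
  refine h2.congr_of_eventuallyEq (Eventually.of_forall fun y => ?_)
  exact ((tangentBundleCore I₁ M).coordChange_self (achart H₁ x) x (mem_chart_source H₁ x)
    (v y)).symm

theorem mvfderiv_slices {g : M × E → ℝ} {p : M × E}
    (hg : MDifferentiableAt (I₁.prod I₂) 𝓘(ℝ, ℝ) g p) (a : V₁) (b : V₂) :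
    mvfderiv (I₁.prod I₂) g p (a, b) =
      mvfderiv I₁ (fun x => g (x, p.2)) p.1 a + mvfderiv I₂ (fun e => g (p.1, e)) p.2 b := by
  exact mfderiv_prod_eq_add_apply (v := (a, b)) hg

section Slices

variable {σ : (q : M × E) → TangentSpace (I₁.prod I₂) q} {p : M × E}

theorem mdiff_slice_fst_left
    (hσ : MDifferentiableAt (I₁.prod I₂) (I₁.prod I₂).tangent
      (fun q => (⟨q, σ q⟩ : TangentBundle (I₁.prod I₂) (M × E))) p) :
    MDifferentiableAt I₁ I₁.tangent
    (fun x => (⟨x, (σ (x, p.2)).1⟩ : TangentBundle I₁ M)) p.1 :=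
  (mdiff_fst_section hσ).comp p.1 (mdiff_left p)

theorem mdiff_slice_fst_right
    (hσ : MDifferentiableAt (I₁.prod I₂) (I₁.prod I₂).tangent
      (fun q => (⟨q, σ q⟩ : TangentBundle (I₁.prod I₂) (M × E))) p) :
    MDifferentiableAt I₂ 𝓘(ℝ, V₁) (M' := V₁)
    (fun e => (σ (p.1, e)).1) p.2 :=
  have h := (mdiff_fst_section hσ).comp p.2 (mdiff_right p)
  mdiff_fixed (x := p.1) (v := fun e => (σ (p.1, e)).1) h

theorem mdiff_slice_snd_right
    (hσ : MDifferentiableAt (I₁.prod I₂) (I₁.prod I₂).tangent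
      (fun q => (⟨q, σ q⟩ : TangentBundle (I₁.prod I₂) (M × E))) p) :
    MDifferentiableAt I₂ I₂.tangent
    (fun e => (⟨e, (σ (p.1, e)).2⟩ : TangentBundle I₂ E)) p.2 :=
  (mdiff_snd_section hσ).comp p.2 (mdiff_right p)

theorem mdiff_slice_snd_left
    (hσ : MDifferentiableAt (I₁.prod I₂) (I₁.prod I₂).tangent
      (fun q => (⟨q, σ q⟩ : TangentBundle (I₁.prod I₂) (M × E))) p) :
    MDifferentiableAt I₁ 𝓘(ℝ, V₂) (M' := V₂)
    (fun x => (σ (x, p.2)).2) p.1 :=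
  have h := (mdiff_snd_section hσ).comp p.1 (mdiff_left p)
  mdiff_fixed (x := p.2) (v := fun x => (σ (x, p.2)).2) h

end Slices

/-- The covariant derivative of the direct sum `Θ ⊕ Γ` of two linear connections: the
`M`-component of a vector field is differentiated by means of `Θ` along `M` and, for a fixed point
of `M`, as a function with values in a fixed vector space along `E`; similarly for the other
component. -/
noncomputable def prodConnectionFun (Θ : LinearConnection I₁ M) (Γ : LinearConnection I₂ E)
    (σ : (p : M × E) → TangentSpace (I₁.prod I₂) p) (p : M × E) :
    TangentSpace (I₁.prod I₂) p →L[ℝ] TangentSpace (I₁.prod I₂) p :=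
  ContinuousLinearMap.prod (M₁ := V₁ × V₂) (M₂ := V₁) (M₃ := V₂)
    (ContinuousLinearMap.coprod (M := V₁) (M₁ := V₁) (M₂ := V₂)
      (Θ (fun x => (σ (x, p.2)).1) p.1) (mvfderiv I₂ (F := V₁) (fun e => (σ (p.1, e)).1) p.2))
    (ContinuousLinearMap.coprod (M := V₂) (M₁ := V₁) (M₂ := V₂)
      (mvfderiv I₁ (F := V₂) (fun x => (σ (x, p.2)).2) p.1) (Γ (fun e => (σ (p.1, e)).2) p.2))

/-- The direct sum `Θ ⊕ Γ` of two linear connections, on the product manifold. -/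
noncomputable def prodConnection (Θ : LinearConnection I₁ M) (Γ : LinearConnection I₂ E) :
    LinearConnection (I₁.prod I₂) (M × E) where
  toFun := prodConnectionFun Θ Γ
  isCovariantDerivativeOnUniv :=
    { add := by
        intro σ σ' p hσ hσ' _
        have a1 := mdiff_slice_fst_left hσ
        have a2 := mdiff_slice_fst_left hσ'
        have b1 := mdiff_slice_fst_right hσ
        have b2 := mdiff_slice_fst_right hσ'
        have c1 := mdiff_slice_snd_right hσ
        have c2 := mdiff_slice_snd_right hσ'
        have d1 := mdiff_slice_snd_left hσ
        have d2 := mdiff_slice_snd_left hσ'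
        have A := Θ.isCovariantDerivativeOnUniv.add a1 a2
        have B := mvfderiv_fun_add (F := V₁) b1 b2
        have C := Γ.isCovariantDerivativeOnUniv.add c1 c2
        have D := mvfderiv_fun_add (F := V₂) d1 d2
        refine ContinuousLinearMap.ext fun v => ?_
        obtain ⟨a, b⟩ : V₁ × V₂ := v
        have A' := congrArg (fun T => T a) A
        have B' := congrArg (fun T => T b) B
        have C' := congrArg (fun T => T b) C
        have D' := congrArg (fun T => T a) D
        refine Prod.ext ?_ ?_
        · refine (congrArg₂ (fun x y : V₁ => x + y) A' B').trans ?_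
          exact add_add_add_comm (G := V₁) _ _ _ _
        · refine (congrArg₂ (fun x y : V₂ => x + y) D' C').trans ?_
          exact add_add_add_comm (G := V₂) _ _ _ _
      leibniz := by
        intro σ g p hσ hg _
        have g1 := hg.comp p.1 (mdiff_left p)
        have g2 := hg.comp p.2 (mdiff_right p)
        have a1 := mdiff_slice_fst_left hσ
        have b1 := mdiff_slice_fst_right hσ
        have c1 := mdiff_slice_snd_right hσ
        have d1 := mdiff_slice_snd_left hσ
        have A := Θ.isCovariantDerivativeOnUniv.leibniz a1 g1
        have B := mvfderiv_fun_smul (F := V₁) g2 b1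
        have C := Γ.isCovariantDerivativeOnUniv.leibniz c1 g2
        have D := mvfderiv_fun_smul (F := V₂) g1 d1
        refine ContinuousLinearMap.ext fun v => ?_
        obtain ⟨a, b⟩ : V₁ × V₂ := v
        have A' := congrArg (fun T => T a) A
        have B' := congrArg (fun T => T b) B
        have C' := congrArg (fun T => T b) C
        have D' := congrArg (fun T => T a) D
        have G := mvfderiv_slices hg a b
        refine Prod.ext ?_ ?_
        · refine (congrArg₂ (fun x y : V₁ => x + y) A' B').trans ?_
          have key (c s t : ℝ) (x y w : V₁) :
              (c • x + s • w) + (c • y + t • w) = c • (x + y) + (s + t) • w := by module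
          refine (key _ _ _ _ _ _).trans ?_
          exact congrArg (fun r : ℝ => (_ : V₁) + r • (_ : V₁)) G.symm
        · refine (congrArg₂ (fun x y : V₂ => x + y) D' C').trans ?_
          have key (c s t : ℝ) (x y w : V₂) :
              (c • x + s • w) + (c • y + t • w) = c • (x + y) + (s + t) • w := by module
          refine (key _ _ _ _ _ _).trans ?_
          exact congrArg (fun r : ℝ => (_ : V₂) + r • (_ : V₂)) G.symm }

variable (I₁ I₂ M E) in
/-- The submanifolds of `M × E` that are images of local sections `x ↦ (x, s x)` of the projection
to `M`; their jets form the jet spaces of that projection. -/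
def sectionClass : Set (Set (M × E)) :=
  {L | ∃ (U : Set M) (s : M → E), IsOpen U ∧ ContMDiffOn I₁ I₂ ∞ s U ∧
    L = (fun x => (x, s x)) '' U}

variable (I₁ I₂ M E) in
/-- Those for which `s` is moreover an immersion. -/
def immersedSectionClass : Set (Set (M × E)) :=
  {L | ∃ (U : Set M) (s : M → E), IsOpen U ∧ ContMDiffOn I₁ I₂ ∞ s U ∧
    (∀ x ∈ U, Function.Injective (mfderiv I₁ I₂ s x)) ∧ L = (fun x => (x, s x)) '' U}

end Product

end GeodesicJets

/-! In a divided chart where the connection has Christoffel form C, the graph of u has vanishing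
second fundamental form at a point exactly when D²u = G(j¹u) there, with G = `geodesicForm C`
(`secondFormVanishes_iff`). The form G is symmetric because the torsion vanishes. The equation is
thus solved for all its second derivatives: S is the image of a section of J² → J¹. That section is
the Grassmannian structure, since horizontality of a field of planes puts the same condition on the
derivative of its slope (`hasCoords_grassmannStructure`). The distribution on J¹ is therefore
spanned by the total derivatives `horLift` of the system D²u = G.

Applying these total derivatives repeatedly expresses every derivative of a solution as a smooth
function of its first order jet; this is `tower`. A point of any prolongation must have tower
coordinates (`eq_tower_of_mem_prolong`), so S^∞ → J¹ is injective. Conversely, tower coordinates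
need not be those of a jet, the mixed derivatives being possibly incompatible, and here
integrability enters. An integral manifold of the distribution projects locally diffeomorphically to
the base variable, so it is the first order jet of a map u, whose graph is totally geodesic at all
nearby points; all its jets lie in the prolongations (`exists_geodesic_submanifold`,
`mem_prolong_of_eventually`). Hence S^∞ → J¹ is bijective. As the tower is smooth, pull-back of
functions is an isomorphism of algebras (`bijective_pullInf`); the same holds for S → J¹ without
integrability (`bijective_pullEquation`).

Vector fields are derivations, so these isomorphisms induce Φ and Ψ. It remains to match the
distributions. A tangent vector of S^∞ is determined by its push-forward to J¹, and the derivative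
of the tower carries total derivatives to total derivatives; so the vector is in the Cartan
distribution exactly when its push-forward lies in the distribution on J¹ (`mem_infCartan_iff`). The
analogue for S is `mem_equationCartan_iff`. Symmetries, trivial symmetries and quotients are then
transported formally, and trivial fields are symmetries by the easy half of Frobenius' theorem
(`IsIntegrable.lie_mem`).

The three situations are treated at once, for a class of submanifolds satisfying `IsOpenClass`. Two
points need care. Jets are classes of a generated equivalence relation, so coordinates are well
defined only after the change of charts has been computed on jets (`exists_isGraphAt_of_mk_eq`, for
order at least one). Smooth functions are global on the jet space, so coordinate functions are
available only after a cutoff (`exists_cutoff`), which must control both the base point and the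
slope. -/

namespace GeodesicJets

/-! ### Transport of distributions along an isomorphism of function algebras -/

section Transport

variable {Z P : Type*} {O : Subalgebra ℝ (Z → ℝ)} {O' : Subalgebra ℝ (P → ℝ)}

/-- Transport of a derivation along an isomorphism of algebras. -/
def transportField (ε : O ≃ₐ[ℝ] O') (X : VField O') : VField O :=
  Derivation.mk' (ε.symm.toLinearMap ∘ₗ X.toLinearMap ∘ₗ ε.toLinearMap) fun a b => by
    simp

@[simp] theorem transportField_apply (ε : O ≃ₐ[ℝ] O') (X : VField O') (f : O) :
    transportField ε X f = ε.symm (X (ε f)) := rfl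

/-- The isomorphism of the Lie algebras of vector fields induced by an isomorphism of the algebras
of functions. -/
def transport (ε : O ≃ₐ[ℝ] O') : VField O' ≃ₗ⁅ℝ⁆ VField O where
  toFun := transportField ε
  map_add' X Y := Derivation.ext fun f => map_add ε.symm (X (ε f)) (Y (ε f))
  map_smul' c X := Derivation.ext fun f => map_smul ε.symm c (X (ε f))
  map_lie' {X Y} := Derivation.ext fun f => by
    simp only [Derivation.commutator_apply, transportField_apply, map_sub,
      AlgEquiv.apply_symm_apply]
  invFun := transportField ε.symm
  left_inv X := Derivation.ext fun f => by
    simp only [transportField_apply, AlgEquiv.symm_symm, AlgEquiv.apply_symm_apply]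
  right_inv X := Derivation.ext fun f => by
    simp only [transportField_apply, AlgEquiv.symm_symm, AlgEquiv.symm_apply_apply]

@[simp] theorem transport_apply (ε : O ≃ₐ[ℝ] O') (X : VField O') (f : O) :
    transport ε X f = ε.symm (X (ε f)) := rfl

theorem mem_fieldsIn {D : Distribution O} {X : VField O} :
    X ∈ fieldsIn D ↔ ∀ z, (valueAt O z X).1 ∈ D z := Iff.rfl

theorem mem_symmetries {D : Distribution O} {X : VField O} :
    X ∈ symmetries D ↔ ∀ Y ∈ fieldsIn D, ⁅X, Y⁆ ∈ fieldsIn D := Iff.rfl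

variable {ε : O ≃ₐ[ℝ] O'} {π : P → Z} {D : Distribution O} {D' : Distribution O'}

/-- The value of `X` at `p`, composed with `ε`, is the value of the transported field at `π p`; so
`hD` compares the two conditions point by point, and surjectivity of `π` reaches every point of `Z`.
-/
theorem transport_mem_fieldsIn (hε : ∀ f p, (ε f).1 p = f.1 (π p)) (hπ : Function.Surjective π)
    (hD : ∀ p d, d ∈ D' p ↔ d ∘ₗ ε.toLinearMap ∈ D (π p)) (X : VField O') :
    X ∈ fieldsIn D' ↔ transport ε X ∈ fieldsIn D := by
  have key : ∀ p, (valueAt O' p X).1 ∘ₗ ε.toLinearMap = (valueAt O (π p) (transport ε X)).1 := by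
    intro p
    ext f
    have := hε (ε.symm (X (ε f))) p
    simpa [valueAt] using this
  simp only [mem_fieldsIn, hD, key]
  exact (hπ.forall (p := fun z => (valueAt O z (transport ε X)).1 ∈ D z)).symm

/-- Transport is a bijection that preserves brackets and matches the fields lying in the two
distributions, and symmetries are defined by these data alone. -/
theorem transport_mem_symmetries (hε : ∀ f p, (ε f).1 p = f.1 (π p))
    (hπ : Function.Surjective π)
    (hD : ∀ p d, d ∈ D' p ↔ d ∘ₗ ε.toLinearMap ∈ D (π p)) (X : VField O') :
    X ∈ symmetries D' ↔ transport ε X ∈ symmetries D := by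
  simp only [mem_symmetries]
  constructor
  · intro h Y hY
    obtain ⟨Y', rfl⟩ := (transport ε).surjective Y
    have := h Y' ((transport_mem_fieldsIn hε hπ hD _).2 hY)
    have h1 := (transport_mem_fieldsIn hε hπ hD _).1 this
    rwa [LieEquiv.map_lie] at h1
  · intro h Y hY
    have := h _ ((transport_mem_fieldsIn hε hπ hD _).1 hY)
    rw [← LieEquiv.map_lie] at this
    exact (transport_mem_fieldsIn hε hπ hD _).2 this

theorem quotientProj_eq_iff {X Y : VField O} :
    quotientProj D X = quotientProj D Y ↔ X - Y ∈ fieldsIn D := by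
  rw [mem_fieldsIn, funext_iff]
  exact forall_congr' fun z => Submodule.Quotient.eq _

/-- First isomorphism theorem, in a form that asks only that the fibres of `q` be the cosets of `J`.
-/
theorem exists_lieQuotient_equiv {L Y : Type*} [LieRing L] [LieAlgebra ℝ L] [AddCommMonoid Y]
    [Module ℝ Y] (J : LieIdeal ℝ L) (q : L → Y) (hadd : ∀ x y, q (x + y) = q x + q y)
    (hsmul : ∀ (c : ℝ) x, q (c • x) = c • q x) (hq : Function.Surjective q)
    (hJ : ∀ x y, q x = q y ↔ x - y ∈ J) :
    ∃ e : (L ⧸ J) ≃ₗ[ℝ] Y, ∀ x, e (LieSubmodule.Quotient.mk x) = q x := by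
  -- Defined on chosen representatives; `hf` is the independence of the choice.
  let f : (L ⧸ J) → Y := fun z => q (Quotient.out z)
  have hf (x : L) : f (LieSubmodule.Quotient.mk x) = q x := by
    rw [hJ]
    have : (LieSubmodule.Quotient.mk (Quotient.out (LieSubmodule.Quotient.mk x : L ⧸ J)) : L ⧸ J) =
      LieSubmodule.Quotient.mk x := Quotient.out_eq _
    exact (Submodule.Quotient.eq J.toSubmodule).1 this
  have hmk (z : L ⧸ J) : ∃ x : L, LieSubmodule.Quotient.mk x = z :=
    ⟨Quotient.out z, Quotient.out_eq _⟩
  let g : (L ⧸ J) →ₗ[ℝ] Y :=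
    { toFun := f
      map_add' := fun z w => by
        obtain ⟨x, rfl⟩ := hmk z
        obtain ⟨y, rfl⟩ := hmk w
        rw [hf, hf, ← hadd]
        exact hf (x + y)
      map_smul' := fun c z => by
        obtain ⟨x, rfl⟩ := hmk z
        rw [hf, RingHom.id_apply, ← hsmul]
        exact hf (c • x) }
  have hg : Function.Bijective g := by
    refine ⟨fun z w h => ?_, fun y => ?_⟩
    · obtain ⟨x, rfl⟩ := hmk z
      obtain ⟨y, rfl⟩ := hmk w
      have h' : q x = q y := by rw [← hf, ← hf]; exact h
      exact (Submodule.Quotient.eq J.toSubmodule).2 ((hJ x y).1 h')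
    · obtain ⟨x, rfl⟩ := hq y
      exact ⟨LieSubmodule.Quotient.mk x, hf x⟩
  exact ⟨LinearEquiv.ofBijective g hg, hf⟩

variable (D) in
/-- A vector field preserving a distribution, as a section of the quotient bundle. -/
noncomputable def transportProj (hε : ∀ f p, (ε f).1 p = f.1 (π p))
    (hπ : Function.Surjective π)
    (hD : ∀ p d, d ∈ D' p ↔ d ∘ₗ ε.toLinearMap ∈ D (π p)) :
    symmetries D' →ₗ[ℝ] (symmetries D).toSubmodule.map (quotientProj D) :=
  LinearMap.codRestrict _
    ((quotientProj D ∘ₗ (transport ε).toLinearEquiv.toLinearMap) ∘ₗ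
      (symmetries D').toSubmodule.subtype)
    fun X => Submodule.mem_map_of_mem ((transport_mem_symmetries hε hπ hD X.1).1 X.2)

/-- Non-trivial symmetries as sections of the quotient bundle. -/
theorem exists_nontrivialSymmetries_equiv (hε : ∀ f p, (ε f).1 p = f.1 (π p))
    (hπ : Function.Surjective π)
    (hD : ∀ p d, d ∈ D' p ↔ d ∘ₗ ε.toLinearMap ∈ D (π p)) :
    ∃ e : NontrivialSymmetries D' ≃ₗ[ℝ] (symmetries D).toSubmodule.map (quotientProj D),
      ∀ X : symmetries D',
        (e (LieSubmodule.Quotient.mk X)).1 = quotientProj D (transport ε X.1) := by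
  have hsurj : Function.Surjective (transportProj D hε hπ hD) := by
    rintro ⟨_, Y, hY, rfl⟩
    obtain ⟨X, rfl⟩ := (transport ε).surjective Y
    exact ⟨⟨X, (transport_mem_symmetries hε hπ hD X).2 hY⟩, rfl⟩
  have hker (X Y) : transportProj D hε hπ hD X = transportProj D hε hπ hD Y ↔
      X - Y ∈ trivialIdeal D' := by
    rw [Subtype.ext_iff]
    refine Iff.trans ?_ (transport_mem_fieldsIn hε hπ hD (X - Y).1).symm
    have : transport ε (X - Y).1 = transport ε X.1 - transport ε Y.1 :=
      Derivation.ext fun f => map_sub ε.symm (X.1 (ε f)) (Y.1 (ε f))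
    rw [this]
    exact quotientProj_eq_iff
  obtain ⟨e, he⟩ := exists_lieQuotient_equiv (trivialIdeal D') _
    (map_add (transportProj D hε hπ hD)) (map_smul (transportProj D hε hπ hD)) hsurj hker
  exact ⟨e, fun X => congrArg Subtype.val (he X)⟩

end Transport

end GeodesicJets

namespace GeodesicJets

/-! ### Involutivity of integrable distributions -/

section Involutive

variable {Z : Type*} {V : Type*} [NormedAddCommGroup V] [NormedSpace ℝ V]
  [FiniteDimensional ℝ V] {O : Subalgebra ℝ (Z → ℝ)}

/-- Functions whose differentials along a piece of integral manifold form a coframe. -/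
theorem exists_coframe {j : V → Z}
    (hd : ∀ f : O, DifferentiableAt ℝ (fun x => f.1 (j x)) 0)
    (hinj : ∀ v : V, (∀ f : O, fderiv ℝ (fun y => f.1 (j y)) 0 v = 0) → v = 0)
    (e : V →L[ℝ] ℝ) : ∃ f : O, fderiv ℝ (fun y => f.1 (j y)) 0 = e := by
  -- `ρ` takes the differential at `0`. No nonzero vector is annihilated by its range, which in
  -- finite dimension is therefore the whole dual.
  let ρ : O →ₗ[ℝ] Module.Dual ℝ V :=
    { toFun := fun f => (fderiv ℝ (fun y => f.1 (j y)) 0).toLinearMap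
      map_add' := fun f g => by
        have := fderiv_add (hd f) (hd g)
        exact congrArg ContinuousLinearMap.toLinearMap this
      map_smul' := fun c f => by
        have := fderiv_const_smul (hd f) c
        exact congrArg ContinuousLinearMap.toLinearMap this }
  have h1 : (LinearMap.range ρ).dualCoannihilator = ⊥ := by
    rw [eq_bot_iff]
    intro v hv
    rw [Submodule.mem_dualCoannihilator] at hv
    exact hinj v fun f => hv _ ⟨f, rfl⟩
  have h2 : LinearMap.range ρ = ⊤ := by
    rw [← Subspace.dualCoannihilator_dualAnnihilator_eq (W := LinearMap.range ρ), h1,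
      Submodule.dualAnnihilator_bot]
  obtain ⟨f, hf⟩ := LinearMap.range_eq_top.1 h2 e.toLinearMap
  exact ⟨f, ContinuousLinearMap.coe_injective hf⟩

/-- A vector field tangent to a piece of integral manifold restricts to a differentiable vector
field. -/
theorem differentiableAt_restriction {j : V → Z} {U : Set V} (hU : IsOpen U) (h0 : (0 : V) ∈ U)
    (hj : ∀ f : O, ContDiffOn ℝ ∞ (fun x => f.1 (j x)) U)
    (hinj : ∀ v : V, (∀ f : O, fderiv ℝ (fun y => f.1 (j y)) 0 v = 0) → v = 0)
    (X : VField O) (ξ : V → V)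
    (hξ : ∀ x ∈ U, ∀ f : O, (X f).1 (j x) = fderiv ℝ (fun y => f.1 (j y)) x (ξ x)) :
    DifferentiableAt ℝ ξ 0 := by
  have hd (f : O) : ContDiffAt ℝ ∞ (fun x => f.1 (j x)) 0 := (hj f).contDiffAt (hU.mem_nhds h0)
  let B : V ≃L[ℝ] (Fin (Module.finrank ℝ V) → ℝ) := (Module.finBasis ℝ V).equivFunL
  -- The differentials of the `f i` at `0` are the coordinate forms of a basis. So `h` has an
  -- invertible derivative near `0`, and `ξ` is recovered there as the inverse of `Dh` applied to
  -- the functions `X (f i)` along `j`.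
  choose f hf using fun i => exists_coframe
    (fun f => (hd f).differentiableAt (by simp)) hinj
    ((ContinuousLinearMap.proj i).comp (B : V →L[ℝ] (Fin (Module.finrank ℝ V) → ℝ)))
  let h : V → Fin (Module.finrank ℝ V) → ℝ := fun y i => (f i).1 (j y)
  have hA (x : V) (hx : x ∈ U) (v : V) (i) : fderiv ℝ h x v i =
      fderiv ℝ (fun y => (f i).1 (j y)) x v := by
    have := fderiv_pi (𝕜 := ℝ) (φ := fun i y => (f i).1 (j y)) (x := x) fun i =>
      (((hj (f i)).contDiffAt (hU.mem_nhds hx)).differentiableAt (by simp))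
    exact congrArg (fun l => l v i) this
  have hA0 : fderiv ℝ h 0 = B := by
    ext v i
    rw [hA 0 h0, hf]
    rfl
  have hA' : DifferentiableAt ℝ (fderiv ℝ h) 0 :=
    ((contDiffAt_pi.2 fun i => hd (f i)).fderiv_right (m := 1)
      (by norm_cast)).differentiableAt one_ne_zero
  have hh : DifferentiableAt ℝ (fun x i => (X (f i)).1 (j x)) 0 :=
    differentiableAt_pi.2 fun i => (hd (X (f i))).differentiableAt (by simp)
  have hinv : DifferentiableAt ℝ (fun x => (fderiv ℝ h x).inverse) 0 := by
    have h2 : DifferentiableAt ℝ ContinuousLinearMap.inverse (fderiv ℝ h 0) := by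
      rw [hA0]
      exact (contDiffAt_map_inverse (n := 1) B).differentiableAt one_ne_zero
    exact h2.comp _ hA'
  have hev : ∀ᶠ x in 𝓝 (0 : V), fderiv ℝ h x ∈
      range (fun e : V ≃L[ℝ] (Fin (Module.finrank ℝ V) → ℝ) => (e : V →L[ℝ] _)) := by
    refine hA'.continuousAt.eventually_mem ?_
    rw [hA0]
    exact ContinuousLinearEquiv.nhds B
  refine (hinv.clm_apply hh).congr_of_eventuallyEq ?_
  filter_upwards [hev, hU.mem_nhds h0] with x ⟨e, he⟩ hx
  have : (fun i => (X (f i)).1 (j x)) = fderiv ℝ h x (ξ x) :=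
    funext fun i => (hξ x hx (f i)).trans (hA x hx _ i).symm
  rw [this, ← he]
  simp

/-- The vector fields lying in an integrable distribution form a Lie algebra. -/
theorem IsIntegrable.lie_mem {D : Distribution O} (hD : IsIntegrable V D) {X Y : VField O}
    (hX : X ∈ fieldsIn D) (hY : Y ∈ fieldsIn D) : ⁅X, Y⁆ ∈ fieldsIn D := by
  intro z
  obtain ⟨j, U, hU, h0, rfl, hj, hT⟩ := hD z
  obtain ⟨T, hT0⟩ := hT 0 h0
  have hinj (v : V) (hv : ∀ f : O, fderiv ℝ (fun y => f.1 (j y)) 0 v = 0) : v = 0 := by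
    have : T v = 0 := by
      ext f
      rw [hT0, hv]
      rfl
    simpa using this
  have hd (f : O) : ContDiffAt ℝ ∞ (fun x => f.1 (j x)) 0 := (hj f).contDiffAt (hU.mem_nhds h0)
  have key (X : VField O) (hX : X ∈ fieldsIn D) (x : V) (hx : x ∈ U) :
      ∃ v, ∀ f : O, (X f).1 (j x) = fderiv ℝ (fun y => f.1 (j y)) x v := by
    obtain ⟨T, hT⟩ := hT x hx
    refine ⟨T.symm ⟨(valueAt O (j x) X).1, hX (j x)⟩, fun f => ?_⟩
    rw [← hT, LinearEquiv.apply_symm_apply]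
    rfl
  choose! ξ kξ using key X hX
  choose! η kη using key Y hY
  have hξ := differentiableAt_restriction hU h0 hj hinj X ξ kξ
  have hη := differentiableAt_restriction hU h0 hj hinj Y η kη
  have comp (X Y : VField O) (ξ η : V → V)
      (kX : ∀ x ∈ U, ∀ f : O, (X f).1 (j x) = fderiv ℝ (fun y => f.1 (j y)) x (ξ x))
      (kY : ∀ x ∈ U, ∀ f : O, (Y f).1 (j x) = fderiv ℝ (fun y => f.1 (j y)) x (η x))
      (hη : DifferentiableAt ℝ η 0) (f : O) :
      (X (Y f)).1 (j 0) = fderiv ℝ (fderiv ℝ (fun y => f.1 (j y))) 0 (ξ 0) (η 0) +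
        fderiv ℝ (fun y => f.1 (j y)) 0 (fderiv ℝ η 0 (ξ 0)) := by
    rw [kX 0 h0]
    have : (fun y => (Y f).1 (j y)) =ᶠ[𝓝 0] fun x => fderiv ℝ (fun y => f.1 (j y)) x (η x) := by
      filter_upwards [hU.mem_nhds h0] with x hx using kY x hx f
    rw [this.fderiv_eq, fderiv_clm_apply
      (((hd f).fderiv_right (m := 1) (by norm_cast)).differentiableAt one_ne_zero) hη]
    simp [add_comm]
  -- Along the leaf `X` and `Y` are images of `ξ` and `η`. In the commutator the second derivatives
  -- of `f ∘ j` cancel by symmetry, and the image of the bracket of `ξ` and `η` is left.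
  have hres : (valueAt O (j 0) ⁅X, Y⁆).1 =
      (T (fderiv ℝ η 0 (ξ 0) - fderiv ℝ ξ 0 (η 0))).1 := by
    ext f
    rw [hT0, map_sub]
    have e : (valueAt O (j 0) ⁅X, Y⁆).1 f = (X (Y f)).1 (j 0) - (Y (X f)).1 (j 0) := by
      change ((⁅X, Y⁆ : VField O) f).1 (j 0) = _
      rw [Derivation.commutator_apply]
      rfl
    rw [e, comp X Y ξ η kξ kη hη, comp Y X η ξ kη kξ hξ]
    have hsymm : IsSymmSndFDerivAt ℝ (fun y => f.1 (j y)) 0 :=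
      (hd f).isSymmSndFDerivAt (by
        rw [minSmoothness_of_isRCLikeNormedField]
        exact WithTop.coe_le_coe.2 (le_top (a := (2 : ℕ∞))))
    rw [hsymm.eq (ξ 0) (η 0)]
    ring
  rw [hres]
  exact (T _).2

end Involutive

end GeodesicJets

namespace GeodesicJets

/-! ### Jet coordinates and total derivatives -/

section JetCalculus

variable {V W : Type*} [NormedAddCommGroup V] [NormedSpace ℝ V]
  [NormedAddCommGroup W] [NormedSpace ℝ W]

/-- The `r`-jet of `u` at `x`. -/
noncomputable def jet (r : ℕ) (u : V → W) (x : V) : JetCoords V W r :=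
  (x, fun k => iteratedFDeriv ℝ (k : ℕ) u x)

/-- Currying of the first argument of a multilinear map. -/
noncomputable def curryL (V W : Type*) [NormedAddCommGroup V] [NormedSpace ℝ V]
    [NormedAddCommGroup W] [NormedSpace ℝ W] (k : ℕ) :
    ContinuousMultilinearMap ℝ (fun _ : Fin (k + 1) => V) W ≃L[ℝ]
      (V →L[ℝ] ContinuousMultilinearMap ℝ (fun _ : Fin k => V) W) :=
  (continuousMultilinearCurryLeftEquiv ℝ (fun _ : Fin (k + 1) => V) W).toContinuousLinearEquiv

/-- The derivative of order `k`. -/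
noncomputable def compJ {r : ℕ} (k : ℕ) (h : k < r + 1) :
    JetCoords V W r →L[ℝ] ContinuousMultilinearMap ℝ (fun _ : Fin k => V) W :=
  (ContinuousLinearMap.proj (R := ℝ)
    (φ := fun k : Fin (r + 1) => ContinuousMultilinearMap ℝ (fun _ : Fin (k : ℕ) => V) W)
    ⟨k, h⟩).comp (ContinuousLinearMap.snd ℝ V _)

/-- Truncation of jets. -/
noncomputable def truncJ {k r : ℕ} (h : k ≤ r) : JetCoords V W r →L[ℝ] JetCoords V W k :=
  (ContinuousLinearMap.fst ℝ V _).prod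
    (ContinuousLinearMap.pi fun i : Fin (k + 1) => compJ (i : ℕ) (by omega))

/-- The derivative of a jet `x ↦ j^r u(x)`, as a function of the jet of order `r + 1`. -/
noncomputable def hor {r : ℕ} (c : JetCoords V W (r + 1)) : V →L[ℝ] JetCoords V W r :=
  (ContinuousLinearMap.id ℝ V).prod
    (ContinuousLinearMap.pi fun k : Fin (r + 1) => curryL V W k (compJ ((k : ℕ) + 1) (by omega) c))

/-- The value. -/
noncomputable def val0 {r : ℕ} : JetCoords V W r →L[ℝ] W :=
  (continuousMultilinearCurryFin0 ℝ V W).toContinuousLinearEquiv.toContinuousLinearMap.comp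
    (compJ 0 (by omega))

/-- The point of the graph. -/
noncomputable def ptJ {r : ℕ} : JetCoords V W r →L[ℝ] V × W :=
  (ContinuousLinearMap.fst ℝ V _).prod val0

/-- The first derivative. -/
noncomputable def lin {r : ℕ} (h : 1 ≤ r) : JetCoords V W r →L[ℝ] (V →L[ℝ] W) :=
  (continuousMultilinearCurryFin1 ℝ V W).toContinuousLinearEquiv.toContinuousLinearMap.comp
    (compJ 1 (by omega))

/-- The bilinear map corresponding to a multilinear map of two arguments. -/
noncomputable def bilin (V W : Type*) [NormedAddCommGroup V] [NormedSpace ℝ V]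
    [NormedAddCommGroup W] [NormedSpace ℝ W] :
    ContinuousMultilinearMap ℝ (fun _ : Fin 2 => V) W ≃L[ℝ] (V →L[ℝ] V →L[ℝ] W) :=
  (curryL V W 1).trans (ContinuousLinearEquiv.arrowCongr (.refl ℝ V)
    (continuousMultilinearCurryFin1 ℝ V W).toContinuousLinearEquiv)

/-- The jet of order one with given value and derivative. -/
noncomputable def mkJ1 : (V × W) × (V →L[ℝ] W) →L[ℝ] JetCoords V W 1 :=
  ((ContinuousLinearMap.fst ℝ V W).comp (ContinuousLinearMap.fst ℝ _ _)).prod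
    (ContinuousLinearMap.pi fun i : Fin 2 => match i with
      | ⟨0, _⟩ => (continuousMultilinearCurryFin0 ℝ V
          W).symm.toContinuousLinearEquiv.toContinuousLinearMap.comp
            ((ContinuousLinearMap.snd ℝ V W).comp (ContinuousLinearMap.fst ℝ _ _))
      | ⟨1, _⟩ => (continuousMultilinearCurryFin1 ℝ V
          W).symm.toContinuousLinearEquiv.toContinuousLinearMap.comp
            (ContinuousLinearMap.snd ℝ _ _))

variable {r : ℕ} {u : V → W} {x : V}

theorem jetC_ext {c c' : JetCoords V W r} (h0 : c.1 = c'.1)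
    (h : ∀ k (hk : k < r + 1), compJ k hk c = compJ k hk c') : c = c' :=
  Prod.ext h0 (funext fun k => h k k.2)

@[simp] theorem compJ_jet (k : ℕ) (h : k < r + 1) :
    compJ k h (jet r u x) = iteratedFDeriv ℝ k u x := rfl

@[simp] theorem truncJ_jet {k : ℕ} (h : k ≤ r) : truncJ h (jet r u x) = jet k u x := rfl

@[simp] theorem truncJ_truncJ {k l : ℕ} (h : k ≤ r) (hl : l ≤ k) (c : JetCoords V W r) :
    truncJ hl (truncJ h c) = truncJ (hl.trans h) c := rfl

@[simp] theorem truncJ_self (c : JetCoords V W r) : truncJ le_rfl c = c := rfl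

@[simp] theorem ptJ_jet : ptJ (jet r u x) = (x, u x) := rfl

@[simp] theorem fst_ptJ (c : JetCoords V W r) : (ptJ c).1 = c.1 := rfl

@[simp] theorem snd_ptJ (c : JetCoords V W r) : (ptJ c).2 = val0 c := rfl

@[simp] theorem lin_jet (h : 1 ≤ r) : lin h (jet r u x) = fderiv ℝ u x := by
  ext v
  simp [lin, iteratedFDeriv_one_apply]

theorem bilin_iteratedFDeriv (v w : V) :
    bilin V W (iteratedFDeriv ℝ 2 u x) v w = fderiv ℝ (fderiv ℝ u) x v w := by
  simp [bilin, curryL, iteratedFDeriv_two_apply]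

@[simp] theorem compJ_hor (c : JetCoords V W (r + 1)) (v : V) (k : ℕ) (h : k < r + 1) :
    compJ k h (hor c v) = curryL V W k (compJ (k + 1) (by omega) c) v := rfl

theorem truncJ_hor {k : ℕ} (h : k ≤ r) (c : JetCoords V W (r + 1)) (v : V) :
    truncJ h (hor c v) = hor (truncJ (Nat.succ_le_succ h) c) v := rfl

theorem lin_hor (h : 1 ≤ r) (c : JetCoords V W (r + 1)) (v : V) :
    lin h (hor c v) = bilin V W (compJ 2 (by omega) c) v := rfl

@[simp] theorem ptJ_mkJ1 (z : V × W) (P : V →L[ℝ] W) : ptJ (mkJ1 (z, P)) = z := rfl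

@[simp] theorem lin_mkJ1 (z : V × W) (P : V →L[ℝ] W) : lin le_rfl (mkJ1 (z, P)) = P :=
  (continuousMultilinearCurryFin1 ℝ V W).apply_symm_apply P

theorem jetC1_ext {c c' : JetCoords V W 1} (h0 : ptJ c = ptJ c') (h1 : lin le_rfl c = lin le_rfl c') :
    c = c' := by
  refine jetC_ext (show (ptJ c).1 = (ptJ c').1 by rw [h0]) fun k hk => ?_
  interval_cases k
  · exact (continuousMultilinearCurryFin0 ℝ V W).injective (congrArg Prod.snd h0)
  · exact (continuousMultilinearCurryFin1 ℝ V W).injective h1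

theorem mkJ1_ptJ_lin (c : JetCoords V W 1) : mkJ1 (ptJ c, lin le_rfl c) = c :=
  jetC1_ext (ptJ_mkJ1 _ _) (lin_mkJ1 _ _)

/-- Smoothness of a map into `V →L[ℝ] _` is tested vector by vector, which is where `V` has to be
finite-dimensional. -/
theorem contDiff_hor [FiniteDimensional ℝ V] {n : ℕ∞ω} :
    ContDiff ℝ n (fun c : JetCoords V W (r + 1) => hor c) := by
  refine contDiff_clm_apply_iff.2 fun v => ?_
  refine ContDiff.prodMk contDiff_const (contDiff_pi.2 fun k => ?_)
  exact (((curryL V W k).contDiff.comp (compJ (r := r + 1) ((k : ℕ) + 1) (by omega)).contDiff)).clm_apply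
    contDiff_const

theorem contDiff_ptJ {n : ℕ∞ω} : ContDiff ℝ n fun c : JetCoords V W r => ptJ c :=
  ContinuousLinearMap.contDiff _

theorem contDiff_truncJ {n : ℕ∞ω} {k : ℕ} (h : k ≤ r) :
    ContDiff ℝ n fun c : JetCoords V W r => truncJ h c :=
  ContinuousLinearMap.contDiff _

theorem contDiff_lin {n : ℕ∞ω} (h : 1 ≤ r) : ContDiff ℝ n fun c : JetCoords V W r => lin h c :=
  ContinuousLinearMap.contDiff _

theorem contDiff_compJ {n : ℕ∞ω} {k : ℕ} (h : k < r + 1) :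
    ContDiff ℝ n fun c : JetCoords V W r => compJ k h c :=
  ContinuousLinearMap.contDiff _

theorem contDiff_mkJ1 {n : ℕ∞ω} :
    ContDiff ℝ n fun c : (V × W) × (V →L[ℝ] W) => (mkJ1 c : JetCoords V W 1) :=
  ContinuousLinearMap.contDiff _

theorem contDiff_curryL_symm {n : ℕ∞ω} {k : ℕ} :
    ContDiff ℝ n fun c : V →L[ℝ] ContinuousMultilinearMap ℝ (fun _ : Fin k => V) W =>
      (curryL V W k).symm c :=
  ContinuousLinearEquiv.contDiff _

theorem contDiffAt_iteratedFDeriv (hu : ContDiffAt ℝ ∞ u x) (k : ℕ) :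
    ContDiffAt ℝ ∞ (iteratedFDeriv ℝ k u) x :=
  hu.iteratedFDeriv_right (m := ∞) (by norm_cast)

theorem contDiffAt_jet (hu : ContDiffAt ℝ ∞ u x) (r : ℕ) : ContDiffAt ℝ ∞ (jet r u) x :=
  contDiffAt_id.prodMk (contDiffAt_pi.2 fun k => contDiffAt_iteratedFDeriv hu k)

/-- The iterated derivative of order `k + 1` is the derivative of the one of order `k`, uncurried;
`hor` undoes this uncurrying in every order. -/
theorem hasFDerivAt_jet (hu : ContDiffAt ℝ ∞ u x) (r : ℕ) :
    HasFDerivAt (jet r u) (hor (jet (r + 1) u x)) x := by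
  refine (hasFDerivAt_id x).prodMk (hasFDerivAt_pi.2 fun k => ?_)
  exact ((contDiffAt_iteratedFDeriv hu k).differentiableAt (by simp)).hasFDerivAt

theorem jet_congr {u' : V → W} (h : u =ᶠ[𝓝 x] u') (r : ℕ) : jet r u x = jet r u' x :=
  Prod.ext rfl (funext fun k => (h.iteratedFDeriv ℝ k).eq_of_nhds)

end JetCalculus

end GeodesicJets

namespace GeodesicJets

/-! ### Action of a map of `V × W` on the jets of graphs -/

section JetChange

variable {V W : Type*} [NormedAddCommGroup V] [NormedSpace ℝ V]
  [NormedAddCommGroup W] [NormedSpace ℝ W]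

/-- The derivative at a jet of `x ↦ τ (x, u x)`. -/
noncomputable def graphDeriv (τ : V × W → V × W) (c : JetCoords V W 1) : V →L[ℝ] V × W :=
  (fderiv ℝ τ (ptJ c)).comp ((ContinuousLinearMap.id ℝ V).prod (lin le_rfl c))

/-- The derivative at a jet of `x ↦ (τ (x, u x)).1`. -/
noncomputable def baseDeriv (τ : V × W → V × W) (c : JetCoords V W 1) : V →L[ℝ] V :=
  (ContinuousLinearMap.fst ℝ V W).comp (graphDeriv τ c)

/-- The derivative of order `k` of the map whose graph is the image under `τ` of the graph of `u`,
in terms of the jet of `u`. -/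
noncomputable def jetChange (τ : V × W → V × W) : (k : ℕ) → JetCoords V W k →
    ContinuousMultilinearMap ℝ (fun _ : Fin k => V) W
  | 0 => fun c => (continuousMultilinearCurryFin0 ℝ V W).symm (τ (ptJ c)).2
  -- Differentiating the formula of order `k` along the graph yields `D(Dᵏu) ∘ Da`, where `a` is the
  -- base component of the image of the graph; the factor `(Da)⁻¹` isolates the derivative of order
  -- `k + 1`.
  | k + 1 => fun c => (curryL V W k).symm (((fderiv ℝ (jetChange τ k) (truncJ k.le_succ c)).comp
      (hor c)).comp (baseDeriv τ (truncJ (Nat.succ_le_succ k.zero_le) c)).inverse)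

/-- The map of jet coordinates induced by `τ`. -/
noncomputable def jetMap (τ : V × W → V × W) (r : ℕ) (c : JetCoords V W r) : JetCoords V W r :=
  ((τ (ptJ c)).1, fun k => jetChange τ k (truncJ (Nat.lt_succ_iff.1 k.2) c))

/-- The jets whose images under `τ` are jets of maps. -/
def changeDomain (τ : V × W → V × W) (Ω : Set (V × W)) (k : ℕ) : Set (JetCoords V W k) :=
  -- A jet of order `0` carries no derivative to test, so the second condition is void for `k = 0`.
  {c | ptJ c ∈ Ω ∧ ∀ h : 1 ≤ k, (baseDeriv τ (truncJ h c)).IsInvertible}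

variable {τ : V × W → V × W} {Ω : Set (V × W)}

theorem truncJ_mem_changeDomain {k r : ℕ} (h : k ≤ r) {c : JetCoords V W r}
    (hc : c ∈ changeDomain τ Ω r) : truncJ h c ∈ changeDomain τ Ω k :=
  ⟨hc.1, fun h1 => hc.2 (h1.trans h)⟩

theorem contDiffAt_graphDeriv [FiniteDimensional ℝ V] (hΩ : IsOpen Ω) (hτ : ContDiffOn ℝ ∞ τ Ω)
    {c : JetCoords V W 1} (hc : ptJ c ∈ Ω) : ContDiffAt ℝ ∞ (graphDeriv τ) c := by
  have h1 : ContDiffAt ℝ ∞ (fun c : JetCoords V W 1 => fderiv ℝ τ (ptJ c)) c := by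
    have h2 : ContDiffAt ℝ ∞ (fderiv ℝ τ) (ptJ c) :=
      ((hτ.contDiffAt (hΩ.mem_nhds hc)).fderiv_right (m := ∞) (by norm_cast))
    exact h2.comp c contDiff_ptJ.contDiffAt
  refine h1.clm_comp ?_
  have h3 : ContDiff ℝ ∞ (fun c : JetCoords V W 1 =>
      (ContinuousLinearMap.id ℝ V).prod (lin le_rfl c)) := by
    refine contDiff_clm_apply_iff.2 fun v => contDiff_const.prodMk ?_
    exact (contDiff_lin le_rfl).clm_apply contDiff_const
  exact h3.contDiffAt

theorem contDiffAt_baseDeriv [FiniteDimensional ℝ V] (hΩ : IsOpen Ω) (hτ : ContDiffOn ℝ ∞ τ Ω)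
    {c : JetCoords V W 1} (hc : ptJ c ∈ Ω) : ContDiffAt ℝ ∞ (baseDeriv τ) c :=
  contDiffAt_const.clm_comp (contDiffAt_graphDeriv hΩ hτ hc)

theorem isOpen_isInvertible {X Y : Type*} [NormedAddCommGroup X] [NormedSpace ℝ X]
    [CompleteSpace X] [NormedAddCommGroup Y] [NormedSpace ℝ Y] :
    IsOpen {A : X →L[ℝ] Y | A.IsInvertible} :=
  ContinuousLinearEquiv.isOpen

theorem isOpen_changeDomain [FiniteDimensional ℝ V] (hΩ : IsOpen Ω) (hτ : ContDiffOn ℝ ∞ τ Ω)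
    (k : ℕ) : IsOpen (changeDomain τ Ω k) := by
  have : CompleteSpace V := FiniteDimensional.complete ℝ V
  rw [isOpen_iff_mem_nhds]
  intro c hc
  have h1 : ∀ᶠ c' in 𝓝 c, ptJ c' ∈ Ω :=
    ptJ.continuous.continuousAt.eventually_mem (hΩ.mem_nhds hc.1)
  by_cases h : 1 ≤ k
  · have h2 : ∀ᶠ c' in 𝓝 c, (baseDeriv τ (truncJ h c')).IsInvertible :=
      ((contDiffAt_baseDeriv hΩ hτ (c := truncJ h c) hc.1).continuousAt.comp
        (truncJ h).continuous.continuousAt).eventually_mem (isOpen_isInvertible.mem_nhds (hc.2 h))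
    filter_upwards [h1, h2] with c' h1 h2 using ⟨h1, fun _ => h2⟩
  · filter_upwards [h1] with c' h1 using ⟨h1, fun h' => absurd h' h⟩

theorem contDiffOn_jetChange [FiniteDimensional ℝ V] (hΩ : IsOpen Ω) (hτ : ContDiffOn ℝ ∞ τ Ω)
    (k : ℕ) : ContDiffOn ℝ ∞ (jetChange τ k) (changeDomain τ Ω k) := by
  have : CompleteSpace V := FiniteDimensional.complete ℝ V
  induction k with
  | zero =>
    refine (continuousMultilinearCurryFin0 ℝ V W).symm.contDiff.comp_contDiffOn ?_
    exact contDiff_snd.comp_contDiffOn (hτ.comp contDiff_ptJ.contDiffOn fun c hc => hc.1)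
  | succ k ih =>
    intro c hc
    refine ContDiffAt.contDiffWithinAt ?_
    refine contDiff_curryL_symm.contDiffAt.comp c ?_
    have hc' := truncJ_mem_changeDomain k.le_succ hc
    have h1 : ContDiffAt ℝ ∞ (fderiv ℝ (jetChange τ k)) (truncJ k.le_succ c) :=
      (ih.contDiffAt ((isOpen_changeDomain hΩ hτ k).mem_nhds hc')).fderiv_right (m := ∞)
        (by norm_cast)
    have h2 : ContDiffAt ℝ ∞ (fun c : JetCoords V W (k + 1) =>
        baseDeriv τ (truncJ (Nat.succ_le_succ k.zero_le) c)) c :=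
      (contDiffAt_baseDeriv hΩ hτ (c := truncJ _ c) hc.1).comp c
        (contDiff_truncJ _).contDiffAt
    have h3 := (hc.2 (Nat.succ_le_succ k.zero_le)).contDiffAt_map_inverse (n := ∞)
    have h4 : ContDiffAt ℝ ∞ (fun c : JetCoords V W (k + 1) =>
        (baseDeriv τ (truncJ (Nat.succ_le_succ k.zero_le) c)).inverse) c :=
      ContDiffAt.comp (g := ContinuousLinearMap.inverse) c h3 h2
    exact ((h1.comp c (contDiff_truncJ _).contDiffAt).clm_comp contDiff_hor.contDiffAt).clm_comp
      h4

theorem contDiffOn_jetMap [FiniteDimensional ℝ V] (hΩ : IsOpen Ω) (hτ : ContDiffOn ℝ ∞ τ Ω)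
    (r : ℕ) : ContDiffOn ℝ ∞ (jetMap τ r) (changeDomain τ Ω r) := by
  refine ContDiffOn.prodMk ?_ (contDiffOn_pi.2 fun k => ?_)
  · exact contDiff_fst.comp_contDiffOn (hτ.comp contDiff_ptJ.contDiffOn fun c hc => hc.1)
  · exact (contDiffOn_jetChange hΩ hτ k).comp (contDiff_truncJ _).contDiffOn
      fun c hc => truncJ_mem_changeDomain _ hc

theorem hasFDerivAt_graph {w : V → W} {x : V} (hw : DifferentiableAt ℝ w x) :
    HasFDerivAt (fun x => (x, w x)) ((ContinuousLinearMap.id ℝ V).prod (fderiv ℝ w x)) x :=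
  (hasFDerivAt_id x).prodMk hw.hasFDerivAt

theorem hasFDerivAt_comp_graph {w : V → W} {x : V} (hw : DifferentiableAt ℝ w x)
    (hτ : DifferentiableAt ℝ τ (x, w x)) :
    HasFDerivAt (fun x => τ (x, w x)) (graphDeriv τ (jet 1 w x)) x := by
  have := hτ.hasFDerivAt.comp x (hasFDerivAt_graph hw)
  rw [graphDeriv, ptJ_jet, lin_jet]
  exact this

/-- The jet of the map whose graph is the image of a graph. -/
theorem jetMap_jet [FiniteDimensional ℝ V] (hΩ : IsOpen Ω) (hτ : ContDiffOn ℝ ∞ τ Ω)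
    {u w : V → W} {U : Set V} (hU : IsOpen U) (hw : ContDiffOn ℝ ∞ w U)
    (hmem : ∀ x ∈ U, jet 1 w x ∈ changeDomain τ Ω 1)
    (hu : ∀ x ∈ U, ContDiffAt ℝ ∞ u (τ (x, w x)).1)
    (hgraph : ∀ x ∈ U, (τ (x, w x)).2 = u (τ (x, w x)).1) (r : ℕ) {x : V} (hx : x ∈ U) :
    jet r u (τ (x, w x)).1 = jetMap τ r (jet r w x) := by
  -- The formula must hold on all of `U`, because the inductive step differentiates it.
  have key (k : ℕ) : ∀ x ∈ U,
      iteratedFDeriv ℝ k u (τ (x, w x)).1 = jetChange τ k (jet k w x) := by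
    induction k with
    | zero =>
      intro x hx
      ext m
      simp [jetChange, ← hgraph x hx]
    | succ k ih =>
      intro x hx
      have hwx := hw.contDiffAt (hU.mem_nhds hx)
      have hτx := hτ.contDiffAt (hΩ.mem_nhds (hmem x hx).1)
      have ha : HasFDerivAt (fun x => (τ (x, w x)).1) (baseDeriv τ (jet 1 w x)) x :=
        hasFDerivAt_fst.comp x
          (hasFDerivAt_comp_graph (hwx.differentiableAt (by simp)) (hτx.differentiableAt (by simp)))
      have hDu := ((contDiffAt_iteratedFDeriv (hu x hx) k).differentiableAt (by simp)).hasFDerivAt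
      have h1 := hDu.comp x ha
      have hdom : jet k w x ∈ changeDomain τ Ω k := by
        refine ⟨(hmem x hx).1, fun h => ?_⟩
        exact (hmem x hx).2 le_rfl
      have h2 := (((contDiffOn_jetChange hΩ hτ k).contDiffAt
        ((isOpen_changeDomain hΩ hτ k).mem_nhds hdom)).differentiableAt (by simp)).hasFDerivAt.comp x
          (hasFDerivAt_jet hwx k)
      have h3 : (iteratedFDeriv ℝ k u ∘ fun x => (τ (x, w x)).1) =ᶠ[𝓝 x]
          (jetChange τ k ∘ jet k w) := by
        filter_upwards [hU.mem_nhds hx] with y hy using ih y hy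
      have h4 := h1.unique (h2.congr_of_eventuallyEq h3)
      have h5 := (hmem x hx).2 le_rfl
      have h6 : fderiv ℝ (iteratedFDeriv ℝ k u) (τ (x, w x)).1 =
          ((fderiv ℝ (jetChange τ k) (jet k w x)).comp (hor (jet (k + 1) w x))).comp
            (baseDeriv τ (jet 1 w x)).inverse := by
        rw [← h4, ContinuousLinearMap.comp_assoc]
        have := h5.self_comp_inverse
        simp only [truncJ_jet] at this
        rw [this, ContinuousLinearMap.comp_id]
      have h7 : iteratedFDeriv ℝ (k + 1) u (τ (x, w x)).1 =
          (curryL V W k).symm (fderiv ℝ (iteratedFDeriv ℝ k u) (τ (x, w x)).1) := rfl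
      rw [h7, h6]
      rfl
  exact Prod.ext rfl (funext fun k => key k x hx)

end JetChange

end GeodesicJets

namespace GeodesicJets

/-! ### Submanifolds as graphs in different charts -/

section Contact

variable {V W : Type*} [NormedAddCommGroup V] [NormedSpace ℝ V]
  [NormedAddCommGroup W] [NormedSpace ℝ W]
  {H : Type*} [TopologicalSpace H]
  {I : ModelWithCorners ℝ (V × W) H} {F : Type*} [TopologicalSpace F] [ChartedSpace H F]

theorem DividedChart.isOpen_target (φ : DividedChart I F) : IsOpen φ.target :=
  φ.open_target

theorem DividedChart.continuousAt (φ : DividedChart I F) {p : F} (hp : p ∈ φ.source) :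
    ContinuousAt φ.toFun p :=
  φ.toOpenPartialHomeomorph.continuousAt hp

theorem DividedChart.continuousAt_inv (φ : DividedChart I F) {z : V × W} (hz : z ∈ φ.target) :
    ContinuousAt φ.invFun z :=
  φ.toOpenPartialHomeomorph.continuousAt_symm hz

theorem DividedChart.invFun_toFun (φ : DividedChart I F) {p : F} (hp : p ∈ φ.source) :
    φ.invFun (φ.toFun p) = p :=
  φ.left_inv hp

theorem DividedChart.toFun_invFun (φ : DividedChart I F) {z : V × W} (hz : z ∈ φ.target) :
    φ.toFun (φ.invFun z) = z :=
  φ.right_inv hz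

theorem DividedChart.mapsTo (φ : DividedChart I F) {p : F} (hp : p ∈ φ.source) :
    φ.toFun p ∈ φ.target :=
  φ.map_source hp

theorem DividedChart.inv_mapsTo (φ : DividedChart I F) {z : V × W} (hz : z ∈ φ.target) :
    φ.invFun z ∈ φ.source :=
  φ.map_target hz

theorem DividedChart.source_mem_nhds (φ : DividedChart I F) {p : F} (hp : p ∈ φ.source) :
    φ.source ∈ 𝓝 p :=
  φ.open_source.mem_nhds hp

/-- The change of coordinates from `ψ` to `φ`. -/
def transition (ψ φ : DividedChart I F) (z : V × W) : V × W := φ.toFun (ψ.invFun z)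

/-- The domain of a change of coordinates. -/
def transitionDomain (ψ φ : DividedChart I F) : Set (V × W) :=
  ψ.target ∩ ψ.invFun ⁻¹' φ.source

variable {φ ψ : DividedChart I F} {L : Set F} {p : F} {u w : V → W}

theorem isOpen_transitionDomain (ψ φ : DividedChart I F) : IsOpen (transitionDomain ψ φ) :=
  ψ.toOpenPartialHomeomorph.isOpen_inter_preimage_symm φ.open_source

theorem contDiffOn_transition (ψ φ : DividedChart I F) :
    ContDiffOn ℝ ∞ (transition ψ φ) (transitionDomain ψ φ) := by
  rw [← contMDiffOn_iff_contDiffOn]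
  exact φ.contMDiffOn_to.comp (ψ.contMDiffOn_inv.mono inter_subset_left) fun z hz => hz.2

theorem IsGraphAt.contDiffAt (h : IsGraphAt φ L p u) : ContDiffAt ℝ ∞ u (φ.toFun p).1 := by
  obtain ⟨U, hU, hu⟩ := h.smooth
  exact hu.contDiffAt hU

theorem IsGraphAt.apply_eq (h : IsGraphAt φ L p u) (hp : p ∈ L) :
    (φ.toFun p).2 = u (φ.toFun p).1 :=
  h.graph.self_of_nhds.1 hp

theorem IsGraphAt.toFun_eq (h : IsGraphAt φ L p u) (hp : p ∈ L) :
    φ.toFun p = ((φ.toFun p).1, u (φ.toFun p).1) :=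
  Prod.ext rfl (h.apply_eq hp)

/-- The parametrization of a graph. -/
def graphPt (φ : DividedChart I F) (u : V → W) (x : V) : F := φ.invFun (x, u x)

theorem IsGraphAt.graphPt_eq (h : IsGraphAt φ L p u) (hp : p ∈ L) :
    graphPt φ u (φ.toFun p).1 = p := by
  rw [graphPt, ← h.toFun_eq hp, φ.invFun_toFun h.mem_source]

theorem IsGraphAt.continuousAt_graphPt (h : IsGraphAt φ L p u) (hp : p ∈ L) :
    ContinuousAt (graphPt φ u) (φ.toFun p).1 := by
  refine ContinuousAt.comp (f := fun x => (x, u x)) (g := φ.invFun) ?_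
    (continuousAt_id.prodMk h.contDiffAt.continuousAt)
  exact φ.continuousAt_inv ((h.toFun_eq hp) ▸ φ.mapsTo h.mem_source)

/-- A submanifold that is a graph near a point is so near the neighbouring points. -/
theorem IsGraphAt.exists_nhds (h : IsGraphAt φ L p u) (hp : p ∈ L) :
    ∃ U : Set V, IsOpen U ∧ (φ.toFun p).1 ∈ U ∧ ContDiffOn ℝ ∞ u U ∧
      ∀ x ∈ U, (x, u x) ∈ φ.target ∧ graphPt φ u x ∈ L ∧ IsGraphAt φ L (graphPt φ u x) u := by
  obtain ⟨U, hU, hu⟩ := h.smooth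
  have h1 : ∀ᶠ x in 𝓝 (φ.toFun p).1, (x, u x) ∈ φ.target :=
    (continuousAt_id.prodMk h.contDiffAt.continuousAt).eventually_mem
      (φ.isOpen_target.mem_nhds ((h.toFun_eq hp) ▸ φ.mapsTo h.mem_source))
  have h2 : ∀ᶠ x in 𝓝 (φ.toFun p).1,
      ∀ᶠ q in 𝓝 (graphPt φ u x), (q ∈ L ↔ (φ.toFun q).2 = u (φ.toFun q).1) := by
    have := (h.continuousAt_graphPt hp).tendsto
    rw [h.graphPt_eq hp] at this
    exact this.eventually h.graph.eventually_nhds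
  obtain ⟨U', hU', hopen, hmem⟩ := eventually_nhds_iff.1 (h1.and (h2.and (mem_interior_iff_mem_nhds.2 hU |>
    isOpen_interior.mem_nhds)))
  refine ⟨U', hopen, hmem, fun x hx => ?_, fun x hx => ?_⟩
  · exact (hu x (interior_subset (hU' x hx).2.2)).mono_of_mem_nhdsWithin
      (mem_nhdsWithin_of_mem_nhds (mem_interior_iff_mem_nhds.1 (hU' x hx).2.2))
  · obtain ⟨k1, k2, k3⟩ := hU' x hx
    have e : φ.toFun (graphPt φ u x) = (x, u x) := φ.toFun_invFun k1
    refine ⟨k1, k2.self_of_nhds.2 (by rw [e]), φ.inv_mapsTo k1, ⟨U, ?_, hu⟩, k2⟩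
    rw [e]
    exact mem_interior_iff_mem_nhds.1 k3

theorem IsGraphAt.eventually_mem (h : IsGraphAt φ L p u) (hp : p ∈ L) :
    ∀ᶠ x in 𝓝 (φ.toFun p).1, (x, u x) ∈ φ.target ∧ graphPt φ u x ∈ L ∧
      IsGraphAt φ L (graphPt φ u x) u := by
  obtain ⟨U, hU, hx, -, h⟩ := h.exists_nhds hp
  filter_upwards [hU.mem_nhds hx] using h

theorem IsGraphAt.eventually_isGraphAt (h : IsGraphAt φ L p u) (hp : p ∈ L) :
    ∀ᶠ q in 𝓝 p, q ∈ L → IsGraphAt φ L q u ∧ graphPt φ u (φ.toFun q).1 = q := by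
  obtain ⟨U, hU, hx, -, hUL⟩ := h.exists_nhds hp
  have h3 : ∀ᶠ q in 𝓝 p, (φ.toFun q).1 ∈ U :=
    (continuous_fst.continuousAt.comp (φ.continuousAt h.mem_source)).eventually_mem
      (hU.mem_nhds hx)
  filter_upwards [h3, h.graph, φ.source_mem_nhds h.mem_source] with q h1 h2 h4 hq
  have e : graphPt φ u (φ.toFun q).1 = q := by
    rw [graphPt, ← h2.1 hq]
    exact φ.invFun_toFun h4
  exact ⟨e ▸ (hUL _ h1).2.2, e⟩

theorem toFun_graphPt {x : V} (h : (x, u x) ∈ φ.target) :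
    φ.toFun (graphPt φ u x) = (x, u x) := φ.toFun_invFun h

theorem IsGraphAt.eventuallyEq (h : IsGraphAt φ L p u) (h' : IsGraphAt φ L p w) (hp : p ∈ L) :
    u =ᶠ[𝓝 (φ.toFun p).1] w := by
  have h2 := (h.continuousAt_graphPt hp).tendsto
  rw [h.graphPt_eq hp] at h2
  filter_upwards [h.eventually_mem hp, h2.eventually h'.graph] with x ⟨k1, k2, _⟩ k4
  have := k4.1 k2
  rwa [toFun_graphPt k1] at this

/-- The jet coordinates depend only on the submanifold. -/
theorem IsGraphAt.jet_eq (h : IsGraphAt φ L p u) (h' : IsGraphAt φ L p w) (hp : p ∈ L) (r : ℕ) :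
    jet r u (φ.toFun p).1 = jet r w (φ.toFun p).1 :=
  jet_congr (h.eventuallyEq h' hp) r

theorem hasFDerivAt_transition_graph {w : V → W} {x : V} (hw : DifferentiableAt ℝ w x)
    (hx : (x, w x) ∈ transitionDomain ψ φ) :
    HasFDerivAt (fun x => transition ψ φ (x, w x)) (graphDeriv (transition ψ φ) (jet 1 w x)) x :=
  hasFDerivAt_comp_graph hw (((contDiffOn_transition ψ φ).contDiffAt
    ((isOpen_transitionDomain ψ φ).mem_nhds hx)).differentiableAt (by simp))

/-- The opposite transition is a left inverse near `z`, so the chain rule gives a left inverse of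
the derivative. -/
theorem fderiv_transition_injective {z : V × W} (hz : z ∈ transitionDomain ψ φ) :
    Function.Injective (fderiv ℝ (transition ψ φ) z) := by
  have hz' : transition ψ φ z ∈ transitionDomain φ ψ :=
    ⟨φ.mapsTo hz.2, by
      rw [mem_preimage, transition, φ.invFun_toFun hz.2]; exact ψ.inv_mapsTo hz.1⟩
  have h1 := ((contDiffOn_transition ψ φ).contDiffAt
    ((isOpen_transitionDomain ψ φ).mem_nhds hz)).differentiableAt (by simp)
  have h2 := ((contDiffOn_transition φ ψ).contDiffAt
    ((isOpen_transitionDomain φ ψ).mem_nhds hz')).differentiableAt (by simp)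
  have h3 : transition φ ψ ∘ transition ψ φ =ᶠ[𝓝 z] id := by
    filter_upwards [(isOpen_transitionDomain ψ φ).mem_nhds hz] with y hy
    simp only [Function.comp, transition, id]
    rw [φ.invFun_toFun hy.2, ψ.toFun_invFun hy.1]
  have h4 := (h2.hasFDerivAt.comp z h1.hasFDerivAt).unique
    ((hasFDerivAt_id z).congr_of_eventuallyEq h3)
  intro a b hab
  have ha := congrArg (fun l => l a) h4
  have hb := congrArg (fun l => l b) h4
  simp only [ContinuousLinearMap.comp_apply, ContinuousLinearMap.id_apply] at ha hb
  rw [← ha, ← hb, hab]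

/-- The relation of the descriptions of a submanifold as a graph in two charts. -/
theorem IsGraphAt.transition_eventually (hw : IsGraphAt ψ L p w) (hu : IsGraphAt φ L p u)
    (hp : p ∈ L) :
    ∀ᶠ x in 𝓝 (ψ.toFun p).1, (x, w x) ∈ transitionDomain ψ φ ∧ graphPt ψ w x ∈ L ∧
      IsGraphAt ψ L (graphPt ψ w x) w ∧
      (transition ψ φ (x, w x)).2 = u (transition ψ φ (x, w x)).1 ∧
      ContDiffAt ℝ ∞ u (transition ψ φ (x, w x)).1 := by
  have h2 := (hw.continuousAt_graphPt hp).tendsto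
  rw [hw.graphPt_eq hp] at h2
  obtain ⟨U, hU, hxU, hcd, -⟩ := hu.exists_nhds hp
  have h3 : ∀ᶠ q in 𝓝 p, (φ.toFun q).1 ∈ U :=
    (continuous_fst.continuousAt.comp (φ.continuousAt hu.mem_source)).eventually_mem
      (hU.mem_nhds hxU)
  filter_upwards [hw.eventually_mem hp, h2.eventually hu.graph,
    h2.eventually (φ.source_mem_nhds hu.mem_source), h2.eventually h3] with x ⟨k1, k2, k3⟩ k4 k5 k6
  exact ⟨⟨k1, k5⟩, k2, k3, k4.1 k2, hcd.contDiffAt (hU.mem_nhds k6)⟩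

/-- This is the derivative of the identity `(τ (x, w x)).2 = u (τ (x, w x)).1`, `τ` the transition,
which holds near the point because both graphs describe `L`. -/
theorem IsGraphAt.graphDeriv_snd (hw : IsGraphAt ψ L p w) (hu : IsGraphAt φ L p u)
    (hp : p ∈ L) (v : V) :
    (graphDeriv (transition ψ φ) (jet 1 w (ψ.toFun p).1) v).2 =
      fderiv ℝ u (φ.toFun p).1 (baseDeriv (transition ψ φ) (jet 1 w (ψ.toFun p).1) v) := by
  have h := hw.transition_eventually hu hp
  obtain ⟨h1, -, -, h4, h5⟩ := h.self_of_nhds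
  have hd := hasFDerivAt_transition_graph (hw.contDiffAt.differentiableAt (by simp)) h1
  have e2 := HasFDerivAt.comp (g := u) (f := fun x => (transition ψ φ (x, w x)).1) _
    (h5.differentiableAt (by simp)).hasFDerivAt hd.fst
  have e3 := hd.snd.unique (e2.congr_of_eventuallyEq (h.mono fun x hx => hx.2.2.2.1))
  have e4 := congrArg (fun l => l v) e3
  have e5 : transition ψ φ ((ψ.toFun p).1, w (ψ.toFun p).1) = φ.toFun p := by
    rw [← hw.toFun_eq hp, transition, ψ.invFun_toFun hw.mem_source]
  rw [e5] at e4
  exact e4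

section Transfer

variable [FiniteDimensional ℝ V]

theorem isInvertible_of_injective {A : V →L[ℝ] V} (hA : ∀ v, A v = 0 → v = 0) :
    A.IsInvertible := by
  have hinj : Function.Injective A.toLinearMap := by
    rw [← LinearMap.ker_eq_bot, LinearMap.ker_eq_bot']
    exact hA
  exact ⟨(LinearEquiv.ofInjectiveEndo A.toLinearMap hinj).toContinuousLinearEquiv, by ext; rfl⟩

/-- By `graphDeriv_snd` a vector killed by the base derivative is killed by the whole graph
derivative; since the derivative of the transition is injective, the vector is zero. -/
theorem IsGraphAt.mem_changeDomain (hw : IsGraphAt ψ L p w) (hu : IsGraphAt φ L p u)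
    (hp : p ∈ L) :
    jet 1 w (ψ.toFun p).1 ∈ changeDomain (transition ψ φ) (transitionDomain ψ φ) 1 := by
  have h1 := (hw.transition_eventually hu hp).self_of_nhds.1
  refine ⟨h1, fun _ => isInvertible_of_injective fun v hv => ?_⟩
  rw [truncJ_self] at hv
  have e4 := hw.graphDeriv_snd hu hp v
  rw [hv, map_zero] at e4
  have h0 : graphDeriv (transition ψ φ) (jet 1 w (ψ.toFun p).1) v = 0 := Prod.ext hv e4
  have h6 := fderiv_transition_injective h1 (a₁ := (v, fderiv ℝ w (ψ.toFun p).1 v)) (a₂ := 0) (by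
    rw [map_zero, ← h0, graphDeriv, lin_jet, ptJ_jet]
    rfl)
  exact congrArg Prod.fst h6

/-- Change of jet coordinates. -/
theorem IsGraphAt.jet_transition (hw : IsGraphAt ψ L p w) (hu : IsGraphAt φ L p u)
    (hp : p ∈ L) (r : ℕ) :
    jet r u (φ.toFun p).1 = jetMap (transition ψ φ) r (jet r w (ψ.toFun p).1) := by
  obtain ⟨U, hU, hxU, hcd, -⟩ := hw.exists_nhds hp
  obtain ⟨U', hU', hopen, hmem⟩ := eventually_nhds_iff.1
    ((hw.transition_eventually hu hp).and (hU.mem_nhds hxU))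
  have hτ := contDiffOn_transition ψ φ
  have hc : ContinuousAt (jet 1 w) (ψ.toFun p).1 := (contDiffAt_jet hw.contDiffAt 1).continuousAt
  obtain ⟨U₂, hU₂, hopen₂, hmem₂⟩ := eventually_nhds_iff.1 (hc.eventually_mem
    ((isOpen_changeDomain (isOpen_transitionDomain ψ φ) hτ 1).mem_nhds
      (hw.mem_changeDomain hu hp)))
  have := jetMap_jet (isOpen_transitionDomain ψ φ) hτ (u := u) (w := w) (hopen.inter hopen₂)
    (fun x hx => (hcd x (hU' x hx.1).2).mono_of_mem_nhdsWithin
      (mem_nhdsWithin_of_mem_nhds (hU.mem_nhds (hU' x hx.1).2)))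
    (fun x hx => hU₂ x hx.2) (fun x hx => (hU' x hx.1).1.2.2.2.2)
    (fun x hx => (hU' x hx.1).1.2.2.2.1) r ⟨hmem, hmem₂⟩
  rw [← this, ← hw.toFun_eq hp, transition, ψ.invFun_toFun hw.mem_source]

/-- If the change of charts does not make the tangent plane vertical, a graph in one chart is a
graph in the other. -/
theorem IsGraphAt.exists_transfer (hw : IsGraphAt ψ L p w) (hp : p ∈ L)
    (hdom : jet 1 w (ψ.toFun p).1 ∈ changeDomain (transition ψ φ) (transitionDomain ψ φ) 1) :
    ∃ u, IsGraphAt φ L p u := by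
  have : CompleteSpace V := FiniteDimensional.complete ℝ V
  set x₀ := (ψ.toFun p).1 with hx₀
  have hpφ : p ∈ φ.source := by
    have h1 := hdom.1.2
    rwa [mem_preimage, ptJ_jet, ← hw.toFun_eq hp, ψ.invFun_toFun hw.mem_source] at h1
  have hz : (x₀, w x₀) ∈ transitionDomain ψ φ := hdom.1
  have hτ : ContDiffAt ℝ ∞ (fun x => transition ψ φ (x, w x)) x₀ :=
    ContDiffAt.comp (g := transition ψ φ) (f := fun x => (x, w x)) x₀
      ((contDiffOn_transition ψ φ).contDiffAt ((isOpen_transitionDomain ψ φ).mem_nhds hz))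
      (contDiffAt_id.prodMk hw.contDiffAt)
  obtain ⟨A, hA⟩ := hdom.2 le_rfl
  have ha : ContDiffAt ℝ ∞ (fun x => (transition ψ φ (x, w x)).1) x₀ := contDiff_fst.contDiffAt.comp x₀ hτ
  have hda : HasFDerivAt (fun x => (transition ψ φ (x, w x)).1) (A : V →L[ℝ] V) x₀ := by
    rw [hA]
    exact hasFDerivAt_fst.comp x₀ (hasFDerivAt_transition_graph
      (hw.contDiffAt.differentiableAt (by simp)) hz)
  have hn : (∞ : ℕ∞ω) ≠ 0 := by simp
  set a := fun x => (transition ψ φ (x, w x)).1 with ha_def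
  set e := ha.toOpenPartialHomeomorph a hda hn with he
  have he_coe : ∀ x, e x = a x := fun x => rfl
  have hx_src : x₀ ∈ e.source := ha.mem_toOpenPartialHomeomorph_source hda hn
  have hφp : transition ψ φ (x₀, w x₀) = φ.toFun p := by
    rw [hx₀, ← hw.toFun_eq hp, transition, ψ.invFun_toFun hw.mem_source]
  have hax : e x₀ = (φ.toFun p).1 := by rw [he_coe, ha_def]; exact congrArg Prod.fst hφp
  have hsx : e.symm (φ.toFun p).1 = x₀ := by rw [← hax, e.left_inv hx_src]
  have hy_tgt : (φ.toFun p).1 ∈ e.target := by rw [← hax]; exact e.map_source hx_src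
  have hsymm : Tendsto e.symm (𝓝 (φ.toFun p).1) (𝓝 x₀) := by
    have := (e.continuousAt_symm hy_tgt).tendsto
    rwa [hsx] at this
  obtain ⟨U, hU, hxU, hcd, hUL⟩ := hw.exists_nhds hp
  -- Smoothness of `u` is needed on a neighbourhood, so the hypotheses of the inverse function
  -- theorem are secured at nearby points as well.
  have hgood : ∀ᶠ x in 𝓝 x₀, ContDiffAt ℝ ∞ w x ∧
      jet 1 w x ∈ changeDomain (transition ψ φ) (transitionDomain ψ φ) 1 := by
    filter_upwards [hU.mem_nhds hxU, (contDiffAt_jet hw.contDiffAt 1).continuousAt.eventually_mem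
      ((isOpen_changeDomain (isOpen_transitionDomain ψ φ)
        (contDiffOn_transition ψ φ) 1).mem_nhds hdom)] with x h1 h2
    exact ⟨hcd.contDiffAt (hU.mem_nhds h1), h2⟩
  let u : V → W := fun y => (transition ψ φ (e.symm y, w (e.symm y))).2
  have hu : ∀ᶠ y in 𝓝 (φ.toFun p).1, ContDiffAt ℝ ∞ u y := by
    filter_upwards [hsymm.eventually hgood, e.open_target.mem_nhds hy_tgt] with y ⟨h1, h2⟩ h3
    have h4 : ContDiffAt ℝ ∞ (fun x => transition ψ φ (x, w x)) (e.symm y) :=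
      ContDiffAt.comp (g := transition ψ φ) (f := fun x => (x, w x)) _
        ((contDiffOn_transition ψ φ).contDiffAt ((isOpen_transitionDomain ψ φ).mem_nhds h2.1))
        (contDiffAt_id.prodMk h1)
    obtain ⟨B, hB⟩ := h2.2 le_rfl
    have h5 : HasFDerivAt e (B : V →L[ℝ] V) (e.symm y) := by
      rw [hB]
      exact (hasFDerivAt_transition_graph (h1.differentiableAt (by simp)) h2.1).fst
    exact ContDiffAt.comp (g := fun x => (transition ψ φ (x, w x)).2) y
      (contDiff_snd.contDiffAt.comp _ h4)
      (e.contDiffAt_symm h3 h5 (contDiff_fst.contDiffAt.comp _ h4))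
  refine ⟨u, hpφ, ?_, ?_⟩
  · obtain ⟨U', hU', hopen, hmem⟩ := eventually_nhds_iff.1 hu
    exact ⟨U', hopen.mem_nhds hmem, fun y hy => (hU' y hy).contDiffWithinAt⟩
  · have htgt : ∀ᶠ q in 𝓝 p, (φ.toFun q).1 ∈ e.target :=
      (continuous_fst.continuousAt.comp (φ.continuousAt hpφ)).eventually_mem
        (e.open_target.mem_nhds hy_tgt)
    have hsrc : ∀ᶠ q in 𝓝 p, (ψ.toFun q).1 ∈ e.source :=
      (continuous_fst.continuousAt.comp (ψ.continuousAt hw.mem_source)).eventually_mem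
        (e.open_source.mem_nhds hx_src)
    have hdomq : ∀ᶠ q in 𝓝 p, (e.symm (φ.toFun q).1, w (e.symm (φ.toFun q).1)) ∈
        transitionDomain ψ φ := by
      have hc : ContinuousAt (fun q => (e.symm (φ.toFun q).1, w (e.symm (φ.toFun q).1))) p := by
        have h1 : ContinuousAt (fun q => e.symm (φ.toFun q).1) p :=
          ContinuousAt.comp (g := e.symm) (f := fun q => (φ.toFun q).1) (e.continuousAt_symm hy_tgt)
            (continuous_fst.continuousAt.comp (φ.continuousAt hpφ))
        have h2 : ContinuousAt w (e.symm (φ.toFun p).1) := by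
          rw [hsx]; exact hw.contDiffAt.continuousAt
        exact h1.prodMk (ContinuousAt.comp (g := w) (f := fun q => e.symm (φ.toFun q).1) h2 h1)
      refine hc.eventually_mem ((isOpen_transitionDomain ψ φ).mem_nhds ?_)
      rw [hsx]; exact hz
    filter_upwards [hw.graph, htgt, hsrc, hdomq, ψ.source_mem_nhds hw.mem_source,
      φ.source_mem_nhds hpφ] with q k1 k2 k3 k4 k5 k6
    rw [k1]
    constructor
    · intro h
      have e1 : transition ψ φ ((ψ.toFun q).1, w (ψ.toFun q).1) = φ.toFun q := by
        rw [← h]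
        exact congrArg φ.toFun (ψ.invFun_toFun k5)
      have e2 : e.symm (φ.toFun q).1 = (ψ.toFun q).1 := by
        rw [← e1]
        exact e.left_inv k3
      change _ = (transition ψ φ (e.symm (φ.toFun q).1, w (e.symm (φ.toFun q).1))).2
      rw [e2, e1]
    · intro h
      have e3 : (transition ψ φ (e.symm (φ.toFun q).1, w (e.symm (φ.toFun q).1))).1 =
          (φ.toFun q).1 := e.right_inv k2
      have e4 : transition ψ φ (e.symm (φ.toFun q).1, w (e.symm (φ.toFun q).1)) = φ.toFun q :=
        Prod.ext e3 h.symm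
      have e5 : ψ.invFun (e.symm (φ.toFun q).1, w (e.symm (φ.toFun q).1)) = q :=
        φ.injOn k4.2 k6 e4
      rw [← e5, ψ.toFun_invFun k4.1]

end Transfer

end Contact

end GeodesicJets

namespace GeodesicJets

/-! ### Coordinates and smooth functions on the jet spaces -/

section JetSpace

variable {V W : Type*} [NormedAddCommGroup V] [NormedSpace ℝ V]
  [NormedAddCommGroup W] [NormedSpace ℝ W]
  {H : Type*} [TopologicalSpace H]
  {I : ModelWithCorners ℝ (V × W) H} {F : Type*} [TopologicalSpace F] [ChartedSpace H F]
  {A : Set (Set F)} {φ ψ : DividedChart I F} {r : ℕ}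

/-- `c` are the coordinates of the jet `θ` in the chart `φ`. -/
def HasCoords (φ : DividedChart I F) (θ : Jet I A r) (c : JetCoords V W r) : Prop :=
  ∃ (s : PointedSub I A) (u : V → W), Jet.mk r s = θ ∧ IsGraphAt φ s.carrier s.pt u ∧
    jet r u (φ.toFun s.pt).1 = c

theorem HasContact.symm {s t : PointedSub I A} (h : HasContact r s t) : HasContact r t s := by
  obtain ⟨φ, u, u', hu, hu', he⟩ := h
  exact ⟨φ, u', u, hu', hu, he.symm⟩

theorem IsGraphAt.hasCoords {s : PointedSub I A} {u : V → W}
    (h : IsGraphAt φ s.carrier s.pt u) :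
    HasCoords φ (Jet.mk r s) (jet r u (φ.toFun s.pt).1) :=
  ⟨s, u, rfl, h, rfl⟩

theorem exists_hasCoords (θ : Jet I A r) : ∃ (φ : DividedChart I F) (c : JetCoords V W r),
    HasCoords φ θ c := by
  obtain ⟨s, rfl⟩ := Quot.exists_rep θ
  obtain ⟨φ, u, h⟩ := s.isSubmanifold s.pt s.pt_mem
  exact ⟨φ, _, h.hasCoords⟩

theorem HasCoords.proj {k : ℕ} (h : k ≤ r) {θ : Jet I A r} {c : JetCoords V W r}
    (hc : HasCoords φ θ c) : HasCoords φ (Jet.proj h θ) (truncJ h c) := by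
  obtain ⟨s, u, rfl, hu, rfl⟩ := hc
  exact ⟨s, u, rfl, hu, rfl⟩

theorem HasCoords.eq {θ θ' : Jet I A r} {c : JetCoords V W r}
    (h : HasCoords φ θ c) (h' : HasCoords φ θ' c) : θ = θ' := by
  obtain ⟨s, u, rfl, hu, rfl⟩ := h
  obtain ⟨s', u', rfl, hu', he⟩ := h'
  exact Quot.sound ⟨φ, u, u', hu, hu', he.symm⟩

theorem HasCoords.mem_target {θ : Jet I A r} {c : JetCoords V W r}
    (h : HasCoords φ θ c) : ptJ c ∈ φ.target := by
  obtain ⟨s, u, rfl, hu, rfl⟩ := h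
  rw [ptJ_jet, ← hu.toFun_eq s.pt_mem]
  exact φ.mapsTo hu.mem_source

theorem HasCoords.base_eq {θ : Jet I A r} {c : JetCoords V W r}
    (h : HasCoords φ θ c) : θ.base = φ.invFun (ptJ c) := by
  obtain ⟨s, u, rfl, hu, rfl⟩ := h
  exact (hu.graphPt_eq s.pt_mem).symm

theorem HasCoords.base_mem_source {θ : Jet I A r} {c : JetCoords V W r}
    (h : HasCoords φ θ c) : θ.base ∈ φ.source := by
  rw [h.base_eq]
  exact φ.inv_mapsTo h.mem_target

theorem HasCoords.toFun_base {θ : Jet I A r} {c : JetCoords V W r}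
    (h : HasCoords φ θ c) : φ.toFun θ.base = ptJ c := by
  rw [h.base_eq]
  exact φ.toFun_invFun h.mem_target

theorem isSmoothFun_iff {f : Jet I A r → ℝ} : IsSmoothFun f ↔
    ∀ (φ : DividedChart I F) (θ : Jet I A r) (c : JetCoords V W r), HasCoords φ θ c → ∃ (g : JetCoords V W r → ℝ), ∃ N ∈ 𝓝 c,
      ContDiffOn ℝ ∞ g N ∧ ∀ θ' c', HasCoords φ θ' c' → c' ∈ N → f θ' = g c' := by
  constructor
  · rintro h φ _ _ ⟨s, u, rfl, hu, rfl⟩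
    obtain ⟨g, N, hN, hg, hf⟩ := h s φ u hu
    refine ⟨g, N, hN, hg, ?_⟩
    rintro _ _ ⟨t, u', rfl, hu', rfl⟩ hm
    exact hf t u' hu' hm
  · intro h s φ u hu
    obtain ⟨g, N, hN, hg, hf⟩ := h φ _ _ hu.hasCoords
    exact ⟨g, N, hN, hg, fun t u' hu' hm => hf _ _ hu'.hasCoords hm⟩

/-- `g` is the expression of `f` in the jet coordinates of `φ` near `c`. -/
def IsRep (f : Jet I A r → ℝ) (φ : DividedChart I F) (g : JetCoords V W r → ℝ)
    (c : JetCoords V W r) : Prop :=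
  ∃ N ∈ 𝓝 c, ContDiffOn ℝ ∞ g N ∧ ∀ θ' c', HasCoords φ θ' c' → c' ∈ N → f θ' = g c'

theorem exists_isRep (f : smoothFun I A r) {θ : Jet I A r} {c : JetCoords V W r}
    (h : HasCoords φ θ c) : ∃ g, IsRep f.1 φ g c :=
  isSmoothFun_iff.1 f.2 φ θ c h

theorem IsRep.apply_eq {f : Jet I A r → ℝ} {g : JetCoords V W r → ℝ} {c : JetCoords V W r}
    (h : IsRep f φ g c) {θ : Jet I A r} (hc : HasCoords φ θ c) : f θ = g c := by
  obtain ⟨N, hN, -, h⟩ := h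
  exact h θ c hc (mem_of_mem_nhds hN)

theorem IsRep.contDiffAt {f : Jet I A r → ℝ} {g : JetCoords V W r → ℝ} {c : JetCoords V W r}
    (h : IsRep f φ g c) : ContDiffAt ℝ ∞ g c := by
  obtain ⟨N, hN, h, -⟩ := h
  exact h.contDiffAt hN

theorem IsRep.eventually {f : Jet I A r → ℝ} {g : JetCoords V W r → ℝ} {c : JetCoords V W r}
    (h : IsRep f φ g c) : ∀ᶠ c' in 𝓝 c, ∀ θ, HasCoords φ θ c' → f θ = g c' := by
  obtain ⟨N, hN, -, h⟩ := h
  filter_upwards [hN] with c' hc' θ hθ using h θ c' hθ hc'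

open Classical in
/-- The function on the jet space given by `g` in the jet coordinates of `φ`, extended by zero. -/
noncomputable def extendZero (A : Set (Set F)) (φ : DividedChart I F) (g : JetCoords V W r → ℝ)
    (θ : Jet I A r) : ℝ :=
  if h : ∃ c, HasCoords φ θ c then g h.choose else 0

theorem extendZero_of_not (g : JetCoords V W r → ℝ) {θ : Jet I A r}
    (h : ¬ ∃ c, HasCoords φ θ c) : extendZero A φ g θ = 0 := by
  rw [extendZero, dif_neg h]

section FiniteDim

variable [FiniteDimensional ℝ V]

/-- Whether `t` is a graph in `φ` is decided by its first order jet, which it shares with `s` as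
soon as `1 ≤ r`. The coordinates in `φ` then agree, both being `jetMap` of the common jet in the
chart of contact. -/
theorem HasContact.transfer (hr : 1 ≤ r) {s t : PointedSub I A} (hc : HasContact r s t)
    {u : V → W} (hu : IsGraphAt φ s.carrier s.pt u) :
    ∃ u', IsGraphAt φ t.carrier t.pt u' ∧
      jet r u' (φ.toFun t.pt).1 = jet r u (φ.toFun s.pt).1 := by
  obtain ⟨ψ, w, w', hw, hw', he⟩ := hc
  have he' : jet r w (ψ.toFun s.pt).1 = jet r w' (ψ.toFun t.pt).1 := he
  have hdom := hw.mem_changeDomain hu s.pt_mem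
  have e1 : jet 1 w (ψ.toFun s.pt).1 = jet 1 w' (ψ.toFun t.pt).1 := congrArg (truncJ hr) he'
  rw [e1] at hdom
  obtain ⟨u', hu'⟩ := hw'.exists_transfer t.pt_mem hdom
  refine ⟨u', hu', ?_⟩
  rw [hw'.jet_transition hu' t.pt_mem, hw.jet_transition hu s.pt_mem, he']

/-- `Quot` identifies along the equivalence relation generated by contact. By transfer the set of
coordinates in `φ` of a pointed submanifold is invariant under contact, hence constant on the
generated classes. -/
theorem exists_isGraphAt_of_mk_eq (hr : 1 ≤ r) {s t : PointedSub I A}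
    (h : Jet.mk r s = Jet.mk r t) {u : V → W} (hu : IsGraphAt φ s.carrier s.pt u) :
    ∃ u', IsGraphAt φ t.carrier t.pt u' ∧
      jet r u' (φ.toFun t.pt).1 = jet r u (φ.toFun s.pt).1 := by
  have key : ∀ s t : PointedSub I A, Relation.EqvGen (HasContact r) s t →
      ∀ c, (∃ u, IsGraphAt φ s.carrier s.pt u ∧ jet r u (φ.toFun s.pt).1 = c) ↔
        (∃ u, IsGraphAt φ t.carrier t.pt u ∧ jet r u (φ.toFun t.pt).1 = c) := by
    intro s t hst
    induction hst with
    | rel s t h =>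
      refine fun c => ⟨?_, ?_⟩
      · rintro ⟨u, hu, rfl⟩
        exact h.transfer hr hu
      · rintro ⟨u, hu, rfl⟩
        exact h.symm.transfer hr hu
    | refl s => exact fun c => Iff.rfl
    | symm s t _ ih => exact fun c => (ih c).symm
    | trans s t t' _ _ ih ih' => exact fun c => (ih c).trans (ih' c)
  exact (key s t (Quot.eqvGen_exact h) _).1 ⟨u, hu, rfl⟩

theorem HasCoords.exists_isGraphAt (hr : 1 ≤ r) {s : PointedSub I A} {c : JetCoords V W r}
    (h : HasCoords φ (Jet.mk r s) c) :
    ∃ u, IsGraphAt φ s.carrier s.pt u ∧ jet r u (φ.toFun s.pt).1 = c := by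
  obtain ⟨t, u, h1, hu, rfl⟩ := h
  exact exists_isGraphAt_of_mk_eq hr h1 hu

theorem HasCoords.unique (hr : 1 ≤ r) {θ : Jet I A r} {c c' : JetCoords V W r}
    (h : HasCoords φ θ c) (h' : HasCoords φ θ c') : c = c' := by
  obtain ⟨s, u, rfl, hu, rfl⟩ := h
  obtain ⟨u', hu', rfl⟩ := h'.exists_isGraphAt hr
  exact hu.jet_eq hu' s.pt_mem r

/-- Being a graph in `φ` is already visible on jets of order `k ≥ 1`, so any representative of `θ`
is one. -/
theorem HasCoords.lift {k : ℕ} (hk : 1 ≤ k) (h : k ≤ r) {θ : Jet I A r} {c : JetCoords V W k}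
    (hc : HasCoords φ (Jet.proj h θ) c) : ∃ c', HasCoords φ θ c' ∧ truncJ h c' = c := by
  obtain ⟨s, rfl⟩ := Quot.exists_rep θ
  obtain ⟨u, hu, rfl⟩ := HasCoords.exists_isGraphAt (s := s) hk hc
  exact ⟨_, ⟨s, u, rfl, hu, rfl⟩, rfl⟩

theorem HasCoords.change {θ : Jet I A r} {c : JetCoords V W r} (hr : 1 ≤ r)
    (h : HasCoords ψ θ c) (hc : c ∈ changeDomain (transition ψ φ) (transitionDomain ψ φ) r) :
    HasCoords φ θ (jetMap (transition ψ φ) r c) := by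
  obtain ⟨s, u, rfl, hu, rfl⟩ := h
  obtain ⟨u', hu'⟩ := hu.exists_transfer (φ := φ) s.pt_mem ⟨hc.1, fun _ => hc.2 hr⟩
  exact ⟨s, u', rfl, hu', hu.jet_transition hu' s.pt_mem r⟩

theorem HasCoords.lin_baseDeriv {θ : Jet I A 1} {c c' : JetCoords V W 1}
    (h : HasCoords ψ θ c) (h' : HasCoords φ θ c') (v : V) :
    (graphDeriv (transition ψ φ) c v).2 = lin le_rfl c' (baseDeriv (transition ψ φ) c v) := by
  obtain ⟨s, u, rfl, hu, rfl⟩ := h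
  obtain ⟨u', hu', rfl⟩ := h'.exists_isGraphAt le_rfl
  rw [lin_jet]
  exact hu.graphDeriv_snd hu' s.pt_mem v

theorem extendZero_apply (hr : 1 ≤ r) (g : JetCoords V W r → ℝ) {θ : Jet I A r}
    {c : JetCoords V W r} (h : HasCoords φ θ c) : extendZero A φ g θ = g c := by
  have h' : ∃ c, HasCoords φ θ c := ⟨c, h⟩
  rw [extendZero, dif_pos h', h'.choose_spec.unique hr h]

/-- A function of the jet coordinates whose support is compact over `F` and bounded in the
direction of the first derivatives gives a smooth function on the jet space. -/
theorem isSmoothFun_extendZero [T2Space F] (hr : 1 ≤ r) {g : JetCoords V W r → ℝ}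
    (hg : ContDiffOn ℝ ∞ g {c | ptJ c ∈ φ.target}) {K : Set (V × W)} (hK : IsCompact K)
    (hKφ : K ⊆ φ.target) {C : ℝ}
    (hsupp : ∀ c, g c ≠ 0 → ptJ c ∈ K ∧ ‖lin hr c‖ ≤ C) :
    IsSmoothFun (extendZero A φ g) := by
  rw [isSmoothFun_iff]
  intro ψ θ c hc
  -- Either the jet is a graph in `φ`, and `g` is read through `jetMap`; or the function vanishes
  -- near it, because its base point is off the image of `K`, or because its plane is vertical for
  -- `φ` in some direction and nearby planes are too steep for the support of `g`.
  by_cases hdom : c ∈ changeDomain (transition ψ φ) (transitionDomain ψ φ) r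
  · have hop := isOpen_changeDomain (isOpen_transitionDomain ψ φ) (contDiffOn_transition ψ φ) r
    refine ⟨g ∘ jetMap (transition ψ φ) r, _, hop.mem_nhds hdom, ?_, fun θ' c' h' hm => ?_⟩
    · refine hg.comp (contDiffOn_jetMap (isOpen_transitionDomain ψ φ)
        (contDiffOn_transition ψ φ) r) fun c' hc' => ?_
      have : ptJ (jetMap (transition ψ φ) r c') = transition ψ φ (ptJ c') := by
        refine Prod.ext rfl ?_
        exact (continuousMultilinearCurryFin0 ℝ V W).apply_symm_apply _
      rw [mem_ofPred_eq, this]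
      exact φ.mapsTo hc'.1.2
    · exact extendZero_apply hr g (h'.change hr hm)
  -- The image of `K` is compact, hence closed because `F` is Hausdorff; so vanishing off `K` is an
  -- open condition on base points.
  · have hclosed : IsClosed (φ.invFun '' K) :=
      (hK.image_of_continuousOn fun z hz =>
        (φ.continuousAt_inv (hKφ hz)).continuousWithinAt).isClosed
    have hc0 : ContinuousAt (fun c : JetCoords V W r => ψ.invFun (ptJ c)) c :=
      ContinuousAt.comp (g := ψ.invFun) (ψ.continuousAt_inv hc.mem_target)
        (contDiff_ptJ (n := ∞)).continuous.continuousAt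
    by_cases hp : ψ.invFun (ptJ c) ∈ φ.invFun '' K
    · have hΩ : ptJ c ∈ transitionDomain ψ φ := by
        refine ⟨hc.mem_target, ?_⟩
        obtain ⟨z, hz, hz'⟩ := hp
        rw [mem_preimage, ← hz']
        exact φ.inv_mapsTo (hKφ hz)
      have hninv : ¬ (baseDeriv (transition ψ φ) (truncJ hr c)).IsInvertible :=
        fun h => hdom ⟨hΩ, fun _ => h⟩
      obtain ⟨v, hv0, hv⟩ : ∃ v, baseDeriv (transition ψ φ) (truncJ hr c) v = 0 ∧ v ≠ 0 := by
        by_contra! h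
        exact hninv (isInvertible_of_injective h)
      have hb : (graphDeriv (transition ψ φ) (truncJ hr c) v).2 ≠ 0 := by
        intro h0
        have h1 : graphDeriv (transition ψ φ) (truncJ hr c) v = 0 := Prod.ext hv0 h0
        have h2 := fderiv_transition_injective hΩ
          (h1.trans (map_zero (fderiv ℝ (transition ψ φ) (ptJ c))).symm)
        exact hv (congrArg Prod.fst h2)
      have hcont : ContinuousAt (fun c : JetCoords V W r =>
          graphDeriv (transition ψ φ) (truncJ hr c) v) c := by
        have h1 := (contDiffAt_graphDeriv (isOpen_transitionDomain ψ φ)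
          (contDiffOn_transition ψ φ) (c := truncJ hr c) hΩ).continuousAt
        exact (ContinuousAt.comp (g := graphDeriv (transition ψ φ)) h1
          ((contDiff_truncJ (n := ∞) hr).continuous.continuousAt)).clm_apply continuousAt_const
      -- Seen in `φ`, the vector `v` has zero base component and nonzero fibre component at `c`;
      -- nearby jets that are graphs in `φ` therefore have slope of norm greater than `C`.
      have hlt : ∀ᶠ c' in 𝓝 c, C * ‖(graphDeriv (transition ψ φ) (truncJ hr c') v).1‖ <
          ‖(graphDeriv (transition ψ φ) (truncJ hr c') v).2‖ := by
        refine ContinuousAt.eventually_lt (continuousAt_const.mul hcont.fst.norm) hcont.snd.norm ?_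
        have : (graphDeriv (transition ψ φ) (truncJ hr c) v).1 = 0 := hv0
        simpa [this] using hb
      refine ⟨0, _, hlt, contDiffOn_const, fun θ' c' h' hm => ?_⟩
      by_cases hex : ∃ c'', HasCoords φ θ' c''
      · obtain ⟨c'', h''⟩ := hex
        rw [extendZero_apply hr g h'']
        by_contra hne
        have h1 := (h'.proj hr).lin_baseDeriv (h''.proj hr) v
        have h2 : ‖(graphDeriv (transition ψ φ) (truncJ hr c') v).2‖ ≤
            C * ‖(graphDeriv (transition ψ φ) (truncJ hr c') v).1‖ := by
          rw [h1]
          exact (ContinuousLinearMap.le_opNorm _ _).trans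
            (mul_le_mul_of_nonneg_right (hsupp c'' hne).2 (norm_nonneg _))
        exact absurd hm (not_lt.2 h2)
      · exact extendZero_of_not g hex
    · have hN : ∀ᶠ c' in 𝓝 c, ψ.invFun (ptJ c') ∉ φ.invFun '' K :=
        hc0.eventually_mem (hclosed.isOpen_compl.mem_nhds hp)
      refine ⟨0, _, hN, contDiffOn_const, fun θ' c' h' hm => ?_⟩
      by_cases hex : ∃ c'', HasCoords φ θ' c''
      · obtain ⟨c'', h''⟩ := hex
        rw [extendZero_apply hr g h'']
        by_contra hne
        exact hm ⟨ptJ c'', (hsupp c'' hne).1, by rw [← h''.base_eq, h'.base_eq]⟩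
      · exact extendZero_of_not g hex

/-- Every function of the jet coordinates is locally induced by a smooth function on the jet
space. -/
theorem exists_cutoff [T2Space F] [FiniteDimensional ℝ W] (A : Set (Set F)) (hr : 1 ≤ r)
    {φ : DividedChart I F} {c : JetCoords V W r} (hc : ptJ c ∈ φ.target) :
    ∃ χ : JetCoords V W r → ℝ, ContDiff ℝ ∞ χ ∧ χ =ᶠ[𝓝 c] 1 ∧
      ∀ g : JetCoords V W r → ℝ, ContDiffOn ℝ ∞ g {c | ptJ c ∈ φ.target} →
        IsSmoothFun (extendZero A φ (χ * g)) := by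
  obtain ⟨ε, hε, hball⟩ := Metric.isOpen_iff.1 φ.isOpen_target _ hc
  -- `χ₀` keeps the point of the graph in a closed ball inside the target and `χ₁` bounds the slope.
  -- Higher derivatives need no cutoff. The radius `2` of `χ₁` gives the bound `‖lin hr c‖ + 2`
  -- below.
  let χ₀ : ContDiffBump (ptJ c) := ⟨ε / 4, ε / 2, by positivity, by linarith⟩
  let χ₁ : ContDiffBump (lin hr c) := ⟨1, 2, one_pos, one_lt_two⟩
  refine ⟨fun c' => χ₀ (ptJ c') * χ₁ (lin hr c'), ?_, ?_, fun g hg => ?_⟩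
  · exact (χ₀.contDiff.comp contDiff_ptJ).mul (χ₁.contDiff.comp (contDiff_lin hr))
  · have h0 := (contDiff_ptJ (n := ∞) (V := V) (W := W) (r := r)).continuous.continuousAt
      (x := c) |>.eventually χ₀.eventuallyEq_one
    have h1 := (contDiff_lin (n := ∞) (V := V) (W := W) hr).continuous.continuousAt
      (x := c) |>.eventually χ₁.eventuallyEq_one
    filter_upwards [h0, h1] with c' h0 h1
    rw [h0, h1]
    simp
  · refine isSmoothFun_extendZero hr ?_ (isCompact_closedBall (ptJ c) (ε / 2)) (C := ‖lin hr c‖ + 2)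
      ((Metric.closedBall_subset_ball (by linarith)).trans hball) fun c' hne => ?_
    · exact ((χ₀.contDiff.comp contDiff_ptJ).mul
        (χ₁.contDiff.comp (contDiff_lin hr))).contDiffOn.mul hg
    · have h1 : χ₀ (ptJ c') ≠ 0 := fun h => hne (by simp [h])
      have h2 : χ₁ (lin hr c') ≠ 0 := fun h => hne (by simp [h])
      have h1' : ptJ c' ∈ Function.support χ₀ := h1
      have h2' : lin hr c' ∈ Function.support χ₁ := h2
      rw [χ₀.support_eq] at h1'
      rw [χ₁.support_eq] at h2'
      refine ⟨Metric.ball_subset_closedBall h1', ?_⟩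
      have h3 : ‖lin hr c' - lin hr c‖ < 2 := by simpa [dist_eq_norm] using h2'
      linarith [norm_sub_norm_le (lin hr c') (lin hr c)]

end FiniteDim

end JetSpace

end GeodesicJets

namespace GeodesicJets

/-! ### `R`-planes in coordinates and separation by smooth functions -/

section RPlanes

variable {V W : Type*} [NormedAddCommGroup V] [NormedSpace ℝ V]
  [NormedAddCommGroup W] [NormedSpace ℝ W]
  {H : Type*} [TopologicalSpace H]
  {I : ModelWithCorners ℝ (V × W) H} {F : Type*} [TopologicalSpace F] [ChartedSpace H F]
  {A : Set (Set F)} {φ ψ : DividedChart I F} {r : ℕ}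

/-- A bounded smooth reparametrization of the line with unit velocity at the origin. -/
noncomputable def slowTime (δ t : ℝ) : ℝ := δ * Real.sin (t / δ)

theorem contDiff_slowTime (δ : ℝ) : ContDiff ℝ ∞ (slowTime δ) :=
  contDiff_const.mul (Real.contDiff_sin.comp (contDiff_id.div_const δ))

theorem abs_slowTime_le {δ : ℝ} (hδ : 0 < δ) (t : ℝ) : |slowTime δ t| ≤ δ := by
  rw [slowTime, abs_mul, abs_of_pos hδ]
  exact mul_le_of_le_one_right hδ.le (Real.abs_sin_le_one _)

@[simp] theorem slowTime_zero (δ : ℝ) : slowTime δ 0 = 0 := by simp [slowTime]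

theorem hasDerivAt_slowTime {δ : ℝ} (hδ : 0 < δ) : HasDerivAt (slowTime δ) 1 0 := by
  have h1 : HasDerivAt (fun t : ℝ => t / δ) (1 / δ) 0 := (hasDerivAt_id 0).div_const δ
  have h2 := (h1.sin).const_mul δ
  have e : δ * (Real.cos (0 / δ) * (1 / δ)) = 1 := by
    rw [zero_div, Real.cos_zero]
    field_simp
  rw [e] at h2
  exact h2

/-- A smooth curve in a neighbourhood of a point, with given velocity. -/
theorem exists_curve {U : Set V} {x : V} (hU : U ∈ 𝓝 x) (v : V) :
    ∃ η : ℝ → V, ContDiff ℝ ∞ η ∧ (∀ t, η t ∈ U) ∧ η 0 = x ∧ HasDerivAt η v 0 := by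
  obtain ⟨ε, hε, hball⟩ := Metric.mem_nhds_iff.1 hU
  -- The curve must stay in `U` for all times. Its displacement is at most `δ * ‖v‖ ≤ ε / 2`, and
  -- the summand `1` covers `v = 0`.
  have hδ : 0 < ε / (2 * (‖v‖ + 1)) := by positivity
  set δ := ε / (2 * (‖v‖ + 1))
  refine ⟨fun t => x + slowTime δ t • v, contDiff_const.add
    ((contDiff_slowTime δ).smul contDiff_const), fun t => hball ?_, by simp, ?_⟩
  · rw [Metric.mem_ball, dist_eq_norm, add_sub_cancel_left, norm_smul, Real.norm_eq_abs]
    have h1 : |slowTime δ t| * ‖v‖ ≤ δ * (‖v‖ + 1) :=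
      mul_le_mul (abs_slowTime_le hδ t) (by linarith [norm_nonneg v]) (norm_nonneg v) hδ.le
    have h2 : δ * (‖v‖ + 1) = ε / 2 := by
      have : ‖v‖ + 1 ≠ 0 := by positivity
      simp only [δ]
      field_simp
    linarith
  · have := ((hasDerivAt_slowTime hδ).smul_const v).const_add x
    rwa [one_smul] at this

/-- A submanifold contains curves with all velocities tangent to it. -/
theorem IsGraphAt.exists_curve {L : Set F} {p : F} {u : V → W} (h : IsGraphAt φ L p u)
    (hp : p ∈ L) (v : V) :
    ∃ η : ℝ → V, ContDiff ℝ ∞ η ∧ η 0 = (φ.toFun p).1 ∧ HasDerivAt η v 0 ∧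
      (∀ t, (η t, u (η t)) ∈ φ.target ∧ graphPt φ u (η t) ∈ L ∧
        IsGraphAt φ L (graphPt φ u (η t)) u) ∧
      ContMDiff 𝓘(ℝ, ℝ) I ∞ (fun t => graphPt φ u (η t)) ∧ graphPt φ u (η 0) = p := by
  obtain ⟨U, hU, hxU, hcd, hUL⟩ := h.exists_nhds hp
  obtain ⟨η, hη, hηU, h0, hd⟩ := GeodesicJets.exists_curve (hU.mem_nhds hxU) v
  refine ⟨η, hη, h0, hd, fun t => hUL _ (hηU t), ?_, by rw [h0, h.graphPt_eq hp]⟩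
  have h1 : ContDiff ℝ ∞ fun t => (η t, u (η t)) := by
    refine hη.prodMk (contDiff_iff_contDiffAt.2 fun t => ?_)
    exact ContDiffAt.comp (g := u) t (hcd.contDiffAt (hU.mem_nhds (hηU t))) hη.contDiffAt
  intro t
  exact ContMDiffAt.comp (g := φ.invFun) (f := fun t => (η t, u (η t))) t
    (φ.contMDiffOn_inv.contMDiffAt (φ.isOpen_target.mem_nhds (hUL _ (hηU t)).1))
    h1.contMDiff.contMDiffAt

/-- The derivative of a smooth function along a curve in a submanifold. -/
theorem hasDerivAt_along {s : PointedSub I A} {u : V → W} (hu : IsGraphAt φ s.carrier s.pt u)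
    {γ : ℝ → F} (hγ : ∀ t, γ t ∈ s.carrier) (hγc : ContMDiff 𝓘(ℝ, ℝ) I ∞ γ) (h0 : γ 0 = s.pt)
    {f : Jet I A r → ℝ} {g : JetCoords V W r → ℝ}
    (hg : IsRep f φ g (jet r u (φ.toFun s.pt).1)) :
    HasDerivAt (fun t => f (Jet.mk r (s.move (γ t) (hγ t))))
      (fderiv ℝ g (jet r u (φ.toFun s.pt).1) (hor (jet (r + 1) u (φ.toFun s.pt).1)
        (deriv (fun t => (φ.toFun (γ t)).1) 0))) 0 := by
  have hγ0 : Tendsto γ (𝓝 0) (𝓝 s.pt) := h0 ▸ hγc.continuous.continuousAt.tendsto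
  have h1 : ContDiffAt ℝ ∞ (fun t => φ.toFun (γ t)) 0 := by
    rw [← contMDiffAt_iff_contDiffAt]
    refine ContMDiffAt.comp (g := φ.toFun) 0 (φ.contMDiffOn_to.contMDiffAt ?_) (hγc 0)
    rw [h0]
    exact φ.source_mem_nhds hu.mem_source
  have h2 : HasDerivAt (fun t => (φ.toFun (γ t)).1) (deriv (fun t => (φ.toFun (γ t)).1) 0) 0 :=
    (h1.differentiableAt (by simp)).fst.hasDerivAt
  have h3 : HasFDerivAt (jet r u) (hor (jet (r + 1) u (φ.toFun s.pt).1)) (φ.toFun (γ 0)).1 := by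
    rw [h0]
    exact hasFDerivAt_jet hu.contDiffAt r
  have h4 := HasFDerivAt.comp_hasDerivAt (f := fun t => (φ.toFun (γ t)).1) 0 h3 h2
  have h5 : HasFDerivAt g (fderiv ℝ g (jet r u (φ.toFun s.pt).1))
      (jet r u (φ.toFun (γ 0)).1) := by
    rw [h0]
    exact (hg.contDiffAt.differentiableAt (by simp)).hasFDerivAt
  have h6 := HasFDerivAt.comp_hasDerivAt (f := fun t => jet r u (φ.toFun (γ t)).1) 0 h5 h4
  refine h6.congr_of_eventuallyEq ?_
  have h7 : Tendsto (fun t => jet r u (φ.toFun (γ t)).1) (𝓝 0)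
      (𝓝 (jet r u (φ.toFun s.pt).1)) := by
    have := h4.continuousAt.tendsto
    simp only [Function.comp, h0] at this
    exact this
  filter_upwards [hγ0.eventually (hu.eventually_isGraphAt s.pt_mem), h7.eventually hg.eventually]
    with t k1 k2
  exact k2 _ ⟨s.move (γ t) (hγ t), u, rfl, (k1 (hγ t)).1, rfl⟩

/-- The tangent vectors of the graph of the jets of a map. -/
def coordPlane (φ : DividedChart I F) (A : Set (Set F)) (c : JetCoords V W (r + 1)) :
    Submodule ℝ (Module.Dual ℝ (smoothFun I A r)) where
  carrier := {D | ∃ v : V, ∀ (f : smoothFun I A r) (g : JetCoords V W r → ℝ),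
    IsRep f.1 φ g (truncJ r.le_succ c) → D f = fderiv ℝ g (truncJ r.le_succ c) (hor c v)}
  add_mem' := by
    rintro D D' ⟨v, hv⟩ ⟨v', hv'⟩
    refine ⟨v + v', fun f g hg => ?_⟩
    rw [LinearMap.add_apply, hv f g hg, hv' f g hg, map_add, map_add]
  zero_mem' := ⟨0, fun f g hg => by simp⟩
  smul_mem' := by
    rintro a D ⟨v, hv⟩
    refine ⟨a • v, fun f g hg => ?_⟩
    rw [LinearMap.smul_apply, hv f g hg, map_smul, map_smul]

theorem mem_coordPlane {c : JetCoords V W (r + 1)} {D : Module.Dual ℝ (smoothFun I A r)} :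
    D ∈ coordPlane φ A c ↔ ∃ v : V, ∀ (f : smoothFun I A r) (g : JetCoords V W r → ℝ),
      IsRep f.1 φ g (truncJ r.le_succ c) → D f = fderiv ℝ g (truncJ r.le_succ c) (hor c v) :=
  Iff.rfl

/-- The `R`-plane in coordinates. -/
theorem RPlane_eq_coordPlane [FiniteDimensional ℝ V] {θ : Jet I A (r + 1)}
    {c : JetCoords V W (r + 1)} (hc : HasCoords φ θ c) : RPlane θ = coordPlane φ A c := by
  apply le_antisymm
  · refine Submodule.span_le.2 ?_
    rintro D ⟨s, rfl, γ, hγ, hγc, h0, hD⟩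
    obtain ⟨u, hu, rfl⟩ := hc.exists_isGraphAt (Nat.succ_le_succ r.zero_le)
    exact ⟨_, fun f g hg => (hD f).unique (hasDerivAt_along hu hγ hγc h0 hg)⟩
  · rintro D ⟨v, hv⟩
    obtain ⟨s, u, rfl, hu, rfl⟩ := hc
    obtain ⟨η, hη, hη0, hηd, hηm, hηc, hγ0⟩ := hu.exists_curve s.pt_mem v
    refine Submodule.subset_span ⟨s, rfl, fun t => graphPt φ u (η t), fun t => (hηm t).2.1, hηc,
      hγ0, fun f => ?_⟩
    obtain ⟨g, hg⟩ := exists_isRep f (hu.hasCoords (r := r))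
    have h := hasDerivAt_along hu (fun t => (hηm t).2.1) hηc hγ0 hg
    have e : (fun t => (φ.toFun (graphPt φ u (η t))).1) = η :=
      funext fun t => by rw [toFun_graphPt (hηm t).1]
    rw [e, hηd.deriv] at h
    have e2 := hv f g hg
    rw [truncJ_jet] at e2
    rw [e2]
    exact h

variable (I) in
/-- A class of submanifolds that is open: it contains germs of all submanifolds whose tangent plane
is close to that of a member. -/
def IsOpenClass (A : Set (Set F)) : Prop :=
  ∀ (φ : DividedChart I F) (θ : Jet I A 1) (c : JetCoords V W 1), HasCoords φ θ c →
    ∀ᶠ c' in 𝓝 c, ∀ u : V → W, (∃ U ∈ 𝓝 c'.1, ContDiffOn ℝ ∞ u U) → jet 1 u c'.1 = c' →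
      ∃ t : PointedSub I A, φ.toFun t.pt = ptJ c' ∧ IsGraphAt φ t.carrier t.pt u

theorem exists_jet_one (c : JetCoords V W 1) : ∃ u : V → W, ContDiff ℝ ∞ u ∧ jet 1 u c.1 = c := by
  refine ⟨fun x => val0 c + lin le_rfl c (x - c.1), ?_, ?_⟩
  · exact contDiff_const.add ((lin le_rfl c).contDiff.comp (contDiff_id.sub contDiff_const))
  · refine jetC1_ext ?_ ?_
    · rw [ptJ_jet]
      refine Prod.ext rfl ?_
      simp
    · rw [lin_jet]
      have h1 : HasFDerivAt (fun x : V => x - c.1) (ContinuousLinearMap.id ℝ V) c.1 :=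
        (hasFDerivAt_id _).sub_const _
      have h2 := ((lin le_rfl c).hasFDerivAt.comp c.1 h1).const_add (val0 c)
      exact h2.fderiv

theorem IsOpenClass.eventually_exists_jet (hA : IsOpenClass I A) {θ : Jet I A 1}
    {c : JetCoords V W 1} (hc : HasCoords φ θ c) :
    ∀ᶠ c' in 𝓝 c, ∃ θ' : Jet I A 1, HasCoords φ θ' c' := by
  filter_upwards [hA φ θ c hc] with c' h
  obtain ⟨u, hu, hj⟩ := exists_jet_one c'
  obtain ⟨t, ht, hg⟩ := h u ⟨univ, univ_mem, hu.contDiffOn⟩ hj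
  refine ⟨Jet.mk 1 t, t, u, rfl, hg, ?_⟩
  rw [ht, fst_ptJ, hj]

theorem isOpen_ptJ_target (φ : DividedChart I F) :
    IsOpen {c : JetCoords V W r | ptJ c ∈ φ.target} :=
  φ.isOpen_target.preimage (contDiff_ptJ (n := ∞)).continuous

section Separation

variable [FiniteDimensional ℝ V] [FiniteDimensional ℝ W] [T2Space F]

/-- Every smooth function of the coordinates is locally induced by a smooth function. -/
theorem exists_isRep_of_contDiffOn (hr : 1 ≤ r) {c : JetCoords V W r} (hc : ptJ c ∈ φ.target)
    {g : JetCoords V W r → ℝ} (hg : ContDiffOn ℝ ∞ g {c | ptJ c ∈ φ.target}) :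
    ∃ f : smoothFun I A r, IsRep f.1 φ g c ∧
      ∀ θ : Jet I A r, (∀ c', HasCoords φ θ c' → g c' = 0) → f.1 θ = 0 := by
  obtain ⟨χ, hχ, h1, hs⟩ := exists_cutoff A hr hc
  obtain ⟨N, hN, hopen, hm⟩ := eventually_nhds_iff.1 (h1.and
    ((φ.isOpen_target.preimage (contDiff_ptJ (n := ∞)).continuous).mem_nhds hc))
  refine ⟨⟨_, hs g hg⟩, ⟨N, hopen.mem_nhds hm, hg.mono fun c' hc' => (hN c' hc').2,
    fun θ' c' h' hm' => ?_⟩, fun θ h => ?_⟩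
  · refine (extendZero_apply hr _ h').trans ?_
    rw [Pi.mul_apply, (hN c' hm').1, Pi.one_apply, one_mul]
  -- Zeros of `g` survive the cutoff. This is what later produces global functions vanishing on a
  -- prolongation.
  · by_cases hex : ∃ c', HasCoords φ θ c'
    · obtain ⟨c', h'⟩ := hex
      refine (extendZero_apply hr _ h').trans ?_
      rw [Pi.mul_apply, h c' h', mul_zero]
    · exact extendZero_of_not _ hex

/-- Tangent vectors of the jet space are determined by the derivatives of smooth functions. -/
theorem eq_of_forall_fderiv_eq (hr : 1 ≤ r) {c : JetCoords V W r} (hc : ptJ c ∈ φ.target)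
    {a b : JetCoords V W r}
    (h : ∀ (f : smoothFun I A r) (g : JetCoords V W r → ℝ), IsRep f.1 φ g c →
      fderiv ℝ g c a = fderiv ℝ g c b) : a = b := by
  refine (SeparatingDual.eq_iff_forall_dual_eq (R := ℝ)).2 fun ℓ => ?_
  obtain ⟨f, hf, -⟩ := exists_isRep_of_contDiffOn (A := A) hr hc
    (g := fun c => ℓ c) (ContinuousLinearMap.contDiff ℓ).contDiffOn
  have := h f _ hf
  rwa [ContinuousLinearMap.fderiv] at this

theorem contDiffAt_of_forall_dual {X Y : Type*} [NormedAddCommGroup X] [NormedSpace ℝ X]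
    [NormedAddCommGroup Y] [NormedSpace ℝ Y] [FiniteDimensional ℝ Y] {f : X → Y} {x : X}
    {n : ℕ∞ω} (h : ∀ ℓ : Y →L[ℝ] ℝ, ContDiffAt ℝ n (fun x => ℓ (f x)) x) : ContDiffAt ℝ n f x := by
  let B := (Module.finBasis ℝ Y).equivFunL
  have h1 : ContDiffAt ℝ n (fun x => B (f x)) x := by
    refine contDiffAt_pi.2 fun i => ?_
    exact h ((ContinuousLinearMap.proj (R := ℝ)
      (φ := fun _ : Fin (Module.finrank ℝ Y) => ℝ) i).comp B.toContinuousLinearMap)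
  have h2 := B.symm.contDiff.contDiffAt.comp x h1
  have e : B.symm ∘ (fun x => B (f x)) = f := funext fun x => B.symm_apply_apply _
  rwa [e] at h2

/-- A map to the space of first order jets that is smooth in the sense of smooth functions is
smooth in coordinates. -/
theorem exists_smooth_coords {X : Type*} [NormedAddCommGroup X] [NormedSpace ℝ X]
    {j : X → Jet I A 1} {U : Set X} (hU : IsOpen U)
    (hj : ∀ f : smoothFun I A 1, ContDiffOn ℝ ∞ (fun x => f.1 (j x)) U) {x : X} (hx : x ∈ U)
    {c : JetCoords V W 1} (hc : HasCoords φ (j x) c) :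
    ∃ (κ : X → JetCoords V W 1) (U' : Set X), IsOpen U' ∧ x ∈ U' ∧ U' ⊆ U ∧
      (∀ y ∈ U', HasCoords φ (j y) (κ y)) ∧ ContDiffOn ℝ ∞ κ U' ∧ κ x = c := by
  obtain ⟨χ, hχ, h1, hs⟩ := exists_cutoff A le_rfl hc.mem_target
  let κ : X → JetCoords V W 1 := fun y => Classical.epsilon fun c => HasCoords φ (j y) c
  have hκ (y) (h : ∃ c, HasCoords φ (j y) c) : HasCoords φ (j y) (κ y) := Classical.epsilon_spec h
  -- Only global smooth functions can be composed with `j`. Where `fχ` is nonzero the jet has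
  -- coordinates in `φ`, and there a linear form `ℓ` of the coordinates is the quotient of the
  -- functions induced by `χ * ℓ` and by `χ`.
  let fχ : smoothFun I A 1 := ⟨_, hs 1 contDiffOn_const⟩
  have hfχ : ContDiffOn ℝ ∞ (fun y => fχ.1 (j y)) U := hj fχ
  have hfx : fχ.1 (j x) ≠ 0 := by
    have e : fχ.1 (j x) = (χ * 1) c := extendZero_apply le_rfl _ hc
    rw [e, Pi.mul_apply, h1.self_of_nhds]
    simp
  have hopen : IsOpen (U ∩ {y | fχ.1 (j y) ≠ 0}) :=
    hfχ.continuousOn.isOpen_inter_preimage hU isOpen_ne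
  have hdom (y) (hy : fχ.1 (j y) ≠ 0) : HasCoords φ (j y) (κ y) := by
    refine hκ y ?_
    by_contra hex
    exact hy (extendZero_of_not _ hex)
  have hlin (y) (hy : y ∈ U ∩ {y | fχ.1 (j y) ≠ 0}) (ℓ : JetCoords V W 1 →L[ℝ] ℝ) :
      ContDiffAt ℝ ∞ (fun z => ℓ (κ z)) y := by
    let fℓ : smoothFun I A 1 := ⟨_, hs (fun c => ℓ c) (ContinuousLinearMap.contDiff ℓ).contDiffOn⟩
    have hd := ((hj fℓ).contDiffAt (hU.mem_nhds hy.1)).div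
      (hfχ.contDiffAt (hU.mem_nhds hy.1)) hy.2
    refine hd.congr_of_eventuallyEq ?_
    filter_upwards [hopen.mem_nhds hy] with z hz
    have hcz := hdom z hz.2
    have e1 : fχ.1 (j z) = (χ * 1) (κ z) := extendZero_apply le_rfl _ hcz
    have e2 : fℓ.1 (j z) = (χ * fun c => ℓ c) (κ z) := extendZero_apply le_rfl _ hcz
    have hne : fχ.1 (j z) ≠ 0 := hz.2
    rw [e1] at hne
    change _ = fℓ.1 (j z) / fχ.1 (j z)
    rw [e1, e2, eq_div_iff hne]
    simp [mul_comm]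
  refine ⟨κ, _, hopen, ⟨hx, hfx⟩, inter_subset_left, fun y hy => hdom y hy.2, fun y hy => ?_,
    (hdom x hfx).unique le_rfl hc⟩
  refine ContDiffAt.contDiffWithinAt ?_
  -- Linear forms test smoothness of maps into finite-dimensional spaces, so the jet is split into
  -- its point and its slope.
  have e : κ = fun z => mkJ1 (ptJ (κ z), lin le_rfl (κ z)) :=
    funext fun z => (mkJ1_ptJ_lin _).symm
  rw [e]
  refine contDiff_mkJ1.contDiffAt.comp y (ContDiffAt.prodMk ?_ ?_)
  · exact contDiffAt_of_forall_dual fun ℓ => hlin y hy (ℓ.comp ptJ)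
  · exact contDiffAt_of_forall_dual fun ℓ => hlin y hy (ℓ.comp (lin le_rfl))

end Separation

end RPlanes

end GeodesicJets

namespace GeodesicJets

/-! ### Vector fields and connections in a chart -/

section ChartFields

variable {B : Type*} [NormedAddCommGroup B] [NormedSpace ℝ B]
  {H : Type*} [TopologicalSpace H] {I : ModelWithCorners ℝ B H}
  {F : Type*} [TopologicalSpace F] [ChartedSpace H F]

variable (I) in
/-- A diffeomorphism of an open set of `F` onto an open set of the model space. -/
structure IsSmoothChart (e : OpenPartialHomeomorph F B) : Prop where
  fwd : ContMDiffOn I 𝓘(ℝ, B) ∞ e e.source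
  inv : ContMDiffOn 𝓘(ℝ, B) I ∞ e.symm e.target

variable {e : OpenPartialHomeomorph F B}

theorem IsSmoothChart.mdifferentiable (he : IsSmoothChart I e) :
    e.MDifferentiable I 𝓘(ℝ, B) :=
  ⟨he.fwd.mdifferentiableOn (by simp), he.inv.mdifferentiableOn (by simp)⟩

variable (I) in
/-- The differential of a chart. -/
noncomputable def chartD (e : OpenPartialHomeomorph F B) (q : F) (X : TangentSpace I q) : B :=
  mfderiv I 𝓘(ℝ, B) e q X

variable (I) in
/-- The differential of the inverse of a chart. -/
noncomputable def chartDinv (e : OpenPartialHomeomorph F B) (q : F) (a : B) : TangentSpace I q :=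
  mfderiv 𝓘(ℝ, B) I e.symm (e q) a

theorem chartD_add (q : F) (X Y : TangentSpace I q) :
    chartD I e q (X + Y) = chartD I e q X + chartD I e q Y :=
  map_add (mfderiv I 𝓘(ℝ, B) e q) X Y

theorem chartD_smul (q : F) (a : ℝ) (X : TangentSpace I q) :
    chartD I e q (a • X) = a • chartD I e q X :=
  map_smul (mfderiv I 𝓘(ℝ, B) e q) a X

theorem chartD_sub (q : F) (X Y : TangentSpace I q) :
    chartD I e q (X - Y) = chartD I e q X - chartD I e q Y :=
  map_sub (mfderiv I 𝓘(ℝ, B) e q) X Y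

theorem chartDinv_add (q : F) (a b : B) :
    chartDinv I e q (a + b) = chartDinv I e q a + chartDinv I e q b :=
  map_add (mfderiv 𝓘(ℝ, B) I e.symm (e q)) a b

theorem chartDinv_smul (q : F) (t : ℝ) (a : B) :
    chartDinv I e q (t • a) = t • chartDinv I e q a :=
  map_smul (mfderiv 𝓘(ℝ, B) I e.symm (e q)) t a

theorem chartD_chartDinv (he : IsSmoothChart I e) {q : F} (hq : q ∈ e.source) (a : B) :
    chartD I e q (chartDinv I e q a) = a := by
  have h := he.mdifferentiable.comp_symm_deriv (e.map_source hq)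
  rw [e.left_inv hq] at h
  exact congrArg (fun T : B →L[ℝ] B => T a) h

theorem chartDinv_chartD (he : IsSmoothChart I e) {q : F} (hq : q ∈ e.source)
    (X : TangentSpace I q) : chartDinv I e q (chartD I e q X) = X := by
  have h := he.mdifferentiable.symm_comp_deriv hq
  exact congrArg (fun T : TangentSpace I q →L[ℝ] TangentSpace I q => T X) h

theorem chartD_injective (he : IsSmoothChart I e) {q : F} (hq : q ∈ e.source)
    {X Y : TangentSpace I q} (h : chartD I e q X = chartD I e q Y) : X = Y := by
  rw [← chartDinv_chartD he hq X, h, chartDinv_chartD he hq Y]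

variable (I) in
/-- The expression of a vector field in a chart. -/
noncomputable def chartField (e : OpenPartialHomeomorph F B) (Y : (q : F) → TangentSpace I q)
    (z : B) : B :=
  chartD I e (e.symm z) (Y (e.symm z))

variable (I) in
/-- The vector field with a given expression in a chart. -/
noncomputable def pullField (e : OpenPartialHomeomorph F B) (Z : B → B) (q : F) :
    TangentSpace I q :=
  chartDinv I e q (Z (e q))

theorem chartField_apply {q : F} (hq : q ∈ e.source) (Y : (q : F) → TangentSpace I q) :
    chartField I e Y (e q) = chartD I e q (Y q) := by
  rw [chartField, e.left_inv hq]

theorem chartD_pullField (he : IsSmoothChart I e) {q : F} (hq : q ∈ e.source) (Z : B → B) :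
    chartD I e q (pullField I e Z q) = Z (e q) :=
  chartD_chartDinv he hq _

theorem chartField_pullField (he : IsSmoothChart I e) {z : B} (hz : z ∈ e.target) (Z : B → B) :
    chartField I e (pullField I e Z) z = Z z := by
  rw [chartField, chartD_pullField he (e.map_target hz), e.right_inv hz]

theorem pullField_chartField (he : IsSmoothChart I e) {q : F} (hq : q ∈ e.source)
    (Y : (q : F) → TangentSpace I q) : pullField I e (chartField I e Y) q = Y q := by
  rw [pullField, chartField_apply hq, chartDinv_chartD he hq]

variable [IsManifold I ∞ F]

/-- The vector field `Y` is smooth at `p`. -/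
def IsSmoothFieldAt (Y : (q : F) → TangentSpace I q) (p : F) : Prop :=
  ContMDiffAt I I.tangent ∞ (fun q => (⟨q, Y q⟩ : TangentBundle I F)) p

theorem IsSmoothChart.contMDiffAt_tangentMap (he : IsSmoothChart I e) {X : TangentBundle I F}
    (hX : X.proj ∈ e.source) :
    ContMDiffAt I.tangent 𝓘(ℝ, B).tangent ∞ (tangentMap I 𝓘(ℝ, B) e) X := by
  have : IsManifold I 1 F := IsManifold.of_le (n := ∞) (by simp)
  have h := he.fwd.contMDiffOn_tangentMapWithin (m := ∞) le_rfl e.open_source.uniqueMDiffOn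
  have ho : IsOpen (Bundle.TotalSpace.proj ⁻¹' e.source : Set (TangentBundle I F)) :=
    e.open_source.preimage (FiberBundle.continuous_proj B (TangentSpace I : F → Type _))
  refine (h.contMDiffAt (ho.mem_nhds hX)).congr_of_eventuallyEq ?_
  filter_upwards [ho.mem_nhds hX] with Y hY
  rw [tangentMapWithin_eq_tangentMap (e.open_source.uniqueMDiffOn _ hY)
    (he.mdifferentiable.mdifferentiableAt hY)]

theorem IsSmoothChart.contMDiffAt_tangentMap_symm (he : IsSmoothChart I e)
    {X : TangentBundle 𝓘(ℝ, B) B} (hX : X.proj ∈ e.target) :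
    ContMDiffAt 𝓘(ℝ, B).tangent I.tangent ∞ (tangentMap 𝓘(ℝ, B) I e.symm) X := by
  have : IsManifold I 1 F := IsManifold.of_le (n := ∞) (by simp)
  have h := he.inv.contMDiffOn_tangentMapWithin (m := ∞) le_rfl e.open_target.uniqueMDiffOn
  have ho : IsOpen (Bundle.TotalSpace.proj ⁻¹' e.target : Set (TangentBundle 𝓘(ℝ, B) B)) :=
    e.open_target.preimage (FiberBundle.continuous_proj B (TangentSpace 𝓘(ℝ, B) : B → Type _))
  refine (h.contMDiffAt (ho.mem_nhds hX)).congr_of_eventuallyEq ?_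
  filter_upwards [ho.mem_nhds hX] with Y hY
  rw [tangentMapWithin_eq_tangentMap (e.open_target.uniqueMDiffOn _ hY)
    (he.mdifferentiable.mdifferentiableAt_symm hY)]

theorem contDiffAt_chartField (he : IsSmoothChart I e) {q : F} (hq : q ∈ e.source)
    {Y : (q : F) → TangentSpace I q} (hY : IsSmoothFieldAt Y q) :
    ContDiffAt ℝ ∞ (chartField I e Y) (e q) := by
  have h1 : ContMDiffAt 𝓘(ℝ, B) I ∞ e.symm (e q) :=
    he.inv.contMDiffAt (e.open_target.mem_nhds (e.map_source hq))
  have h2 : ContMDiffAt 𝓘(ℝ, B) I.tangent ∞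
      (fun z => (⟨e.symm z, Y (e.symm z)⟩ : TangentBundle I F)) (e q) := by
    refine ContMDiffAt.comp (g := fun q => (⟨q, Y q⟩ : TangentBundle I F)) (e q) ?_ h1
    rw [e.left_inv hq]; exact hY
  have h3 := ContMDiffAt.comp (g := tangentMap I 𝓘(ℝ, B) e) (e q)
    (he.contMDiffAt_tangentMap (e.map_target (e.map_source hq))) h2
  rw [← contMDiffAt_vectorSpace_iff_contDiffAt (V := chartField I e Y)]
  refine h3.congr_of_eventuallyEq ?_
  filter_upwards [e.open_target.mem_nhds (e.map_source hq)] with z hz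
  exact Bundle.TotalSpace.ext (e.right_inv hz).symm (heq_of_eq rfl)

theorem isSmoothFieldAt_pullField (he : IsSmoothChart I e) {q : F} (hq : q ∈ e.source)
    {Z : B → B} (hZ : ContDiffAt ℝ ∞ Z (e q)) : IsSmoothFieldAt (pullField I e Z) q := by
  have h1 : ContMDiffAt I 𝓘(ℝ, B) ∞ e q := he.fwd.contMDiffAt (e.open_source.mem_nhds hq)
  rw [← contMDiffAt_vectorSpace_iff_contDiffAt (V := Z)] at hZ
  have h2 := ContMDiffAt.comp (g := fun z => (⟨z, Z z⟩ : TangentBundle 𝓘(ℝ, B) B)) q hZ h1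
  have h3 := ContMDiffAt.comp (g := tangentMap 𝓘(ℝ, B) I e.symm) q
    (he.contMDiffAt_tangentMap_symm (e.map_source hq)) h2
  refine h3.congr_of_eventuallyEq ?_
  filter_upwards [e.open_source.mem_nhds hq] with z hz
  exact Bundle.TotalSpace.ext (e.left_inv hz).symm (heq_of_eq rfl)

theorem IsSmoothFieldAt.mdifferentiableAt {q : F} {Y : (q : F) → TangentSpace I q}
    (hY : IsSmoothFieldAt Y q) :
    MDifferentiableAt I I.tangent (fun q => (⟨q, Y q⟩ : TangentBundle I F)) q :=
  ContMDiffAt.mdifferentiableAt hY (by simp)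

/-- `c` is the Christoffel form of `nabla` in the chart `e` at `e q`. -/
def ChristoffelAt (nabla : LinearConnection I F) (e : OpenPartialHomeomorph F B) (q : F)
    (c : B →L[ℝ] B →L[ℝ] B) : Prop :=
  ∀ Y : (q : F) → TangentSpace I q, IsSmoothFieldAt Y q → ∀ X : TangentSpace I q,
    chartD I e q (nabla Y q X) =
      fderiv ℝ (chartField I e Y) (e q) (chartD I e q X) + c (chartD I e q X) (chartD I e q (Y q))

/-- `C` is the Christoffel form of `nabla` in the chart `e`. -/
structure HasChristoffel (nabla : LinearConnection I F) (e : OpenPartialHomeomorph F B)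
    (C : B → B →L[ℝ] B →L[ℝ] B) : Prop where
  smooth : ContDiffOn ℝ ∞ C e.target
  symm : ∀ z ∈ e.target, ∀ a b, C z a b = C z b a
  eq : ∀ q ∈ e.source, ChristoffelAt nabla e q (C (e q))

end ChartFields

section Divided

variable {V W : Type*} [NormedAddCommGroup V] [NormedSpace ℝ V]
  [NormedAddCommGroup W] [NormedSpace ℝ W]
  {H : Type*} [TopologicalSpace H]
  {I : ModelWithCorners ℝ (V × W) H} {F : Type*} [TopologicalSpace F] [ChartedSpace H F]

theorem DividedChart.isSmoothChart (φ : DividedChart I F) :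
    IsSmoothChart I φ.toOpenPartialHomeomorph :=
  ⟨φ.contMDiffOn_to, φ.contMDiffOn_inv⟩

end Divided

end GeodesicJets

namespace GeodesicJets

/-! ### The tower of derivatives of the solutions of `D²u = G` -/

section Tower

variable {V W : Type*} [NormedAddCommGroup V] [NormedSpace ℝ V]
  [NormedAddCommGroup W] [NormedSpace ℝ W]
  {G : JetCoords V W 1 → V →L[ℝ] V →L[ℝ] W} {Ω : Set (JetCoords V W 1)} {c : JetCoords V W 1}

/-- The total derivatives on the space of first order jets determined by the system `D²u = G`. -/
noncomputable def horLift (G : JetCoords V W 1 → V →L[ℝ] V →L[ℝ] W) (c : JetCoords V W 1) :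
    V →L[ℝ] JetCoords V W 1 :=
  mkJ1.comp (((ContinuousLinearMap.id ℝ V).prod (lin le_rfl c)).prod (G c))

/-- The derivatives of order `k` of the solutions of the system `D²u = G`, as functions of the
first order jet. -/
noncomputable def towerComp (G : JetCoords V W 1 → V →L[ℝ] V →L[ℝ] W) :
    (k : ℕ) → JetCoords V W 1 → ContinuousMultilinearMap ℝ (fun _ : Fin k => V) W
  | 0 => fun c => compJ 0 (by omega) c
  | k + 1 => fun c => (curryL V W k).symm ((fderiv ℝ (towerComp G k) c).comp (horLift G c))

/-- The jets of the solutions of the system `D²u = G`, as functions of the first order jet. -/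
noncomputable def tower (G : JetCoords V W 1 → V →L[ℝ] V →L[ℝ] W) (l : ℕ) (c : JetCoords V W 1) :
    JetCoords V W l :=
  (c.1, fun k => towerComp G k c)

@[simp] theorem ptJ_horLift (v : V) : ptJ (horLift G c v) = (v, lin le_rfl c v) := rfl

@[simp] theorem lin_horLift (v : V) : lin le_rfl (horLift G c v) = G c v := lin_mkJ1 _ _

@[simp] theorem fst_horLift (v : V) : (horLift G c v).1 = v := rfl

@[simp] theorem compJ_tower {l k : ℕ} (h : k < l + 1) :
    compJ k h (tower G l c) = towerComp G k c := rfl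

@[simp] theorem truncJ_tower {k l : ℕ} (h : k ≤ l) : truncJ h (tower G l c) = tower G k c := rfl

/-- The recursion starts from the value alone; its first step differentiates the value along
`horLift`, and this derivative is the slope. -/
theorem towerComp_one : towerComp G 1 c = compJ 1 (by omega) c := by
  refine (curryL V W 0).injective ?_
  rw [towerComp, ContinuousLinearEquiv.apply_symm_apply]
  ext1 v
  have e : towerComp G 0 = fun c => compJ 0 (by omega) c := rfl
  rw [e, ContinuousLinearMap.comp_apply, ContinuousLinearMap.fderiv]
  apply (continuousMultilinearCurryFin0 ℝ V W).injective
  have h : val0 (horLift G c v) = lin le_rfl c v := rfl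
  refine h.trans ?_
  simp [lin, curryL]

@[simp] theorem tower_one : tower G 1 c = c := by
  refine jetC_ext rfl fun k hk => ?_
  interval_cases k
  · rfl
  · exact towerComp_one

theorem contDiffOn_horLift [FiniteDimensional ℝ V] (hG : ContDiffOn ℝ ∞ G Ω) :
    ContDiffOn ℝ ∞ (horLift G) Ω := by
  refine contDiffOn_clm_apply.2 fun v => ?_
  refine contDiff_mkJ1.comp_contDiffOn (ContDiffOn.prodMk (ContDiffOn.prodMk contDiffOn_const
    ((contDiff_lin le_rfl).contDiffOn.clm_apply contDiffOn_const))
    (hG.clm_apply contDiffOn_const))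

variable [FiniteDimensional ℝ V]

theorem contDiffOn_towerComp (hΩ : IsOpen Ω) (hG : ContDiffOn ℝ ∞ G Ω) (k : ℕ) :
    ContDiffOn ℝ ∞ (towerComp G k) Ω := by
  induction k with
  | zero => exact (contDiff_compJ _).contDiffOn
  | succ k ih =>
    exact contDiff_curryL_symm.comp_contDiffOn
      ((ih.fderiv_of_isOpen hΩ (m := ∞) (by norm_cast)).clm_comp (contDiffOn_horLift hG))

theorem contDiffOn_tower (hΩ : IsOpen Ω) (hG : ContDiffOn ℝ ∞ G Ω) (l : ℕ) :
    ContDiffOn ℝ ∞ (tower G l) Ω :=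
  contDiff_fst.contDiffOn.prodMk
    (contDiffOn_pi.2 fun k => contDiffOn_towerComp hΩ hG k)

/-- Componentwise this is the recursion defining `towerComp`. It says that the tower carries the
total derivatives of first order jets to those of jets of order `l`, which is all that the later
comparisons of planes use. -/
theorem fderiv_tower_horLift (hΩ : IsOpen Ω) (hG : ContDiffOn ℝ ∞ G Ω) (hc : c ∈ Ω) (l : ℕ)
    (v : V) : fderiv ℝ (tower G l) c (horLift G c v) = hor (tower G (l + 1) c) v := by
  have hd : DifferentiableAt ℝ (tower G l) c :=
    ((contDiffOn_tower hΩ hG l).contDiffAt (hΩ.mem_nhds hc)).differentiableAt (by simp)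
  refine jetC_ext ?_ fun k hk => ?_
  · have h1 := (ContinuousLinearMap.fst ℝ V
      ((k : Fin (l + 1)) → ContinuousMultilinearMap ℝ (fun _ : Fin (k : ℕ) => V) W)).hasFDerivAt.comp
      c hd.hasFDerivAt
    have h2 : HasFDerivAt (fun c : JetCoords V W 1 => c.1) (ContinuousLinearMap.fst ℝ V _) c :=
      hasFDerivAt_fst
    exact congrArg (fun T => T (horLift G c v)) (h1.unique h2)
  · have h1 := (compJ (V := V) (W := W) k hk).hasFDerivAt.comp c hd.hasFDerivAt
    have h2 : HasFDerivAt (towerComp G k) (fderiv ℝ (towerComp G k) c) c :=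
      (((contDiffOn_towerComp hΩ hG k).contDiffAt (hΩ.mem_nhds hc)).differentiableAt
        (by simp)).hasFDerivAt
    have h3 := congrArg (fun T => T (horLift G c v)) (h1.unique h2)
    refine h3.trans ?_
    rw [compJ_hor, compJ_tower, towerComp, ContinuousLinearEquiv.apply_symm_apply]
    rfl

/-- Case `l = 1` of `fderiv_tower_horLift`, where the tower is the identity. -/
theorem hor_tower_two (hΩ : IsOpen Ω) (hG : ContDiffOn ℝ ∞ G Ω) (hc : c ∈ Ω) :
    hor (tower G 2 c) = horLift G c := by
  ext1 v
  rw [← fderiv_tower_horLift hΩ hG hc]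
  have e : tower G 1 = id := funext fun c => tower_one
  rw [e, fderiv_id]
  rfl

theorem bilin_towerComp_two (hΩ : IsOpen Ω) (hG : ContDiffOn ℝ ∞ G Ω) (hc : c ∈ Ω) :
    bilin V W (towerComp G 2 c) = G c := by
  ext1 v
  have h := lin_hor le_rfl (tower G 2 c) v
  rw [hor_tower_two hΩ hG hc, lin_horLift] at h
  exact h.symm

/-- A second order jet is its first order part together with its second derivative, and the latter
is `G` on the tower. -/
theorem eq_tower_two_iff (hΩ : IsOpen Ω) (hG : ContDiffOn ℝ ∞ G Ω) {c₂ : JetCoords V W 2}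
    (hc : truncJ (Nat.le_succ 1) c₂ ∈ Ω) :
    c₂ = tower G 2 (truncJ (Nat.le_succ 1) c₂) ↔
      bilin V W (compJ 2 (by omega) c₂) = G (truncJ (Nat.le_succ 1) c₂) := by
  constructor
  · intro h
    conv_lhs => rw [h]
    exact bilin_towerComp_two hΩ hG hc
  · intro h
    refine jetC_ext rfl fun k hk => ?_
    interval_cases k
    · rfl
    · exact (towerComp_one (G := G) (c := truncJ (Nat.le_succ 1) c₂)).symm
    · apply (bilin V W).injective
      rw [h, compJ_tower, bilin_towerComp_two hΩ hG hc]

end Tower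

end GeodesicJets

namespace GeodesicJets

/-! ### Tangent planes and the second fundamental form in coordinates -/

section Planes

variable {V W : Type*} [NormedAddCommGroup V] [NormedSpace ℝ V]
  [NormedAddCommGroup W] [NormedSpace ℝ W]
  {H : Type*} [TopologicalSpace H]
  {I : ModelWithCorners ℝ (V × W) H} {F : Type*} [TopologicalSpace F] [ChartedSpace H F]
  {A : Set (Set F)} {φ : DividedChart I F}

/-- The differential of a divided chart. -/
noncomputable def DividedChart.diff (φ : DividedChart I F) (p : F) (X : TangentSpace I p) :
    V × W :=
  chartD I φ.toOpenPartialHomeomorph p X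

theorem hasDerivAt_chart_curve {γ : ℝ → F} (hγ : ContMDiff 𝓘(ℝ, ℝ) I ∞ γ)
    (h0 : γ 0 ∈ φ.source) :
    HasDerivAt (fun t => φ.toFun (γ t)) (φ.diff (γ 0) (tangentMap 𝓘(ℝ, ℝ) I γ ⟨0, 1⟩).2) 0 := by
  have h1 : HasMFDerivAt I 𝓘(ℝ, V × W) φ.toFun (γ 0) (mfderiv I 𝓘(ℝ, V × W) φ.toFun (γ 0)) :=
    (φ.isSmoothChart.mdifferentiable.mdifferentiableAt h0).hasMFDerivAt
  have h2 := h1.comp 0 ((hγ 0).mdifferentiableAt (by simp)).hasMFDerivAt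
  let T : ℝ →L[ℝ] V × W := (mfderiv I 𝓘(ℝ, V × W) φ.toFun (γ 0)).comp (mfderiv 𝓘(ℝ, ℝ) I γ 0)
  have h3 : HasFDerivAt (fun t => φ.toFun (γ t)) T 0 := hasMFDerivAt_iff_hasFDerivAt.1 h2
  exact h3.hasDerivAt

/-- A curve in the submanifold satisfies the graph equation, whose derivative is the stated
relation. Conversely `IsGraphAt.exists_curve` gives a curve with the required base velocity, and the
relation forces its fibre velocity. -/
theorem mem_tangentVectors {s : PointedSub I A} {u : V → W} (hu : IsGraphAt φ s.carrier s.pt u)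
    {X : TangentSpace I s.pt} :
    (⟨s.pt, X⟩ : TangentBundle I F) ∈ s.tangentVectors ↔
      (φ.diff s.pt X).2 = fderiv ℝ u (φ.toFun s.pt).1 (φ.diff s.pt X).1 := by
  have key : ∀ γ : ℝ → F, ContMDiff 𝓘(ℝ, ℝ) I ∞ γ → (∀ t, γ t ∈ s.carrier) → γ 0 = s.pt →
      ((φ.diff (γ 0) (tangentMap 𝓘(ℝ, ℝ) I γ ⟨0, 1⟩).2).2 = fderiv ℝ u (φ.toFun s.pt).1
        (φ.diff (γ 0) (tangentMap 𝓘(ℝ, ℝ) I γ ⟨0, 1⟩).2).1) := by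
    intro γ hγ hL h0
    have h1 := hasDerivAt_chart_curve (φ := φ) hγ (h0 ▸ hu.mem_source)
    have h2 : HasFDerivAt u (fderiv ℝ u (φ.toFun s.pt).1) (φ.toFun (γ 0)).1 := by
      rw [h0]
      exact (hu.contDiffAt.differentiableAt (by simp)).hasFDerivAt
    have h3 := HasFDerivAt.comp_hasDerivAt (f := fun t => (φ.toFun (γ t)).1) 0 h2
      h1.hasFDerivAt.fst.hasDerivAt
    have h4 := h1.hasFDerivAt.snd.hasDerivAt
    have h5 : (fun t => (φ.toFun (γ t)).2) =ᶠ[𝓝 0] u ∘ fun t => (φ.toFun (γ t)).1 := by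
      have hc : Tendsto γ (𝓝 0) (𝓝 s.pt) := h0 ▸ hγ.continuous.continuousAt.tendsto
      filter_upwards [hc.eventually hu.graph] with t ht using ht.1 (hL t)
    have h6 := h4.unique (h3.congr_of_eventuallyEq h5)
    simpa using h6
  constructor
  · rintro ⟨γ, hγ, hL, h0, he⟩
    have k := key γ hγ hL h0
    have e : ∀ Y : TangentBundle I F, (⟨s.pt, X⟩ : TangentBundle I F) = Y →
      φ.diff Y.1 Y.2 = φ.diff s.pt X := by rintro _ rfl; rfl
    have e' := e _ he
    change φ.diff (γ 0) (tangentMap 𝓘(ℝ, ℝ) I γ ⟨0, 1⟩).2 = _ at e'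
    rwa [e'] at k
  · intro h
    obtain ⟨η, -, -, hηd, hηm, hηc, hγ0⟩ := hu.exists_curve s.pt_mem (φ.diff s.pt X).1
    refine ⟨_, hηc, fun t => (hηm t).2.1, hγ0, ?_⟩
    have k := key _ hηc (fun t => (hηm t).2.1) hγ0
    have h1 := hasDerivAt_chart_curve (φ := φ) hηc (hγ0 ▸ hu.mem_source)
    have h2 := h1.hasFDerivAt.fst.hasDerivAt
    have e2 : (fun t => (φ.toFun (graphPt φ u (η t))).1) = η :=
      funext fun t => by rw [toFun_graphPt (hηm t).1]
    rw [e2] at h2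
    have e3 : (φ.diff s.pt X).1 = (φ.diff (graphPt φ u (η 0))
      (tangentMap 𝓘(ℝ, ℝ) I (fun t => graphPt φ u (η t)) ⟨0, 1⟩).2).1 := by
      simpa using hηd.unique h2
    have e4 : φ.diff s.pt X = φ.diff (graphPt φ u (η 0))
        (tangentMap 𝓘(ℝ, ℝ) I (fun t => graphPt φ u (η t)) ⟨0, 1⟩).2 :=
      Prod.ext e3 (by rw [h, k, e3])
    -- The base point of the velocity equals `s.pt` only up to a proof; stating the claim for an
    -- arbitrary tangent vector lets the equality be substituted.
    have fin : ∀ Y : TangentBundle I F, Y.1 = s.pt → φ.diff s.pt X = φ.diff Y.1 Y.2 →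
        (⟨s.pt, X⟩ : TangentBundle I F) = Y := by
      rintro ⟨q, Y⟩ hq hY
      change q = s.pt at hq
      subst hq
      rw [chartD_injective φ.isSmoothChart hu.mem_source hY]
    exact fin _ hγ0 e4

theorem proj_of_mem_tangentVectors {s : PointedSub I A} {X : TangentBundle I F}
    (hX : X ∈ s.tangentVectors) : X.proj = s.pt := by
  obtain ⟨γ, -, -, h0, rfl⟩ := hX
  exact h0

theorem proj_of_mem_plane {θ : Jet I A 1} {X : TangentBundle I F} (hX : X ∈ θ.plane) :
    X.proj = θ.base := by
  obtain ⟨s, rfl, hX⟩ := hX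
  exact proj_of_mem_tangentVectors hX

theorem mem_plane [FiniteDimensional ℝ V] {θ : Jet I A 1} {c : JetCoords V W 1}
    (hc : HasCoords φ θ c) {p : F} (hp : θ.base = p) {X : TangentSpace I p} :
    (⟨p, X⟩ : TangentBundle I F) ∈ θ.plane ↔
      (φ.diff p X).2 = lin le_rfl c (φ.diff p X).1 := by
  subst hp
  constructor
  · rintro ⟨s, rfl, hX⟩
    obtain ⟨u, hu, rfl⟩ := hc.exists_isGraphAt le_rfl
    rw [lin_jet]
    exact (mem_tangentVectors hu).1 hX
  · intro h
    obtain ⟨s, u, rfl, hu, rfl⟩ := hc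
    rw [lin_jet] at h
    exact ⟨s, rfl, (mem_tangentVectors hu).2 h⟩

end Planes

section SecondForm

variable {V W : Type*} [NormedAddCommGroup V] [NormedSpace ℝ V]
  [NormedAddCommGroup W] [NormedSpace ℝ W]

/-- The right-hand side of the equation `D²u = G` of totally geodesic graphs, for a connection
with Christoffel form `C`. -/
noncomputable def geodesicForm (C : V × W → (V × W) →L[ℝ] (V × W) →L[ℝ] (V × W))
    (c : JetCoords V W 1) : V →L[ℝ] V →L[ℝ] W :=
  (ContinuousLinearMap.compL ℝ V (V × W) W ((lin le_rfl c).comp (ContinuousLinearMap.fst ℝ V W) -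
    ContinuousLinearMap.snd ℝ V W)).comp
    ((C (ptJ c)).bilinearComp ((ContinuousLinearMap.id ℝ V).prod (lin le_rfl c))
      ((ContinuousLinearMap.id ℝ V).prod (lin le_rfl c)))

variable {C : V × W → (V × W) →L[ℝ] (V × W) →L[ℝ] (V × W)} {c : JetCoords V W 1}

theorem geodesicForm_apply (v b : V) : geodesicForm C c v b =
    lin le_rfl c (C (ptJ c) (v, lin le_rfl c v) (b, lin le_rfl c b)).1 -
      (C (ptJ c) (v, lin le_rfl c v) (b, lin le_rfl c b)).2 := by
  simp [geodesicForm]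

theorem contDiffOn_geodesicForm [FiniteDimensional ℝ V] {U : Set (V × W)}
    (hC : ContDiffOn ℝ ∞ C U) :
    ContDiffOn ℝ ∞ (geodesicForm C) {c | ptJ c ∈ U} := by
  refine contDiffOn_clm_apply.2 fun v => contDiffOn_clm_apply.2 fun b => ?_
  simp only [geodesicForm_apply]
  have hP : ContDiffOn ℝ ∞ (fun c : JetCoords V W 1 => lin le_rfl c) {c | ptJ c ∈ U} :=
    (contDiff_lin le_rfl).contDiffOn
  have hv (v : V) : ContDiffOn ℝ ∞ (fun c : JetCoords V W 1 => (v, lin le_rfl c v))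
      {c | ptJ c ∈ U} := contDiffOn_const.prodMk (hP.clm_apply contDiffOn_const)
  have hCc : ContDiffOn ℝ ∞ (fun c : JetCoords V W 1 => C (ptJ c)) {c | ptJ c ∈ U} :=
    hC.comp contDiff_ptJ.contDiffOn fun c hc => hc
  have h := (hCc.clm_apply (hv v)).clm_apply (hv b)
  exact (hP.clm_apply (contDiff_fst.comp_contDiffOn h)).sub (contDiff_snd.comp_contDiffOn h)

theorem geodesicForm_symm (hC : ∀ a b, C (ptJ c) a b = C (ptJ c) b a) (v b : V) :
    geodesicForm C c v b = geodesicForm C c b v := by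
  rw [geodesicForm_apply, geodesicForm_apply, hC]

/-- The derivative of a vector field lying in a field of planes. -/
theorem fderiv_field_of_mem_planes {K : Type*} [NormedAddCommGroup K] [NormedSpace ℝ K]
    {ζ : K → V × W} {ζ' : K →L[ℝ] V × W} {P : K → V →L[ℝ] W} {P' : K →L[ℝ] V →L[ℝ] W} {k : K}
    (hζ : HasFDerivAt ζ ζ' k) (hP : HasFDerivAt P P' k) {Z : V × W → V × W}
    (hZ : DifferentiableAt ℝ Z (ζ k)) (h : ∀ᶠ k in 𝓝 k, (Z (ζ k)).2 = P k (Z (ζ k)).1) (a : K) :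
    (fderiv ℝ Z (ζ k) (ζ' a)).2 =
      P' a (Z (ζ k)).1 + P k (fderiv ℝ Z (ζ k) (ζ' a)).1 := by
  have h1 : HasFDerivAt (fun k => Z (ζ k)) ((fderiv ℝ Z (ζ k)).comp ζ') k :=
    hZ.hasFDerivAt.comp k hζ
  have h2 := hP.clm_apply h1.fst
  have h3 := h1.snd.unique (h2.congr_of_eventuallyEq h)
  have h4 := congrArg (fun T => T a) h3
  simp only [ContinuousLinearMap.comp_apply, add_apply,
    ContinuousLinearMap.flip_apply] at h4
  rw [add_comm]
  exact h4

end SecondForm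

section Equation

variable {V W : Type*} [NormedAddCommGroup V] [NormedSpace ℝ V]
  [NormedAddCommGroup W] [NormedSpace ℝ W]
  {H : Type*} [TopologicalSpace H]
  {I : ModelWithCorners ℝ (V × W) H} {F : Type*} [TopologicalSpace F] [ChartedSpace H F]
  [IsManifold I ∞ F] {A : Set (Set F)} {φ : DividedChart I F} {nabla : LinearConnection I F}
  {C : V × W → (V × W) →L[ℝ] (V × W) →L[ℝ] (V × W)}

/-- The covariant derivative of a vector field lying in a field of planes is in the plane if and
only if the derivative of the field of planes is given by `geodesicForm`. -/
theorem covariant_mem_plane_iff {c : JetCoords V W 1} {p : F} (hp : p ∈ φ.source)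
    (hpc : φ.toFun p = ptJ c)
    (hC : ChristoffelAt nabla φ.toOpenPartialHomeomorph p (C (ptJ c)))
    {K : Type*} [NormedAddCommGroup K] [NormedSpace ℝ K]
    {ζ : K → V × W} {ζ' : K →L[ℝ] V × W} {P : K → V →L[ℝ] W} {P' : K →L[ℝ] V →L[ℝ] W} {k : K}
    (hζ : HasFDerivAt ζ ζ' k) (hP : HasFDerivAt P P' k) (hk : ζ k = ptJ c)
    (hPk : P k = lin le_rfl c) {Y : (q : F) → TangentSpace I q} (hY : IsSmoothFieldAt Y p)
    (h : ∀ᶠ k in 𝓝 k, (chartField I φ.toOpenPartialHomeomorph Y (ζ k)).2 =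
      P k (chartField I φ.toOpenPartialHomeomorph Y (ζ k)).1) {X : TangentSpace I p}
    {a : K} (ha : φ.diff p X = ζ' a) (hX : (φ.diff p X).2 = lin le_rfl c (φ.diff p X).1) :
    (φ.diff p (nabla Y p X)).2 = lin le_rfl c (φ.diff p (nabla Y p X)).1 ↔
      P' a (φ.diff p (Y p)).1 = geodesicForm C c (φ.diff p X).1 (φ.diff p (Y p)).1 := by
  -- The parameter space `K` is `V` for the tangent planes along a submanifold and `V × W` for a
  -- field of planes on an open set. With `P` the slope and `y` the base component of `Y`, the
  -- vertical part `(∇_X Y).2 - P (∇_X Y).1` is `P' a y` minus the value of `geodesicForm`: the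
  -- derivative of `Y` itself drops out by `e1`.
  have hYd : DifferentiableAt ℝ (chartField I φ.toOpenPartialHomeomorph Y) (ζ k) := by
    rw [hk, ← hpc]
    exact (contDiffAt_chartField φ.isSmoothChart hp hY).differentiableAt (by simp)
  have e1 := fderiv_field_of_mem_planes hζ hP hYd h a
  have e2 : φ.diff p (nabla Y p X) = fderiv ℝ (chartField I φ.toOpenPartialHomeomorph Y)
    (φ.toFun p) (φ.diff p X) + C (ptJ c) (φ.diff p X) (φ.diff p (Y p)) := hC Y hY X
  have e3 : chartField I φ.toOpenPartialHomeomorph Y (ζ k) = φ.diff p (Y p) := by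
    rw [hk, ← hpc]
    exact chartField_apply hp Y
  have e4 := h.self_of_nhds
  rw [e3, hPk] at e4
  rw [e3, hPk, hk, ← ha] at e1
  rw [geodesicForm_apply, ← hX, ← e4, e2, hpc, Prod.snd_add, Prod.fst_add, e1, map_add]
  simp only [Prod.mk.eta]
  constructor
  · intro h
    rw [eq_sub_iff_add_eq]
    exact add_left_cancel (a := lin le_rfl c (fderiv ℝ
      (chartField I φ.toOpenPartialHomeomorph Y) (ptJ c) (φ.diff p X)).1) (by rw [← h]; abel)
  · intro h
    rw [h]
    abel

/-- `covariant_mem_plane_iff` is applied to the tangent planes `fderiv ℝ u` along the graph. For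
necessity it is enough to test the fields `(b, Du b)`, extended so as not to depend on the fibre
coordinate. -/
theorem secondFormVanishes_iff (hC : HasChristoffel nabla φ.toOpenPartialHomeomorph C)
    {s : PointedSub I A} {u : V → W} (hu : IsGraphAt φ s.carrier s.pt u) :
    SecondFormVanishes nabla s ↔
      bilin V W (iteratedFDeriv ℝ 2 u (φ.toFun s.pt).1) =
        geodesicForm C (jet 1 u (φ.toFun s.pt).1) := by
  set x₀ := (φ.toFun s.pt).1 with hx₀
  have hpc : φ.toFun s.pt = ptJ (jet 1 u x₀) := hu.toFun_eq s.pt_mem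
  have hCp : ChristoffelAt nabla φ.toOpenPartialHomeomorph s.pt (C (ptJ (jet 1 u x₀))) := by
    have := hC.eq s.pt hu.mem_source
    rw [← hpc]
    exact this
  have hζ : HasFDerivAt (fun x => (x, u x)) ((ContinuousLinearMap.id ℝ V).prod (fderiv ℝ u x₀)) x₀ :=
    (hasFDerivAt_id x₀).prodMk (hu.contDiffAt.differentiableAt (by simp)).hasFDerivAt
  have hP : HasFDerivAt (fderiv ℝ u) (fderiv ℝ (fderiv ℝ u) x₀) x₀ :=
    ((hu.contDiffAt.fderiv_right (m := ∞) (by norm_cast)).differentiableAt (by simp)).hasFDerivAt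
  -- fields tangent to the submanifold
  have htan (Y : (q : F) → TangentSpace I q) :
      (∀ᶠ q in 𝓝 s.pt, ∀ hq : q ∈ s.carrier,
        (⟨q, Y q⟩ : TangentBundle I F) ∈ (s.move q hq).tangentVectors) →
      ∀ᶠ x in 𝓝 x₀, (chartField I φ.toOpenPartialHomeomorph Y (x, u x)).2 =
        fderiv ℝ u x (chartField I φ.toOpenPartialHomeomorph Y (x, u x)).1 := by
    intro h
    have hcont := (hu.continuousAt_graphPt s.pt_mem).tendsto
    rw [hu.graphPt_eq s.pt_mem] at hcont
    filter_upwards [hcont.eventually h, hu.eventually_mem s.pt_mem] with x h1 ⟨h2, h3, h4⟩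
    have h5 := (mem_tangentVectors (s := s.move _ h3) h4).1 (h1 h3)
    change _ = fderiv ℝ u (φ.toFun (graphPt φ u x)).1 _ at h5
    rw [toFun_graphPt h2] at h5
    exact h5
  constructor
  · intro h
    ext v b
    rw [bilin_iteratedFDeriv]
    let X : TangentSpace I s.pt := chartDinv I φ.toOpenPartialHomeomorph s.pt (v, fderiv ℝ u x₀ v)
    have eX : φ.diff s.pt X = (v, fderiv ℝ u x₀ v) :=
      chartD_chartDinv φ.isSmoothChart hu.mem_source _
    let Z : V × W → V × W := fun z => (b, fderiv ℝ u z.1 b)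
    let Y : (q : F) → TangentSpace I q := pullField I φ.toOpenPartialHomeomorph Z
    have eY (q : F) (hq : q ∈ φ.source) : φ.diff q (Y q) = Z (φ.toFun q) :=
      chartD_pullField φ.isSmoothChart hq Z
    have hY : IsSmoothFieldAt Y s.pt := by
      refine isSmoothFieldAt_pullField φ.isSmoothChart hu.mem_source ?_
      refine contDiffAt_const.prodMk (ContDiffAt.clm_apply ?_ contDiffAt_const)
      exact ContDiffAt.comp (g := fderiv ℝ u) (f := Prod.fst) _
        (hu.contDiffAt.fderiv_right (m := ∞) (by norm_cast)) contDiffAt_fst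
    have hYt : ∀ᶠ q in 𝓝 s.pt, ∀ hq : q ∈ s.carrier,
        (⟨q, Y q⟩ : TangentBundle I F) ∈ (s.move q hq).tangentVectors := by
      filter_upwards [hu.eventually_isGraphAt s.pt_mem] with q h1 hq
      refine (mem_tangentVectors (s := s.move q hq) (h1 hq).1).2 ?_
      change (φ.diff q (Y q)).2 = fderiv ℝ u (φ.toFun q).1 (φ.diff q (Y q)).1
      rw [eY q (h1 hq).1.mem_source]
    have hXt : (⟨s.pt, X⟩ : TangentBundle I F) ∈ s.tangentVectors := by
      rw [mem_tangentVectors hu, eX]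
    have h1 := (mem_tangentVectors hu).1 (h _ hXt Y hY hYt)
    have h2 := covariant_mem_plane_iff (a := v) hu.mem_source hpc hCp hζ hP rfl (lin_jet _).symm hY
      (htan Y hYt) eX (by rw [eX, lin_jet])
    rw [lin_jet] at h2
    have h3 := h2.1 h1
    rw [eY _ hu.mem_source, eX] at h3
    exact h3
  · rintro h ⟨p, X⟩ hX Y hY hYt
    have hp : p = s.pt := proj_of_mem_tangentVectors hX
    subst hp
    have hX' := (mem_tangentVectors hu).1 hX
    refine (mem_tangentVectors hu).2 ?_
    have h2 := covariant_mem_plane_iff (a := (φ.diff s.pt X).1) hu.mem_source hpc hCp hζ hP rfl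
      (lin_jet _).symm hY (htan Y hYt) (Prod.ext rfl hX') (by rw [lin_jet]; exact hX')
    rw [lin_jet] at h2
    refine h2.2 ?_
    rw [← h, bilin_iteratedFDeriv]

end Equation

end GeodesicJets

namespace GeodesicJets

/-! ### Horizontal lifts in coordinates -/

section Representatives

variable {V W : Type*} [NormedAddCommGroup V] [NormedSpace ℝ V]
  [NormedAddCommGroup W] [NormedSpace ℝ W]
  {H : Type*} [TopologicalSpace H]
  {I : ModelWithCorners ℝ (V × W) H} {F : Type*} [TopologicalSpace F] [ChartedSpace H F]
  {A : Set (Set F)} {φ : DividedChart I F}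

/-- The value on smooth functions of a vector in the plane of a jet. -/
theorem exists_mem_RPlane [FiniteDimensional ℝ V] {r : ℕ} {θ : Jet I A (r + 1)}
    {c : JetCoords V W (r + 1)} (hc : HasCoords φ θ c) (v : V) :
    ∃ D ∈ RPlane θ, ∀ (f : smoothFun I A r) (g : JetCoords V W r → ℝ),
      IsRep f.1 φ g (truncJ r.le_succ c) → D f = fderiv ℝ g (truncJ r.le_succ c) (hor c v) := by
  obtain ⟨s, u, h1, hu, rfl⟩ := id hc
  obtain ⟨η, hη, hη0, hηd, hηm, hηc, hγ0⟩ := hu.exists_curve s.pt_mem v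
  have e : (fun t => (φ.toFun (graphPt φ u (η t))).1) = η :=
    funext fun t => by rw [toFun_graphPt (hηm t).1]
  have hd (f : smoothFun I A r) (g : JetCoords V W r → ℝ)
      (hg : IsRep f.1 φ g (jet r u (φ.toFun s.pt).1)) :
      HasDerivAt (fun t => f.1 (Jet.mk r (s.move (graphPt φ u (η t)) (hηm t).2.1)))
        (fderiv ℝ g (jet r u (φ.toFun s.pt).1) (hor (jet (r + 1) u (φ.toFun s.pt).1) v)) 0 := by
    have h := hasDerivAt_along hu (fun t => (hηm t).2.1) hηc hγ0 hg
    rwa [e, hηd.deriv] at h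
  choose g hg using fun f : smoothFun I A r => exists_isRep f (hu.hasCoords (r := r))
  -- The derivative along one curve of the submanifold with base velocity `v`; it is linear in `f`
  -- because the derivative exists for every smooth `f`.
  let D : Module.Dual ℝ (smoothFun I A r) :=
    { toFun := fun f => deriv (fun t => f.1 (Jet.mk r (s.move (graphPt φ u (η t)) (hηm t).2.1))) 0
      map_add' := fun f f' =>
        ((hd f _ (hg f)).differentiableAt.hasDerivAt.add
          (hd f' _ (hg f')).differentiableAt.hasDerivAt).deriv
      map_smul' := fun a f =>
        ((hd f _ (hg f)).differentiableAt.hasDerivAt.const_smul a).deriv }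
  have hD (f : smoothFun I A r) (g : JetCoords V W r → ℝ)
      (h : IsRep f.1 φ g (truncJ r.le_succ (jet (r + 1) u (φ.toFun s.pt).1))) :
      D f = fderiv ℝ g (truncJ r.le_succ (jet (r + 1) u (φ.toFun s.pt).1))
        (hor (jet (r + 1) u (φ.toFun s.pt).1) v) := (hd f g h).deriv
  refine ⟨D, ?_, hD⟩
  rw [RPlane_eq_coordPlane hc]
  exact ⟨v, hD⟩

theorem mvfderiv_eq_fderiv {g : F → ℝ} {p : F} (hp : p ∈ φ.source)
    (hg : DifferentiableAt ℝ (fun z => g (φ.invFun z)) (φ.toFun p)) (X : TangentSpace I p) :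
    mvfderiv I g p X = fderiv ℝ (fun z => g (φ.invFun z)) (φ.toFun p) (φ.diff p X) := by
  have h1 : HasMFDerivAt I 𝓘(ℝ, V × W) φ.toFun p (mfderiv I 𝓘(ℝ, V × W) φ.toFun p) :=
    (φ.isSmoothChart.mdifferentiable.mdifferentiableAt hp).hasMFDerivAt
  have h2 : HasMFDerivAt 𝓘(ℝ, V × W) 𝓘(ℝ, ℝ) (fun z => g (φ.invFun z)) (φ.toFun p)
    (fderiv ℝ (fun z => g (φ.invFun z)) (φ.toFun p)) := hg.hasFDerivAt.hasMFDerivAt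
  have h3 := (h2.comp p h1).congr_of_eventuallyEq (f₁ := g) (by
    filter_upwards [φ.source_mem_nhds hp] with q hq
    exact congrArg g (φ.invFun_toFun hq).symm)
  exact congrArg (fun T : TangentSpace I p →L[ℝ] ℝ => T X) h3.mfderiv

end Representatives

section Horizontal

variable {V W : Type*} [NormedAddCommGroup V] [NormedSpace ℝ V]
  [NormedAddCommGroup W] [NormedSpace ℝ W] [FiniteDimensional ℝ V]
  {H : Type*} [TopologicalSpace H]
  {I : ModelWithCorners ℝ (V × W) H} {F : Type*} [TopologicalSpace F] [ChartedSpace H F]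
  [IsManifold I ∞ F] {A : Set (Set F)} {φ : DividedChart I F}
  {nabla : LinearConnection I F}
  {C : V × W → (V × W) →L[ℝ] (V × W) →L[ℝ] (V × W)}

/-- Horizontal lifts are given by the total derivatives of the equation of geodesics. -/
theorem IsHorizontalLift.exists_eq [FiniteDimensional ℝ W] [T2Space F]
    (hC : HasChristoffel nabla φ.toOpenPartialHomeomorph C)
    {θ : Jet I A 1} {c : JetCoords V W 1} (hc : HasCoords φ θ c) {X : TangentBundle I F}
    (hX : X ∈ θ.plane) {D : Module.Dual ℝ (smoothFun I A 1)}
    (h : IsHorizontalLift nabla θ X D) :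
    ∃ v : V, ∀ (f : smoothFun I A 1) (g : JetCoords V W 1 → ℝ), IsRep f.1 φ g c →
      D f = fderiv ℝ g c (horLift (geodesicForm C) c v) := by
  obtain ⟨p, X⟩ := X
  have hp : p = θ.base := proj_of_mem_plane hX
  have hps : p ∈ φ.source := by rw [hp]; exact hc.base_mem_source
  have hpc : φ.toFun p = ptJ c := by rw [hp]; exact hc.toFun_base
  have hX' := (mem_plane hc hp.symm).1 hX
  obtain ⟨σ, U, hU, hpU, hbase, hsm, hσp, hD, hY⟩ := h
  change p ∈ U at hpU
  change σ p = θ at hσp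
  have hopen : IsOpen (φ.target ∩ φ.invFun ⁻¹' U) := φ.symm.isOpen_inter_preimage hU
  have hmem : φ.toFun p ∈ φ.target ∩ φ.invFun ⁻¹' U :=
    ⟨φ.mapsTo hps, by rw [mem_preimage, φ.invFun_toFun hps]; exact hpU⟩
  have hj (f : smoothFun I A 1) :
      ContDiffOn ℝ ∞ (fun z => f.1 (σ (φ.invFun z))) (φ.target ∩ φ.invFun ⁻¹' U) := by
    rw [← contMDiffOn_iff_contDiffOn]
    exact (hsm f).comp (φ.contMDiffOn_inv.mono inter_subset_left) fun z hz => hz.2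
  obtain ⟨κ, U', hU', hxU', hsub, hκ, hκs, hκc⟩ := exists_smooth_coords (φ := φ)
    (j := fun z => σ (φ.invFun z)) hopen hj hmem (c := c)
    (by rw [φ.invFun_toFun hps, hσp]; exact hc)
  have hκd : HasFDerivAt κ (fderiv ℝ κ (φ.toFun p)) (φ.toFun p) :=
    ((hκs.contDiffAt (hU'.mem_nhds hxU')).differentiableAt (by simp)).hasFDerivAt
  have hpt : ∀ z ∈ U', ptJ (κ z) = z := fun z hz => by
    rw [← (hκ z hz).toFun_base, hbase _ (hsub hz).2, φ.toFun_invFun (hsub hz).1]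
  have hptd : ∀ a, ptJ (fderiv ℝ κ (φ.toFun p) a) = a := by
    intro a
    have h1 := (ptJ (V := V) (W := W) (r := 1)).hasFDerivAt.comp (φ.toFun p) hκd
    have h2 : HasFDerivAt (fun z => ptJ (κ z)) (ContinuousLinearMap.id ℝ (V × W)) (φ.toFun p) :=
      (hasFDerivAt_id _).congr_of_eventuallyEq (by
        filter_upwards [hU'.mem_nhds hxU'] with z hz using hpt z hz)
    exact congrArg (fun T => T a) (h1.unique h2)
  have hP := (lin (V := V) (W := W) (r := 1) le_rfl).hasFDerivAt.comp (φ.toFun p) hκd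
  have hlin : lin le_rfl (fderiv ℝ κ (φ.toFun p) (φ.diff p X)) =
      geodesicForm C c (φ.diff p X).1 := by
    ext1 b
    -- The fields with constant base component `b` and values in the planes of `σ` suffice to
    -- determine the derivative of the slope.
    let Z : V × W → V × W := fun z => (b, lin le_rfl (κ z) b)
    let Y : (q : F) → TangentSpace I q := pullField I φ.toOpenPartialHomeomorph Z
    have eY (q : F) (hq : q ∈ φ.source) : φ.diff q (Y q) = Z (φ.toFun q) :=
      chartD_pullField φ.isSmoothChart hq Z
    have hYs : IsSmoothFieldAt Y p := by
      refine isSmoothFieldAt_pullField φ.isSmoothChart hps ?_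
      refine contDiffAt_const.prodMk (ContDiffAt.clm_apply ?_ contDiffAt_const)
      exact (contDiff_lin le_rfl).contDiffAt.comp _ (hκs.contDiffAt (hU'.mem_nhds hxU'))
    have hYp : ∀ᶠ q in 𝓝 p, (⟨q, Y q⟩ : TangentBundle I F) ∈ (σ q).plane := by
      filter_upwards [φ.source_mem_nhds hps, hU.mem_nhds hpU,
        (φ.continuousAt hps).eventually_mem (hU'.mem_nhds hxU')] with q h1 h2 h3
      have h4 := hκ _ h3
      rw [φ.invFun_toFun h1] at h4
      rw [mem_plane h4 (hbase q h2), eY q h1]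
    have h1 := (mem_plane hc hp.symm).1 (hY Y hYs hYp)
    have hYc : ∀ᶠ z in 𝓝 (φ.toFun p), (chartField I φ.toOpenPartialHomeomorph Y z).2 =
        (lin le_rfl (κ z)) (chartField I φ.toOpenPartialHomeomorph Y z).1 := by
      filter_upwards [φ.isOpen_target.mem_nhds hmem.1] with z hz
      have e : chartField I φ.toOpenPartialHomeomorph Y z = Z z :=
        chartField_pullField φ.isSmoothChart hz Z
      rw [e]
    have hCp : ChristoffelAt nabla φ.toOpenPartialHomeomorph p (C (ptJ c)) := by
      rw [← hpc]
      exact hC.eq p hps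
    have h2 := (covariant_mem_plane_iff (ζ := fun z => z) (k := φ.toFun p) hps hpc hCp
      (hasFDerivAt_id _) hP hpc (congrArg (lin le_rfl) hκc) hYs hYc (X := X) rfl hX').1 h1
    rw [eY p hps] at h2
    exact h2
  -- The point component is prescribed because `σ` is a section, the slope component because it is
  -- horizontal.
  have hhor : fderiv ℝ κ (φ.toFun p) (φ.diff p X) =
      horLift (geodesicForm C) c (φ.diff p X).1 := by
    refine jetC1_ext ?_ ?_
    · rw [hptd, ptJ_horLift, ← hX']
    · rw [hlin, lin_horLift]
  refine ⟨(φ.diff p X).1, fun f g hg => ?_⟩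
  have e1 : HasFDerivAt g (fderiv ℝ g c) (κ (φ.toFun p)) := by
    rw [hκc]
    exact (hg.contDiffAt.differentiableAt (by simp)).hasFDerivAt
  have e2 := (e1.comp (φ.toFun p) hκd).congr_of_eventuallyEq
      (f₁ := fun z => f.1 (σ (φ.invFun z))) (by
    have h3 : Tendsto κ (𝓝 (φ.toFun p)) (𝓝 c) := by
      have := hκd.continuousAt.tendsto
      rwa [hκc] at this
    filter_upwards [h3.eventually hg.eventually, hU'.mem_nhds hxU'] with z h4 h5
    exact h4 _ (hκ z h5))
  rw [hD f]
  refine (mvfderiv_eq_fderiv (g := fun q => f.1 (σ q)) hps e2.differentiableAt X).trans ?_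
  rw [e2.fderiv, ContinuousLinearMap.comp_apply, hhor]

/-- The lift is realized by a field of planes whose slope is affine in the base coordinate, with
derivative `geodesicForm C c`. Near the point its planes are jets of members of `A` because the
class is open. -/
theorem exists_isHorizontalLift (hA : IsOpenClass I A)
    (hC : HasChristoffel nabla φ.toOpenPartialHomeomorph C)
    {θ : Jet I A 1} {c : JetCoords V W 1} (hc : HasCoords φ θ c)
    {D : Module.Dual ℝ (smoothFun I A 1)} {v : V}
    (hD : ∀ (f : smoothFun I A 1) (g : JetCoords V W 1 → ℝ), IsRep f.1 φ g c →
      D f = fderiv ℝ g c (horLift (geodesicForm C) c v)) :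
    ∃ X ∈ θ.plane, IsHorizontalLift nabla θ X D := by
  obtain ⟨p, hp⟩ : ∃ p, θ.base = p := ⟨_, rfl⟩
  have hps : p ∈ φ.source := by rw [← hp]; exact hc.base_mem_source
  have hpc : φ.toFun p = ptJ c := by rw [← hp]; exact hc.toFun_base
  let X : TangentSpace I p := chartDinv I φ.toOpenPartialHomeomorph p (v, lin le_rfl c v)
  have eX : φ.diff p X = (v, lin le_rfl c v) := chartD_chartDinv φ.isSmoothChart hps _
  have hX : (⟨p, X⟩ : TangentBundle I F) ∈ θ.plane := by rw [mem_plane hc hp, eX]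
  let P : V × W → V →L[ℝ] W := fun z => lin le_rfl c + geodesicForm C c (z.1 - c.1)
  let P' : V × W →L[ℝ] V →L[ℝ] W := (geodesicForm C c).comp (ContinuousLinearMap.fst ℝ V W)
  have hP : HasFDerivAt P P' (φ.toFun p) := by
    have h1 : HasFDerivAt (fun z : V × W => z.1 - c.1) (ContinuousLinearMap.fst ℝ V W)
      (φ.toFun p) := hasFDerivAt_fst.sub_const _
    exact ((geodesicForm C c).hasFDerivAt.comp _ h1).const_add _
  have hPs : ContDiff ℝ ∞ P :=
    contDiff_const.add ((geodesicForm C c).contDiff.comp (contDiff_fst.sub contDiff_const))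
  have hPp : P (φ.toFun p) = lin le_rfl c := by
    simp [P, hpc]
  let κ : V × W → JetCoords V W 1 := fun z => mkJ1 (z, P z)
  have hκs : ContDiff ℝ ∞ κ := contDiff_mkJ1.comp (contDiff_id.prodMk hPs)
  have hκp : κ (φ.toFun p) = c := by
    refine jetC1_ext ?_ ?_
    · rw [ptJ_mkJ1, hpc]
    · rw [lin_mkJ1, hPp]
  have hκd : HasFDerivAt κ (mkJ1.comp ((ContinuousLinearMap.id ℝ (V × W)).prod P'))
      (φ.toFun p) :=
    (mkJ1 (V := V) (W := W)).hasFDerivAt.comp (φ.toFun p) ((hasFDerivAt_id _).prodMk hP)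
  have hκv : mkJ1.comp ((ContinuousLinearMap.id ℝ (V × W)).prod P') (φ.diff p X) =
      horLift (geodesicForm C) c v := by rw [eX]; rfl
  classical
  let σ : F → Jet I A 1 := fun q =>
    if h : ∃ ϑ, HasCoords φ ϑ (κ (φ.toFun q)) then h.choose else θ
  have hσ (q : F) (h : ∃ ϑ : Jet I A 1, HasCoords φ ϑ (κ (φ.toFun q))) :
      HasCoords φ (σ q) (κ (φ.toFun q)) := by
    have e : σ q = h.choose := dif_pos h
    rw [e]
    exact h.choose_spec
  have hev : ∀ᶠ q in 𝓝 p, q ∈ φ.source ∧ ∃ ϑ : Jet I A 1, HasCoords φ ϑ (κ (φ.toFun q)) := by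
    have h1 : Tendsto (fun q => κ (φ.toFun q)) (𝓝 p) (𝓝 c) := by
      have := ContinuousAt.comp (g := κ) (f := φ.toFun) hκs.continuous.continuousAt
        (φ.continuousAt hps)
      rw [ContinuousAt, Function.comp_apply, hκp] at this
      exact this
    filter_upwards [φ.source_mem_nhds hps, h1.eventually (hA.eventually_exists_jet hc)]
      with q h2 h3 using ⟨h2, h3⟩
  obtain ⟨U, hUsub, hU, hpU⟩ := eventually_nhds_iff.1 hev
  have hσp : σ p = θ := by
    have h1 := hσ p (hUsub p hpU).2
    rw [hκp] at h1
    exact h1.eq hc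
  -- smooth functions along the section
  have hloc (f : smoothFun I A 1) {q : F} (hq : q ∈ U) {g : JetCoords V W 1 → ℝ}
      (hg : IsRep f.1 φ g (κ (φ.toFun q))) :
      (fun q => f.1 (σ q)) =ᶠ[𝓝 q] fun q => g (κ (φ.toFun q)) := by
    have h1 : ContinuousAt (fun q => κ (φ.toFun q)) q :=
      ContinuousAt.comp (g := κ) hκs.continuous.continuousAt (φ.continuousAt (hUsub q hq).1)
    filter_upwards [hU.mem_nhds hq, h1.eventually hg.eventually] with q' h2 h3
    exact h3 _ (hσ q' (hUsub q' h2).2)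
  refine ⟨⟨p, X⟩, hX, σ, U, hU, hpU, fun q hq => ?_, fun f q hq => ?_, hσp, fun f => ?_,
    fun Y hY hYp => ?_⟩
  · rw [(hσ q (hUsub q hq).2).base_eq, ptJ_mkJ1, φ.invFun_toFun (hUsub q hq).1]
  · obtain ⟨g, hg⟩ := exists_isRep f (hσ q (hUsub q hq).2)
    refine ContMDiffAt.contMDiffWithinAt (ContMDiffAt.congr_of_eventuallyEq ?_ (hloc f hq hg))
    refine ContMDiffAt.comp (g := fun z => g (κ z)) (f := φ.toFun) q ?_
      (φ.contMDiffOn_to.contMDiffAt (φ.source_mem_nhds (hUsub q hq).1))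
    exact (ContDiffAt.comp (g := g) _ hg.contDiffAt hκs.contDiffAt).contMDiffAt
  · obtain ⟨g, hg⟩ := exists_isRep f hc
    have hg' := hg
    rw [← hκp] at hg'
    rw [hD f g hg]
    have e1 : HasFDerivAt g (fderiv ℝ g c) (κ (φ.toFun p)) := by
      rw [hκp]
      exact (hg.contDiffAt.differentiableAt (by simp)).hasFDerivAt
    have hc' : Tendsto φ.invFun (𝓝 (φ.toFun p)) (𝓝 p) := by
      have := (φ.continuousAt_inv (φ.mapsTo hps)).tendsto
      rwa [φ.invFun_toFun hps] at this
    have e2 := (e1.comp (φ.toFun p) hκd).congr_of_eventuallyEq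
        (f₁ := fun z => f.1 (σ (φ.invFun z))) (by
      filter_upwards [hc'.eventually (hloc f hpU hg'), φ.isOpen_target.mem_nhds (φ.mapsTo hps)]
        with z h4 h5
      rw [h4, φ.toFun_invFun h5]
      rfl)
    refine Eq.trans ?_ (mvfderiv_eq_fderiv (g := fun q => f.1 (σ q)) hps
      e2.differentiableAt X).symm
    rw [e2.fderiv, ContinuousLinearMap.comp_apply, hκv]
  · have hCp : ChristoffelAt nabla φ.toOpenPartialHomeomorph p (C (ptJ c)) := by
      rw [← hpc]
      exact hC.eq p hps
    have hYc : ∀ᶠ z in 𝓝 (φ.toFun p), (chartField I φ.toOpenPartialHomeomorph Y z).2 =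
        P z (chartField I φ.toOpenPartialHomeomorph Y z).1 := by
      have hc' : Tendsto φ.invFun (𝓝 (φ.toFun p)) (𝓝 p) := by
        have := (φ.continuousAt_inv (φ.mapsTo hps)).tendsto
        rwa [φ.invFun_toFun hps] at this
      filter_upwards [φ.isOpen_target.mem_nhds (φ.mapsTo hps), hc'.eventually hYp,
        hc'.eventually (hU.mem_nhds hpU)] with z h1 h2 h3
      have h4 := hσ _ (hUsub _ h3).2
      have h5 : (σ (φ.invFun z)).base = φ.invFun z := by
        rw [h4.base_eq, ptJ_mkJ1, φ.invFun_toFun (hUsub _ h3).1]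
      have h6 := (mem_plane h4 h5).1 h2
      rw [lin_mkJ1, φ.toFun_invFun h1] at h6
      exact h6
    refine (mem_plane hc hp).2 ((covariant_mem_plane_iff (ζ := fun z => z) (k := φ.toFun p) hps hpc
      hCp (hasFDerivAt_id _) hP hpc hPp hY hYc (X := X) rfl (by rw [eX])).2 rfl)

end Horizontal

end GeodesicJets

namespace GeodesicJets

/-! ### The equation and its Grassmannian structure in coordinates -/

section Quadratic

variable {V W : Type*} [NormedAddCommGroup V] [NormedSpace ℝ V]
  [NormedAddCommGroup W] [NormedSpace ℝ W]

/-- A map with given first order jet and given symmetric second derivative. -/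
theorem exists_jet_two (c : JetCoords V W 1) {B : V →L[ℝ] V →L[ℝ] W}
    (hB : ∀ v w, B v w = B w v) :
    ∃ u : V → W, ContDiff ℝ ∞ u ∧ jet 1 u c.1 = c ∧
      bilin V W (iteratedFDeriv ℝ 2 u c.1) = B := by
  let u : V → W := fun x => val0 c + lin le_rfl c (x - c.1) + (1 / 2 : ℝ) • B (x - c.1) (x - c.1)
  have hsub (x : V) : HasFDerivAt (fun x : V => x - c.1) (ContinuousLinearMap.id ℝ V) x :=
    (hasFDerivAt_id _).sub_const _
  have hsmooth : ContDiff ℝ ∞ fun x : V => x - c.1 := contDiff_id.sub contDiff_const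
  have hd (x : V) : HasFDerivAt u (lin le_rfl c + B (x - c.1)) x := by
    have h1 := (((lin le_rfl c).hasFDerivAt.comp x (hsub x)).const_add (val0 c)).add
      (((B.hasFDerivAt.comp x (hsub x)).clm_apply (hsub x)).const_smul (1 / 2 : ℝ))
    refine (show HasFDerivAt u _ x from h1).congr_fderiv ?_
    ext v
    simp only [add_apply, ContinuousLinearMap.comp_apply, ContinuousLinearMap.id_apply,
      smul_apply, ContinuousLinearMap.flip_apply, Function.comp_apply]
    rw [hB v, ← two_smul ℝ (B (x - c.1) v), smul_smul]
    norm_num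
  have hfd : fderiv ℝ u = fun x => lin le_rfl c + B (x - c.1) := funext fun x => (hd x).fderiv
  refine ⟨u, ?_, ?_, ?_⟩
  · exact (contDiff_const.add ((lin le_rfl c).contDiff.comp hsmooth)).add
      (((B.contDiff.comp hsmooth).clm_apply hsmooth).const_smul _)
  · refine jetC1_ext ?_ ?_
    · rw [ptJ_jet]
      refine Prod.ext rfl ?_
      simp [u]
    · rw [lin_jet, hfd]
      simp
  · ext v w
    rw [bilin_iteratedFDeriv, hfd]
    have h2 := (B.hasFDerivAt.comp c.1 (hsub c.1)).const_add (lin le_rfl c)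
    exact congrArg (fun T => T v w) h2.fderiv

end Quadratic

section Equation

variable {V W : Type*} [NormedAddCommGroup V] [NormedSpace ℝ V]
  [NormedAddCommGroup W] [NormedSpace ℝ W] [FiniteDimensional ℝ V]
  {H : Type*} [TopologicalSpace H]
  {I : ModelWithCorners ℝ (V × W) H} {F : Type*} [TopologicalSpace F] [ChartedSpace H F]
  [IsManifold I ∞ F] {A : Set (Set F)} {φ : DividedChart I F}
  {nabla : LinearConnection I F}
  {C : V × W → (V × W) →L[ℝ] (V × W) →L[ℝ] (V × W)}

theorem HasChristoffel.contDiffOn_geodesicForm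
    (hC : HasChristoffel nabla φ.toOpenPartialHomeomorph C) :
    ContDiffOn ℝ ∞ (geodesicForm C) {c | ptJ c ∈ φ.target} :=
  GeodesicJets.contDiffOn_geodesicForm hC.smooth

/-- The equation of totally geodesic submanifolds in coordinates. -/
theorem mem_geodesicEquation_iff (hC : HasChristoffel nabla φ.toOpenPartialHomeomorph C)
    {θ : Jet I A 2} {c : JetCoords V W 2} (hc : HasCoords φ θ c) :
    θ ∈ geodesicEquation nabla A ↔ c = tower (geodesicForm C) 2 (truncJ (Nat.le_succ 1) c) := by
  have key : ∀ (s : PointedSub I A) (u : V → W), IsGraphAt φ s.carrier s.pt u →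
      jet 2 u (φ.toFun s.pt).1 = c → (SecondFormVanishes nabla s ↔
        c = tower (geodesicForm C) 2 (truncJ (Nat.le_succ 1) c)) := by
    rintro s u hu rfl
    rw [secondFormVanishes_iff hC hu, eq_tower_two_iff (isOpen_ptJ_target φ)
      hC.contDiffOn_geodesicForm hc.mem_target]
    rfl
  constructor
  · rintro ⟨s, rfl, hs⟩
    obtain ⟨u, hu, he⟩ := hc.exists_isGraphAt one_le_two
    exact (key s u hu he).1 hs
  · intro h
    obtain ⟨s, u, rfl, hu, he⟩ := hc
    exact ⟨s, rfl, (key s u hu he).2 h⟩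

/-- Vanishing torsion enters here: `geodesicForm` is symmetric, hence the second derivative of a
quadratic map with the given first order jet, and the open class contains a submanifold with that
germ. -/
theorem exists_hasCoords_tower_two (hA : IsOpenClass I A)
    (hC : HasChristoffel nabla φ.toOpenPartialHomeomorph C) {θ : Jet I A 1} {c : JetCoords V W 1}
    (hc : HasCoords φ θ c) :
    ∃ ϑ : Jet I A 2, HasCoords φ ϑ (tower (geodesicForm C) 2 c) := by
  obtain ⟨u, hu, hj, h2⟩ := exists_jet_two c
    (geodesicForm_symm (hC.symm _ hc.mem_target))
  obtain ⟨t, ht, hg⟩ := (hA φ θ c hc).self_of_nhds u ⟨univ, univ_mem, hu.contDiffOn⟩ hj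
  refine ⟨Jet.mk 2 t, t, u, rfl, hg, ?_⟩
  have e : (φ.toFun t.pt).1 = c.1 := by rw [ht, fst_ptJ]
  rw [e]
  have h3 : truncJ (Nat.le_succ 1) (jet 2 u c.1) = c := hj
  have h4 := (eq_tower_two_iff (c₂ := jet 2 u c.1) (isOpen_ptJ_target φ)
    hC.contDiffOn_geodesicForm (by rw [h3]; exact hc.mem_target)).2 (by rw [h3]; exact h2)
  rwa [h3] at h4

theorem mem_geodesicEquation_of_hasCoords
    (hC : HasChristoffel nabla φ.toOpenPartialHomeomorph C)
    {ϑ : Jet I A 2} {c : JetCoords V W 1} (hc : HasCoords φ ϑ (tower (geodesicForm C) 2 c)) :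
    ϑ ∈ geodesicEquation nabla A := by
  rw [mem_geodesicEquation_iff hC hc, truncJ_tower, tower_one]

variable [FiniteDimensional ℝ W] [T2Space F]

/-- The Grassmannian structure in coordinates. -/
theorem hasCoords_grassmannStructure (hA : IsOpenClass I A)
    (hC : HasChristoffel nabla φ.toOpenPartialHomeomorph C) {θ : Jet I A 1} {c : JetCoords V W 1}
    (hc : HasCoords φ θ c) :
    HasCoords φ (grassmannStructure nabla A θ) (tower (geodesicForm C) 2 c) ∧
      Jet.proj (Nat.le_succ 1) (grassmannStructure nabla A θ) = θ := by
  have hΩ : c ∈ {c : JetCoords V W 1 | ptJ c ∈ φ.target} := hc.mem_target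
  have hhor := hor_tower_two (isOpen_ptJ_target φ) hC.contDiffOn_geodesicForm hΩ
  have htr : truncJ (Nat.le_succ 1) (tower (geodesicForm C) 2 c) = c := tower_one
  have hplane (D : Module.Dual ℝ (smoothFun I A 1)) :
      D ∈ coordPlane φ A (tower (geodesicForm C) 2 c) ↔
        ∃ X ∈ θ.plane, IsHorizontalLift nabla θ X D := by
    rw [mem_coordPlane, hhor, htr]
    constructor
    · rintro ⟨v, hv⟩
      exact exists_isHorizontalLift hA hC hc hv
    · rintro ⟨X, hX, h⟩
      exact h.exists_eq hC hc hX
  obtain ⟨ϑ, hϑ⟩ := exists_hasCoords_tower_two hA hC hc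
  -- The choice made in `grassmannStructure` is known only through its specification. Existence is
  -- proved here; uniqueness follows below, because the plane determines the second derivative.
  have hex : ∃ ϑ : Jet I A 2, Jet.proj (Nat.le_succ 1) ϑ = θ ∧
      ∀ v, v ∈ RPlane ϑ ↔ ∃ X ∈ θ.plane, IsHorizontalLift nabla θ X v := by
    refine ⟨ϑ, ?_, fun D => ?_⟩
    · have h1 := hϑ.proj (Nat.le_succ 1)
      rw [htr] at h1
      exact h1.eq hc
    · rw [RPlane_eq_coordPlane hϑ, hplane]
  have hspec := Classical.epsilon_spec hex
  have hspec' : Jet.proj (Nat.le_succ 1) (grassmannStructure nabla A θ) = θ ∧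
      ∀ v, v ∈ RPlane (grassmannStructure nabla A θ) ↔
        ∃ X ∈ θ.plane, IsHorizontalLift nabla θ X v := hspec
  obtain ⟨h1, h2⟩ := hspec'
  refine ⟨?_, h1⟩
  obtain ⟨c', hc', htc⟩ := HasCoords.lift le_rfl (Nat.le_succ 1) (h1.symm ▸ hc)
  have hv (v : V) : hor c' v = hor (tower (geodesicForm C) 2 c) v := by
    obtain ⟨D, hD, hDv⟩ := exists_mem_RPlane hc' v
    obtain ⟨w, hw⟩ := (hplane D).2 ((h2 D).1 hD)
    rw [htr] at hw
    have h3 : hor c' v = hor (tower (geodesicForm C) 2 c) w := by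
      refine eq_of_forall_fderiv_eq (A := A) le_rfl hc.mem_target fun f g hg => ?_
      rw [← hw f g hg]
      rw [← htc] at hg
      rw [hDv f g hg, htc]
    -- The base component of `hor c v` is `v`, whatever `c`.
    have h4 : v = w := congrArg Prod.fst h3
    rw [h3, h4]
  have h5 : c' = tower (geodesicForm C) 2 c := by
    have h6 : bilin V W (compJ 2 (by omega) c') = geodesicForm C c := by
      ext1 v
      rw [← lin_hor le_rfl c' v, hv v, hhor, lin_horLift]
    have h7 := (eq_tower_two_iff (c₂ := c') (isOpen_ptJ_target φ)
      hC.contDiffOn_geodesicForm (by rw [htc]; exact hΩ)).2 (by rw [htc]; exact h6)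
    rwa [htc] at h7
  rwa [← h5]

theorem geodesicDistribution_eq (hA : IsOpenClass I A)
    (hC : HasChristoffel nabla φ.toOpenPartialHomeomorph C) {θ : Jet I A 1} {c : JetCoords V W 1}
    (hc : HasCoords φ θ c) :
    geodesicDistribution nabla A θ = coordPlane φ A (tower (geodesicForm C) 2 c) :=
  RPlane_eq_coordPlane (hasCoords_grassmannStructure hA hC hc).1

theorem mem_geodesicDistribution (hA : IsOpenClass I A)
    (hC : HasChristoffel nabla φ.toOpenPartialHomeomorph C) {θ : Jet I A 1} {c : JetCoords V W 1}
    (hc : HasCoords φ θ c) {D : Module.Dual ℝ (smoothFun I A 1)} :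
    D ∈ geodesicDistribution nabla A θ ↔
      ∃ v : V, ∀ (f : smoothFun I A 1) (g : JetCoords V W 1 → ℝ), IsRep f.1 φ g c →
        D f = fderiv ℝ g c (horLift (geodesicForm C) c v) := by
  rw [geodesicDistribution_eq hA hC hc, mem_coordPlane,
    hor_tower_two (isOpen_ptJ_target φ) hC.contDiffOn_geodesicForm hc.mem_target, truncJ_tower,
    tower_one]

end Equation

end GeodesicJets

/-! ### Prolongations and existence of totally geodesic submanifolds -/

namespace GeodesicJets

/-- The smooth inverse function theorem, with smoothness in a neighbourhood. -/
theorem exists_local_inverse {X Y : Type*} [NormedAddCommGroup X] [NormedSpace ℝ X]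
    [NormedAddCommGroup Y] [NormedSpace ℝ Y] [FiniteDimensional ℝ X] {f : X → Y} {U : Set X}
    (hU : IsOpen U) (hf : ContDiffOn ℝ ∞ f U) {x : X} (hx : x ∈ U)
    (h : (fderiv ℝ f x).IsInvertible) :
    ∃ (g : Y → X) (O : Set Y), IsOpen O ∧ f x ∈ O ∧ ContDiffOn ℝ ∞ g O ∧ g (f x) = x ∧
      (∀ y ∈ O, g y ∈ U ∧ f (g y) = y) ∧ ∀ᶠ x' in 𝓝 x, g (f x') = x' := by
  have : CompleteSpace X := FiniteDimensional.complete ℝ X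
  have hfx : ContDiffAt ℝ ∞ f x := hf.contDiffAt (hU.mem_nhds hx)
  -- the derivative is invertible near the point
  have hinv : ∀ᶠ x' in 𝓝 x, (fderiv ℝ f x').IsInvertible :=
    (hfx.fderiv_right (m := ∞) (by norm_cast)).continuousAt.eventually_mem
      (isOpen_isInvertible.mem_nhds h)
  obtain ⟨U₁, hU₁, hopen, hx₁⟩ := eventually_nhds_iff.1 hinv
  obtain ⟨e, he⟩ := id h
  have hd : HasFDerivAt f (e : X →L[ℝ] Y) x := by
    rw [he]
    exact (hfx.differentiableAt (by simp)).hasFDerivAt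
  let φ := hfx.toOpenPartialHomeomorph f hd (by simp)
  have hφ : (φ : X → Y) = f := hfx.toOpenPartialHomeomorph_coe hd (by simp)
  have hxs : x ∈ φ.source := hfx.mem_toOpenPartialHomeomorph_source hd (by simp)
  -- Restriction to points where the derivative is invertible makes the inverse smooth on an open
  -- set and not only at `f x`.
  have hO : IsOpen (φ.target ∩ φ.symm ⁻¹' (U ∩ U₁)) :=
    φ.symm.isOpen_inter_preimage (hU.inter hopen)
  have hl : φ.symm (f x) = x := by rw [← hφ]; exact φ.left_inv hxs
  refine ⟨φ.symm, φ.target ∩ φ.symm ⁻¹' (U ∩ U₁), hO, ⟨?_, ?_⟩, fun y hy => ?_, hl,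
    fun y hy => ⟨hy.2.1, ?_⟩, ?_⟩
  · rw [← hφ]; exact φ.map_source hxs
  · rw [mem_preimage, hl]; exact ⟨hx, hx₁⟩
  · obtain ⟨e', he'⟩ := hU₁ _ hy.2.2
    have h1 : ContDiffAt ℝ ∞ φ (φ.symm y) := by
      rw [hφ]; exact hf.contDiffAt (hU.mem_nhds hy.2.1)
    have h2 : HasFDerivAt φ (e' : X →L[ℝ] Y) (φ.symm y) := by
      rw [he', hφ]
      rw [hφ] at h1
      exact (h1.differentiableAt (by simp)).hasFDerivAt
    exact (φ.contDiffAt_symm hy.1 h2 h1).contDiffWithinAt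
  · rw [← hφ]; exact φ.right_inv hy.1
  · filter_upwards [φ.open_source.mem_nhds hxs] with x' hx'
    rw [← hφ]; exact φ.left_inv hx'

/-- `hor c` contains all derivatives of orders `1` to `r + 1`; only the point of the graph is
missing. -/
theorem jetC_ext_of_hor {V W : Type*} [NormedAddCommGroup V] [NormedSpace ℝ V]
    [NormedAddCommGroup W] [NormedSpace ℝ W] {r : ℕ} {c c' : JetCoords V W (r + 1)} (h0 : ptJ c = ptJ c')
    (h : ∀ v, hor c v = hor c' v) : c = c' := by
  refine jetC_ext (show (ptJ c).1 = (ptJ c').1 by rw [h0]) fun k hk => ?_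
  cases k with
  | zero => exact (continuousMultilinearCurryFin0 ℝ V W).injective (congrArg Prod.snd h0)
  | succ k =>
    apply (curryL V W k).injective
    ext1 v
    exact congrArg (compJ k (by omega)) (h v)

section Prolongation

variable {V W : Type*} [NormedAddCommGroup V] [NormedSpace ℝ V]
  [NormedAddCommGroup W] [NormedSpace ℝ W] [FiniteDimensional ℝ V]
  {H : Type*} [TopologicalSpace H]
  {I : ModelWithCorners ℝ (V × W) H} {F : Type*} [TopologicalSpace F] [ChartedSpace H F]
  {A : Set (Set F)} {φ : DividedChart I F}

/-- Vectors in the planes of jets are tangent vectors. -/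
theorem mem_tangentAt_of_mem_RPlane {r : ℕ} {θ : Jet I A (r + 1)}
    {D : Module.Dual ℝ (smoothFun I A r)} (hD : D ∈ RPlane θ) :
    D ∈ tangentAt (smoothFun I A r) (Jet.proj r.le_succ θ) := by
  obtain ⟨φ, c, hc⟩ := exists_hasCoords θ
  rw [RPlane_eq_coordPlane hc] at hD
  obtain ⟨v, hv⟩ := hD
  intro f f'
  have hp := hc.proj r.le_succ
  obtain ⟨g, hg⟩ := exists_isRep f hp
  obtain ⟨g', hg'⟩ := exists_isRep f' hp
  have hmul : IsRep (f * f').1 φ (g * g') (truncJ r.le_succ c) := by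
    obtain ⟨N, hN, hs, h⟩ := hg
    obtain ⟨N', hN', hs', h'⟩ := hg'
    refine ⟨N ∩ N', inter_mem hN hN',
      (hs.mono inter_subset_left).mul (hs'.mono inter_subset_right), fun θ c' hc hm => ?_⟩
    rw [Pi.mul_apply, ← h θ c' hc hm.1, ← h' θ c' hc hm.2]
    rfl
  rw [hv _ _ hmul, hv _ _ hg, hv _ _ hg', hg.apply_eq hp, hg'.apply_eq hp,
    fderiv_mul (hg.contDiffAt.differentiableAt (by simp))
      (hg'.contDiffAt.differentiableAt (by simp))]
  rfl

/-- A submanifold whose jets near a point satisfy an equation gives a point of the prolongation. -/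
theorem mem_prolongOne_of_eventually {r : ℕ} {S : Set (Jet I A r)} {s : PointedSub I A}
    {u : V → W} (hu : IsGraphAt φ s.carrier s.pt u)
    (h : ∀ᶠ x in 𝓝 (φ.toFun s.pt).1, ∀ hq : graphPt φ u x ∈ s.carrier,
      Jet.mk r (s.move (graphPt φ u x) hq) ∈ S) : Jet.mk (r + 1) s ∈ prolongOne S := by
  have hx₀ : Jet.mk r s ∈ S := by
    have h1 := h.self_of_nhds
    have e : ∀ q (hq : q ∈ s.carrier), q = s.pt → Jet.mk r (s.move q hq) = Jet.mk r s := by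
      rintro _ hq rfl; rfl
    have h2 := hu.graphPt_eq s.pt_mem
    rw [← e _ (by rw [h2]; exact s.pt_mem) h2]
    exact h1 _
  refine ⟨hx₀, fun D hD => ⟨mem_tangentAt_of_mem_RPlane hD, ?_⟩⟩
  rw [SetLike.mem_coe, Submodule.mem_dualAnnihilator]
  intro f hf
  have hf' : ∀ ϑ ∈ S, f.1 ϑ = 0 := hf
  rw [RPlane_eq_coordPlane hu.hasCoords] at hD
  obtain ⟨v, hv⟩ := hD
  obtain ⟨g, hg⟩ := exists_isRep f (hu.hasCoords (r := r))
  rw [hv f g hg, truncJ_jet]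
  have h1 : HasFDerivAt (fun x => g (jet r u x)) ((fderiv ℝ g (jet r u (φ.toFun s.pt).1)).comp
      (hor (jet (r + 1) u (φ.toFun s.pt).1))) (φ.toFun s.pt).1 :=
    HasFDerivAt.comp (g := g) _ (hg.contDiffAt.differentiableAt (by simp)).hasFDerivAt
      (hasFDerivAt_jet hu.contDiffAt r)
  -- A function vanishing on `S` vanishes at the nearby jets of the submanifold, so its derivative
  -- along them is zero.
  have h2 : (fun x => g (jet r u x)) =ᶠ[𝓝 (φ.toFun s.pt).1] fun _ => 0 := by
    have h3 := (contDiffAt_jet hu.contDiffAt r).continuousAt.eventually hg.eventually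
    filter_upwards [h, h3, hu.eventually_mem s.pt_mem] with x k1 k2 ⟨k3, k4, k5⟩
    have k6 : HasCoords φ (Jet.mk r (s.move _ k4)) (jet r u x) := by
      refine ⟨s.move _ k4, u, rfl, k5, ?_⟩
      change jet r u (φ.toFun (graphPt φ u x)).1 = _
      rw [toFun_graphPt k3]
    rw [← k2 _ k6, hf' _ (k1 k4)]
  have h4 := h1.unique ((hasFDerivAt_const (0 : ℝ) _).congr_of_eventuallyEq h2)
  exact congrArg (fun T => T v) h4

/-- The induction lets the point move: the step from `l` to `l + 1` needs the prolonged equation at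
all nearby points of the submanifold. -/
theorem mem_prolong_of_eventually {r : ℕ} {S : Set (Jet I A r)} (l : ℕ) {s : PointedSub I A}
    {u : V → W} (hu : IsGraphAt φ s.carrier s.pt u)
    (h : ∀ᶠ x in 𝓝 (φ.toFun s.pt).1, ∀ hq : graphPt φ u x ∈ s.carrier,
      Jet.mk r (s.move (graphPt φ u x) hq) ∈ S) : Jet.mk (r + l) s ∈ prolong S l := by
  induction l generalizing s with
  | zero =>
    have h1 := h.self_of_nhds
    have e : ∀ q (hq : q ∈ s.carrier), q = s.pt → Jet.mk r (s.move q hq) = Jet.mk r s := by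
      rintro _ hq rfl; rfl
    have h2 := hu.graphPt_eq s.pt_mem
    have h3 := h1 (by rw [h2]; exact s.pt_mem)
    rwa [e _ _ h2] at h3
  | succ l ih =>
    refine mem_prolongOne_of_eventually hu ?_
    filter_upwards [h.eventually_nhds, hu.eventually_mem s.pt_mem] with x h1 ⟨h2, h3, h4⟩ hq
    refine ih (s := s.move _ hq) h4 ?_
    change ∀ᶠ y in 𝓝 (φ.toFun (graphPt φ u x)).1, _
    rw [toFun_graphPt h2]
    exact h1

variable [FiniteDimensional ℝ W] [T2Space F] [IsManifold I ∞ F] {nabla : LinearConnection I F}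
  {C : V × W → (V × W) →L[ℝ] (V × W) →L[ℝ] (V × W)}

/-- By induction the coordinates on the prolongation of order `l` satisfy `c = tower (j¹ c)`, so the
functions `ℓ (c - tower (j¹ c))`, `ℓ` a linear form, vanish on it. By the definition of prolongation
the `R`-plane annihilates them once they are made global by a cutoff. This says that `hor c v` is
the derivative of the tower along `horLift`, which is `hor` of the tower one order higher. -/
theorem eq_tower_of_mem_prolong (hC : HasChristoffel nabla φ.toOpenPartialHomeomorph C) (l : ℕ)
    {θ : Jet I A (2 + l)} (hθ : θ ∈ prolong (geodesicEquation nabla A) l)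
    {c : JetCoords V W (2 + l)} (hc : HasCoords φ θ c) :
    c = tower (geodesicForm C) (2 + l) (truncJ (by omega) c) := by
  induction l with
  | zero => exact (mem_geodesicEquation_iff hC hc).1 hθ
  | succ l ih =>
    have hΩ := isOpen_ptJ_target (r := 1) φ
    have hG := hC.contDiffOn_geodesicForm
    obtain ⟨h1, h2⟩ := hθ
    have hp := hc.proj (Nat.le_succ (2 + l))
    have e1 := ih h1 hp
    rw [truncJ_truncJ] at e1
    set c₁ : JetCoords V W 1 := truncJ (by omega) c with hc₁
    have hmem : c₁ ∈ {c : JetCoords V W 1 | ptJ c ∈ φ.target} := hc.mem_target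
    refine jetC_ext_of_hor rfl fun v => ?_
    refine Eq.trans ?_ (fderiv_tower_horLift hΩ hG hmem (2 + l) v)
    have e2 : truncJ (k := 1) (r := 2 + l) (by omega) (hor c v) = horLift (geodesicForm C) c₁ v := by
      rw [truncJ_hor, ← hor_tower_two hΩ hG hmem]
      have e3 := congrArg (truncJ (k := 2) (by omega)) e1
      rw [truncJ_truncJ, truncJ_tower] at e3
      rw [← e3]
    refine (SeparatingDual.eq_iff_forall_dual_eq (R := ℝ)).2 fun ℓ => ?_
    let g : JetCoords V W (2 + l) → ℝ := fun c =>
      ℓ (c - tower (geodesicForm C) (2 + l) (truncJ (by omega) c))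
    have hg : ContDiffOn ℝ ∞ g {c | ptJ c ∈ φ.target} :=
      (ContinuousLinearMap.contDiff ℓ).comp_contDiffOn (contDiff_id.contDiffOn.sub
        ((contDiffOn_tower hΩ hG (2 + l)).comp (contDiff_truncJ _).contDiffOn fun c hc => hc))
    obtain ⟨f, hf, hf0⟩ := exists_isRep_of_contDiffOn (A := A) (by omega) hp.mem_target hg
    have hvan : ∀ ϑ ∈ prolong (geodesicEquation nabla A) l, f.1 ϑ = 0 := by
      intro ϑ hϑ
      refine hf0 ϑ fun c' hc' => ?_
      simp only [g]
      rw [← ih hϑ hc', sub_self, map_zero]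
    obtain ⟨D, hD, hDv⟩ := exists_mem_RPlane hc v
    have h3 : D f = 0 := (Submodule.mem_dualAnnihilator _).1 (h2 hD).2 f hvan
    rw [hDv f g hf] at h3
    have hT : HasFDerivAt (tower (geodesicForm C) (2 + l))
        (fderiv ℝ (tower (geodesicForm C) (2 + l)) c₁)
        (truncJ (k := 1) (by omega) (truncJ (Nat.le_succ (2 + l)) c)) :=
      (((contDiffOn_tower hΩ hG (2 + l)).contDiffAt (hΩ.mem_nhds hmem)).differentiableAt
        (by simp)).hasFDerivAt
    have h4 : HasFDerivAt g (ℓ.comp (ContinuousLinearMap.id ℝ _ -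
        (fderiv ℝ (tower (geodesicForm C) (2 + l)) c₁).comp (truncJ (by omega))))
        (truncJ (Nat.le_succ (2 + l)) c) :=
      ℓ.hasFDerivAt.comp _ ((hasFDerivAt_id _).sub (hT.comp _ (ContinuousLinearMap.hasFDerivAt _)))
    rw [h4.fderiv] at h3
    simp only [ContinuousLinearMap.comp_apply, sub_apply, map_sub,
      e2] at h3
    exact sub_eq_zero.1 h3

/-- If the geodesic distribution is integrable, there is a totally geodesic submanifold through
every first order jet. -/
theorem exists_geodesic_submanifold (hA : IsOpenClass I A)
    (hC : HasChristoffel nabla φ.toOpenPartialHomeomorph C)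
    (hint : IsIntegrable V (geodesicDistribution nabla A))
    {θ : Jet I A 1} {c : JetCoords V W 1} (hc : HasCoords φ θ c) :
    ∃ (t : PointedSub I A) (u : V → W), Jet.mk 1 t = θ ∧ IsGraphAt φ t.carrier t.pt u ∧
      ∀ᶠ x in 𝓝 (φ.toFun t.pt).1, ∀ hq : graphPt φ u x ∈ t.carrier,
        Jet.mk 2 (t.move (graphPt φ u x) hq) ∈ geodesicEquation nabla A := by
  have hΩ := isOpen_ptJ_target (V := V) (W := W) (r := 1) φ
  have hG := hC.contDiffOn_geodesicForm
  obtain ⟨j, U, hU, h0U, hj0, hjs, hT⟩ := hint θ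
  subst hj0
  obtain ⟨κ, U₁, hU₁, h0U₁, hsub, hκ, hκs, hκ0⟩ := exists_smooth_coords hU hjs h0U hc
  have hκd (x) (hx : x ∈ U₁) : HasFDerivAt κ (fderiv ℝ κ x) x :=
    ((hκs.contDiffAt (hU₁.mem_nhds hx)).differentiableAt (by simp)).hasFDerivAt
  have hloc (x) (hx : x ∈ U₁) (f : smoothFun I A 1) (g : JetCoords V W 1 → ℝ)
      (hg : IsRep f.1 φ g (κ x)) (v : V) :
      fderiv ℝ (fun y => f.1 (j y)) x v = fderiv ℝ g (κ x) (fderiv ℝ κ x v) := by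
    have h1 := ((hg.contDiffAt.differentiableAt (by simp)).hasFDerivAt.comp x
      (hκd x hx)).congr_of_eventuallyEq (f₁ := fun y => f.1 (j y)) (by
        filter_upwards [(hκd x hx).continuousAt.eventually hg.eventually, hU₁.mem_nhds hx]
          with y h2 h3 using h2 _ (hκ y h3))
    rw [h1.fderiv]
    rfl
  -- the derivative of the integral manifold
  have hder (x) (hx : x ∈ U₁) (v : V) :
      fderiv ℝ κ x v = horLift (geodesicForm C) (κ x) (fderiv ℝ κ x v).1 := by
    obtain ⟨T, hTv⟩ := hT x (hsub hx)
    obtain ⟨w, hw⟩ := (mem_geodesicDistribution hA hC (hκ x hx)).1 (T v).2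
    have h1 : fderiv ℝ κ x v = horLift (geodesicForm C) (κ x) w := by
      refine eq_of_forall_fderiv_eq (A := A) le_rfl (hκ x hx).mem_target fun f g hg => ?_
      rw [← hw f g hg, hTv, hloc x hx f g hg]
    rw [h1, fst_horLift]
  -- The planes of the distribution are graphs over `V`, so the integral manifold projects to `V`
  -- with injective derivative; `ρ` below inverts this projection.
  have hinj (x) (hx : x ∈ U₁) (v : V) (hv : (fderiv ℝ κ x v).1 = 0) : v = 0 := by
    obtain ⟨T, hTv⟩ := hT x (hsub hx)
    have h1 : fderiv ℝ κ x v = 0 := by rw [hder x hx, hv, map_zero]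
    refine T.map_eq_zero_iff.1 (Subtype.ext (LinearMap.ext fun f => ?_))
    obtain ⟨g, hg⟩ := exists_isRep f (hκ x hx)
    rw [hTv, hloc x hx f g hg, h1, map_zero]
    rfl
  have hκ₁s : ContDiffOn ℝ ∞ (fun x => (κ x).1) U₁ := contDiff_fst.comp_contDiffOn hκs
  have hκ₁d (x) (hx : x ∈ U₁) :
      HasFDerivAt (fun x => (κ x).1) ((ContinuousLinearMap.fst ℝ V _).comp (fderiv ℝ κ x)) x :=
    (hκd x hx).fst
  obtain ⟨ρ, O, hO, h0O, hρ, hρ0, hρO, -⟩ := exists_local_inverse hU₁ hκ₁s h0U₁ (by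
    rw [(hκ₁d 0 h0U₁).fderiv]
    exact isInvertible_of_injective fun v hv => hinj 0 h0U₁ v hv)
  have hρd (y) (hy : y ∈ O) : HasFDerivAt ρ (fderiv ℝ ρ y) y :=
    ((hρ.contDiffAt (hO.mem_nhds hy)).differentiableAt (by simp)).hasFDerivAt
  -- The integral manifold parametrized by the base coordinate. Its derivative is `horLift`, which
  -- says both that `K` is the first order jet of its value component `u` and that `D²u = G`.
  let K : V → JetCoords V W 1 := fun y => κ (ρ y)
  have hKs : ContDiffOn ℝ ∞ K O := hκs.comp hρ fun y hy => (hρO y hy).1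
  have hK1 (y) (hy : y ∈ O) : (K y).1 = y := (hρO y hy).2
  have hKd (y) (hy : y ∈ O) : HasFDerivAt K (horLift (geodesicForm C) (K y)) y := by
    have h1 := (hκd _ (hρO y hy).1).comp y (hρd y hy)
    refine (show HasFDerivAt K _ y from h1).congr_fderiv ?_
    ext1 w
    rw [ContinuousLinearMap.comp_apply, hder _ (hρO y hy).1]
    congr 1
    have h2 := (hκ₁d _ (hρO y hy).1).comp y (hρd y hy)
    have h3 : HasFDerivAt (fun y => (K y).1) (ContinuousLinearMap.id ℝ V) y :=
      (hasFDerivAt_id y).congr_of_eventuallyEq (by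
        filter_upwards [hO.mem_nhds hy] with z hz using hK1 z hz)
    exact congrArg (fun T => T w) (h2.unique h3)
  let u : V → W := fun y => val0 (K y)
  have hus : ContDiffOn ℝ ∞ u O :=
    (ContinuousLinearMap.contDiff (val0 (V := V) (W := W) (r := 1))).comp_contDiffOn hKs
  have hud (y) (hy : y ∈ O) : HasFDerivAt u (lin le_rfl (K y)) y := by
    have h1 := (val0 (V := V) (W := W) (r := 1)).hasFDerivAt.comp y (hKd y hy)
    exact (show HasFDerivAt u _ y from h1).congr_fderiv rfl
  have hju (y) (hy : y ∈ O) : jet 1 u y = K y := by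
    refine jetC1_ext ?_ ?_
    · rw [ptJ_jet]
      exact Prod.ext (hK1 y hy).symm rfl
    · rw [lin_jet, (hud y hy).fderiv]
  have hju2 (y) (hy : y ∈ O) : bilin V W (iteratedFDeriv ℝ 2 u y) = geodesicForm C (K y) := by
    ext v w
    rw [bilin_iteratedFDeriv]
    have h1 : fderiv ℝ u =ᶠ[𝓝 y] fun y => lin le_rfl (K y) := by
      filter_upwards [hO.mem_nhds hy] with z hz using (hud z hz).fderiv
    have h2 := (lin (V := V) (W := W) (r := 1) le_rfl).hasFDerivAt.comp y (hKd y hy)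
    rw [h1.fderiv_eq, (show HasFDerivAt (fun y => lin le_rfl (K y)) _ y from h2).fderiv,
      ContinuousLinearMap.comp_apply, lin_horLift]
  have hc0 : (κ 0).1 = c.1 := by rw [hκ0]
  simp only [hc0] at h0O hρ0
  have hKc : K c.1 = c := by
    change κ (ρ c.1) = c
    rw [hρ0, hκ0]
  obtain ⟨t, ht, hg⟩ := (hA φ _ c hc).self_of_nhds u ⟨O, hO.mem_nhds h0O, hus⟩
    (by rw [hju _ h0O, hKc])
  have htc : (φ.toFun t.pt).1 = c.1 := by rw [ht, fst_ptJ]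
  refine ⟨t, u, ?_, hg, ?_⟩
  · refine HasCoords.eq (φ := φ) (c := c) ⟨t, u, rfl, hg, ?_⟩ hc
    rw [htc, hju _ h0O, hKc]
  · have hev := hg.eventually_mem t.pt_mem
    rw [htc] at hev ⊢
    filter_upwards [hO.mem_nhds h0O, hev] with x h1 ⟨h2, h3, h4⟩ hq
    have h5 : HasCoords φ (Jet.mk 2 (t.move (graphPt φ u x) hq)) (jet 2 u x) := by
      refine ⟨t.move _ hq, u, rfl, h4, ?_⟩
      change jet 2 u (φ.toFun (graphPt φ u x)).1 = _
      rw [toFun_graphPt h2]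
    refine (mem_geodesicEquation_iff hC h5).2 ?_
    refine (eq_tower_two_iff hΩ hG h5.mem_target).2 ?_
    rw [truncJ_jet, compJ_jet, hju2 x h1, hju x h1]

end Prolongation

end GeodesicJets

namespace GeodesicJets

/-! ### Projections between jet spaces -/

section PullProj

variable {V W : Type*} [NormedAddCommGroup V] [NormedSpace ℝ V]
  [NormedAddCommGroup W] [NormedSpace ℝ W]
  {H : Type*} [TopologicalSpace H]
  {I : ModelWithCorners ℝ (V × W) H} {F : Type*} [TopologicalSpace F] [ChartedSpace H F]
  {A : Set (Set F)} {φ : DividedChart I F} {k r : ℕ}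

theorem Jet.proj_proj {l : ℕ} (h : k ≤ l) (h' : l ≤ r) (θ : Jet I A r) :
    Jet.proj h (Jet.proj h' θ) = Jet.proj (h.trans h') θ := by
  obtain ⟨s, rfl⟩ := Quot.exists_rep θ
  rfl

theorem Jet.proj_self (θ : Jet I A r) : Jet.proj le_rfl θ = θ := by
  obtain ⟨s, rfl⟩ := Quot.exists_rep θ
  rfl

theorem JetInf.proj_eq (θ : JetInf I A) (h : k ≤ r) : Jet.proj h (θ.1 r) = θ.1 k := by
  induction r, h using Nat.le_induction with
  | base => exact Jet.proj_self _
  | succ r h ih => rw [← ih, ← θ.2 r, Jet.proj_proj]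

theorem IsRep.comp_proj (h : k ≤ r) {f : Jet I A k → ℝ} {g : JetCoords V W k → ℝ}
    {c : JetCoords V W r} (hg : IsRep f φ g (truncJ h c)) :
    IsRep (fun θ => f (Jet.proj h θ)) φ (fun c => g (truncJ h c)) c := by
  obtain ⟨N, hN, hs, hf⟩ := hg
  refine ⟨_, (contDiff_truncJ (n := ∞) h).continuous.continuousAt.preimage_mem_nhds hN,
    hs.comp (contDiff_truncJ h).contDiffOn fun c hc => hc, fun θ c' hc hm => ?_⟩
  exact hf _ _ (hc.proj h) hm

theorem mem_smoothFun {f : Jet I A r → ℝ} : f ∈ smoothFun I A r ↔ IsSmoothFun f := Iff.rfl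

/-- Pull-back of smooth functions between jet spaces. -/
def pullProj (A : Set (Set F)) (h : k ≤ r) : smoothFun I A k →ₐ[ℝ] smoothFun I A r where
  toFun f := ⟨fun θ => f.1 (Jet.proj h θ), mem_smoothFun.2 <| isSmoothFun_iff.2 fun φ θ c hc => by
    obtain ⟨g, hg⟩ := exists_isRep f (hc.proj h)
    exact ⟨_, hg.comp_proj h⟩⟩
  map_one' := rfl
  map_mul' _ _ := rfl
  map_zero' := rfl
  map_add' _ _ := rfl
  commutes' _ := rfl

/-- Truncation of `hor c v` is `hor` of the truncated jet, with the same `v`. -/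
theorem RPlane_comp_pullProj [FiniteDimensional ℝ V] (h : k ≤ r) {θ : Jet I A (r + 1)}
    {D : Module.Dual ℝ (smoothFun I A r)} (hD : D ∈ RPlane θ) :
    D ∘ₗ (pullProj A h).toLinearMap ∈ RPlane (Jet.proj (Nat.succ_le_succ h) θ) := by
  obtain ⟨φ, c, hc⟩ := exists_hasCoords θ
  rw [RPlane_eq_coordPlane hc] at hD
  obtain ⟨v, hv⟩ := hD
  rw [RPlane_eq_coordPlane (hc.proj (Nat.succ_le_succ h))]
  refine ⟨v, fun f g hg => ?_⟩
  rw [truncJ_truncJ] at hg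
  have h1 := hv (pullProj A h f) _ (hg.comp_proj h (c := truncJ r.le_succ c))
  refine h1.trans ?_
  have h2 : HasFDerivAt (fun c : JetCoords V W r => g (truncJ h c)) _ (truncJ r.le_succ c) :=
    (hg.contDiffAt.differentiableAt (by simp)).hasFDerivAt.comp (truncJ r.le_succ c)
      (truncJ (V := V) (W := W) h).hasFDerivAt
  rw [h2.fderiv, ContinuousLinearMap.comp_apply, truncJ_hor]
  rfl

end PullProj

/-! ### Comparison of the equation and its infinite prolongation with first order jets -/

section Main

variable {V W : Type*} [NormedAddCommGroup V] [NormedSpace ℝ V]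
  [NormedAddCommGroup W] [NormedSpace ℝ W] [FiniteDimensional ℝ V]
  {H : Type*} [TopologicalSpace H]
  {I : ModelWithCorners ℝ (V × W) H} {F : Type*} [TopologicalSpace F] [ChartedSpace H F]
  [IsManifold I ∞ F] {A : Set (Set F)} {φ : DividedChart I F}
  {nabla : LinearConnection I F}
  {C : V × W → (V × W) →L[ℝ] (V × W) →L[ℝ] (V × W)}

theorem hasCoords_geodesicEquation (hC : HasChristoffel nabla φ.toOpenPartialHomeomorph C)
    {ϑ : Jet I A 2} (hϑ : ϑ ∈ geodesicEquation nabla A) {c : JetCoords V W 1}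
    (hc : HasCoords φ (Jet.proj (Nat.le_succ 1) ϑ) c) :
    HasCoords φ ϑ (tower (geodesicForm C) 2 c) := by
  obtain ⟨c', hc', rfl⟩ := hc.lift le_rfl (Nat.le_succ 1)
  rw [← (mem_geodesicEquation_iff hC hc').1 hϑ]
  exact hc'

/-- Pull-back of smooth functions along the maps given by the tower of jets. -/
theorem IsRep.comp_tower (hC : HasChristoffel nabla φ.toOpenPartialHomeomorph C) {l : ℕ}
    {f : Jet I A l → ℝ} {g : JetCoords V W l → ℝ} {c : JetCoords V W 1} (hc : ptJ c ∈ φ.target)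
    (hg : IsRep f φ g (tower (geodesicForm C) l c)) {τ : Jet I A 1 → Jet I A l}
    (hτ : ∀ θ c, HasCoords φ θ c → HasCoords φ (τ θ) (tower (geodesicForm C) l c)) :
    IsRep (fun θ => f (τ θ)) φ (fun c => g (tower (geodesicForm C) l c)) c := by
  obtain ⟨N, hN, hs, hf⟩ := hg
  have hT := contDiffOn_tower (isOpen_ptJ_target φ) hC.contDiffOn_geodesicForm l
  have hcont : ContinuousAt (tower (geodesicForm C) l) c :=
    (hT.contDiffAt ((isOpen_ptJ_target φ).mem_nhds hc)).continuousAt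
  refine ⟨_, inter_mem ((isOpen_ptJ_target φ).mem_nhds hc) (hcont.preimage_mem_nhds hN),
    hs.comp (hT.mono inter_subset_left) fun c hc => hc.2, fun θ c' hc' hm => ?_⟩
  exact hf _ _ (hτ θ c' hc') hm.2

theorem fderiv_comp_tower (hC : HasChristoffel nabla φ.toOpenPartialHomeomorph C) {l : ℕ}
    {g : JetCoords V W l → ℝ} {c : JetCoords V W 1} (hc : ptJ c ∈ φ.target)
    (hg : DifferentiableAt ℝ g (tower (geodesicForm C) l c)) (v : V) :
    fderiv ℝ (fun c => g (tower (geodesicForm C) l c)) c (horLift (geodesicForm C) c v) =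
      fderiv ℝ g (tower (geodesicForm C) l c) (hor (tower (geodesicForm C) (l + 1) c) v) := by
  have hΩ := isOpen_ptJ_target (V := V) (W := W) (r := 1) φ
  have hT : DifferentiableAt ℝ (tower (geodesicForm C) l) c :=
    ((contDiffOn_tower hΩ hC.contDiffOn_geodesicForm l).contDiffAt
      (hΩ.mem_nhds hc)).differentiableAt (by simp)
  have h1 := hg.hasFDerivAt.comp c hT.hasFDerivAt
  rw [(show HasFDerivAt (fun c => g (tower (geodesicForm C) l c)) _ c from h1).fderiv,
    ContinuousLinearMap.comp_apply, fderiv_tower_horLift hΩ hC.contDiffOn_geodesicForm hc]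

theorem injective_proj_geodesicEquation
    (hC : ∀ φ : DividedChart I F, ∃ C, HasChristoffel nabla φ.toOpenPartialHomeomorph C) :
    Function.Injective fun θ : geodesicEquation nabla A => Jet.proj (Nat.le_succ 1) θ.1 := by
  intro θ θ' h
  obtain ⟨φ, c, hc⟩ := exists_hasCoords (Jet.proj (Nat.le_succ 1) θ.1)
  obtain ⟨C, hCφ⟩ := hC φ
  have hc' : HasCoords φ (Jet.proj (Nat.le_succ 1) θ'.1) c := by
    have h' : Jet.proj (Nat.le_succ 1) θ.1 = Jet.proj (Nat.le_succ 1) θ'.1 := h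
    rwa [h'] at hc
  exact Subtype.ext
    ((hasCoords_geodesicEquation hCφ θ.2 hc).eq (hasCoords_geodesicEquation hCφ θ'.2 hc'))

theorem surjective_proj_geodesicEquation (hA : IsOpenClass I A)
    (hC : ∀ φ : DividedChart I F, ∃ C, HasChristoffel nabla φ.toOpenPartialHomeomorph C) :
    Function.Surjective fun θ : geodesicEquation nabla A => Jet.proj (Nat.le_succ 1) θ.1 := by
  intro θ
  obtain ⟨φ, c, hc⟩ := exists_hasCoords θ
  obtain ⟨C, hCφ⟩ := hC φ
  obtain ⟨ϑ, hϑ⟩ := exists_hasCoords_tower_two hA hCφ hc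
  refine ⟨⟨ϑ, mem_geodesicEquation_of_hasCoords hCφ hϑ⟩, ?_⟩
  have h1 := hϑ.proj (Nat.le_succ 1)
  rw [truncJ_tower, tower_one] at h1
  exact h1.eq hc

/-- The inverse of the projection from the equation, with `tower` as its expression in all charts
simultaneously; functions and planes are pulled back along it. -/
theorem exists_section_proj (hA : IsOpenClass I A)
    (hC : ∀ φ : DividedChart I F, ∃ C, HasChristoffel nabla φ.toOpenPartialHomeomorph C) :
    ∃ τ : Jet I A 1 → Jet I A 2,
      (∀ ϑ ∈ geodesicEquation nabla A, τ (Jet.proj (Nat.le_succ 1) ϑ) = ϑ) ∧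
      ∀ (φ : DividedChart I F) (C : V × W → (V × W) →L[ℝ] (V × W) →L[ℝ] (V × W)),
        HasChristoffel nabla φ.toOpenPartialHomeomorph C →
          ∀ θ c, HasCoords φ θ c → HasCoords φ (τ θ) (tower (geodesicForm C) 2 c) := by
  obtain ⟨ι, hι⟩ := (surjective_proj_geodesicEquation hA hC).hasRightInverse
  refine ⟨fun θ => (ι θ).1, fun ϑ hϑ => ?_, fun φ C hCφ θ c hc => ?_⟩
  · exact congrArg Subtype.val (injective_proj_geodesicEquation hC (a₂ := ⟨ϑ, hϑ⟩) (hι _))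
  · refine hasCoords_geodesicEquation hCφ (ι θ).2 ?_
    have h1 : Jet.proj (Nat.le_succ 1) (ι θ).1 = θ := hι θ
    rwa [h1]

/-- Smooth functions of the jets of a solution are smooth functions of its first order jet. -/
theorem isSmoothFun_comp_tower
    (hC : ∀ φ : DividedChart I F, ∃ C, HasChristoffel nabla φ.toOpenPartialHomeomorph C) {l : ℕ}
    (f : smoothFun I A l) {τ : Jet I A 1 → Jet I A l}
    (hτ : ∀ (φ : DividedChart I F) (C : V × W → (V × W) →L[ℝ] (V × W) →L[ℝ] (V × W)),
      HasChristoffel nabla φ.toOpenPartialHomeomorph C →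
        ∀ θ c, HasCoords φ θ c → HasCoords φ (τ θ) (tower (geodesicForm C) l c)) :
    IsSmoothFun fun θ => f.1 (τ θ) := by
  rw [isSmoothFun_iff]
  intro φ θ c hc
  obtain ⟨C, hCφ⟩ := hC φ
  obtain ⟨g, hg⟩ := exists_isRep f (hτ φ C hCφ θ c hc)
  exact ⟨_, hg.comp_tower hCφ hc.mem_target (hτ φ C hCφ)⟩

/-- Injectivity is surjectivity of the projection. For surjectivity, a function on the equation
extends to second order jets, and its composition with the section is smooth because the tower is.
No integrability is involved. -/
theorem bijective_pullEquation (hA : IsOpenClass I A)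
    (hC : ∀ φ : DividedChart I F, ∃ C, HasChristoffel nabla φ.toOpenPartialHomeomorph C) :
    Function.Bijective
      ((restrictEq (geodesicEquation nabla A)).comp (pullProj A (Nat.le_succ 1))) := by
  constructor
  · intro f f' h
    refine Subtype.ext (funext fun θ => ?_)
    obtain ⟨ϑ, rfl⟩ := surjective_proj_geodesicEquation hA hC θ
    exact congrArg (fun h => h.1 ϑ) h
  · rintro ⟨_, f, hf, rfl⟩
    obtain ⟨τ, hτ, hτc⟩ := exists_section_proj hA hC
    refine ⟨⟨_, mem_smoothFun.2 (isSmoothFun_comp_tower hC ⟨f, hf⟩ hτc)⟩, ?_⟩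
    exact Subtype.ext (funext fun ϑ => congrArg f (hτ ϑ.1 ϑ.2))

variable [FiniteDimensional ℝ W] [T2Space F]

/-- The jets of the points of the infinite prolongation are determined by their first order
jets. -/
theorem hasCoords_prolongInf (hC : HasChristoffel nabla φ.toOpenPartialHomeomorph C)
    (w : prolongInf (geodesicEquation nabla A)) {c : JetCoords V W 1}
    (hc : HasCoords φ (w.1.1 1) c) (l : ℕ) :
    HasCoords φ (w.1.1 l) (tower (geodesicForm C) l c) := by
  -- Prolongations are counted from order two, so membership in the one of index `l` concerns the
  -- jet of order `2 + l`; the jets of orders `1` and `l` are both truncations of it.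
  rw [← w.1.proj_eq (show 1 ≤ 2 + l by omega)] at hc
  obtain ⟨c', hc', rfl⟩ := hc.lift le_rfl (by omega)
  rw [← w.1.proj_eq (show l ≤ 2 + l by omega)]
  have h1 := hc'.proj (show l ≤ 2 + l by omega)
  rw [eq_tower_of_mem_prolong hC l (w.2 l) hc', truncJ_tower] at h1
  exact h1

theorem injective_projInf
    (hC : ∀ φ : DividedChart I F, ∃ C, HasChristoffel nabla φ.toOpenPartialHomeomorph C) : Function.Injective (projInf (geodesicEquation nabla A) 1) := by
  intro w w' h
  obtain ⟨φ, c, hc⟩ := exists_hasCoords (w.1.1 1)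
  obtain ⟨C, hCφ⟩ := hC φ
  have h' : w.1.1 1 = w'.1.1 1 := h
  have hc' := hc
  rw [h'] at hc'
  refine Subtype.ext (Subtype.ext (funext fun l => ?_))
  exact (hasCoords_prolongInf hCφ w hc l).eq (hasCoords_prolongInf hCφ w' hc' l)

/-- Integrability is used here: the infinite jet of a totally geodesic submanifold with the given
first order jet is a point of the infinite prolongation. -/
theorem surjective_projInf (hA : IsOpenClass I A)
    (hC : ∀ φ : DividedChart I F, ∃ C, HasChristoffel nabla φ.toOpenPartialHomeomorph C)
    (hint : IsIntegrable V (geodesicDistribution nabla A)) :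
    Function.Surjective (projInf (geodesicEquation nabla A) 1) := by
  intro θ
  obtain ⟨φ, c, hc⟩ := exists_hasCoords θ
  obtain ⟨C, hCφ⟩ := hC φ
  obtain ⟨t, u, rfl, hu, h⟩ := exists_geodesic_submanifold hA hCφ hint hc
  exact ⟨⟨⟨fun l => Jet.mk l t, fun l => rfl⟩, fun l => mem_prolong_of_eventually l hu h⟩, rfl⟩

/-- The section of the projection of the infinite prolongation to the space of `l`-jets. -/
theorem exists_section_projInf (hA : IsOpenClass I A)
    (hC : ∀ φ : DividedChart I F, ∃ C, HasChristoffel nabla φ.toOpenPartialHomeomorph C)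
    (hint : IsIntegrable V (geodesicDistribution nabla A)) (l : ℕ) :
    ∃ τ : Jet I A 1 → Jet I A l,
      (∀ w : prolongInf (geodesicEquation nabla A), τ (projInf _ 1 w) = projInf _ l w) ∧
      ∀ (φ : DividedChart I F) (C : V × W → (V × W) →L[ℝ] (V × W) →L[ℝ] (V × W)),
        HasChristoffel nabla φ.toOpenPartialHomeomorph C →
          ∀ θ c, HasCoords φ θ c → HasCoords φ (τ θ) (tower (geodesicForm C) l c) := by
  obtain ⟨ι, hι⟩ := (surjective_projInf hA hC hint).hasRightInverse
  refine ⟨fun θ => projInf _ l (ι θ), fun w => ?_, fun φ C hCφ θ c hc => ?_⟩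
  · exact congrArg (projInf _ l) (injective_projInf hC (hι _))
  · refine hasCoords_prolongInf hCφ (ι θ) ?_ l
    have h1 : (ι θ).1.1 1 = θ := hι θ
    rwa [h1]

/-- Every function of the `l`-jet on the infinite prolongation becomes, through the tower, a smooth
function of the first order jet, so all the algebras in the supremum `infFun` are contained in the
one for `l = 1`. -/
theorem bijective_pullInf (hA : IsOpenClass I A)
    (hC : ∀ φ : DividedChart I F, ∃ C, HasChristoffel nabla φ.toOpenPartialHomeomorph C)
    (hint : IsIntegrable V (geodesicDistribution nabla A)) :
    Function.Bijective (pullInf (geodesicEquation nabla A) 1) := by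
  constructor
  · intro f f' h
    refine Subtype.ext (funext fun θ => ?_)
    obtain ⟨w, rfl⟩ := surjective_projInf hA hC hint θ
    exact congrArg (fun h => h.1 w) h
  · rintro ⟨h, hh⟩
    have hle : infFun (geodesicEquation nabla A) ≤
        (smoothFun I A 1).map (pullback (projInf (geodesicEquation nabla A) 1)) := by
      refine iSup_le fun l => ?_
      rintro _ ⟨f, hf, rfl⟩
      obtain ⟨τ, hτ, hτc⟩ := exists_section_projInf hA hC hint l
      refine ⟨fun θ => f (τ θ), isSmoothFun_comp_tower hC ⟨f, hf⟩ hτc, ?_⟩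
      exact funext fun w => congrArg f (hτ w)
    obtain ⟨f, hf, rfl⟩ := hle hh
    exact ⟨⟨f, hf⟩, rfl⟩

/-- A tangent vector with values determined by its restriction to functions of the first order
jets, where it lies in the geodesic distribution, lies in the planes of higher order jets. -/
theorem mem_RPlane_of_mem_geodesicDistribution (hA : IsOpenClass I A)
    (hC : ∀ φ : DividedChart I F, ∃ C, HasChristoffel nabla φ.toOpenPartialHomeomorph C)
    {l : ℕ} {θ : Jet I A 1} {ϑ : Jet I A (l + 1)}
    (hϑ : ∀ (φ : DividedChart I F) (C : V × W → (V × W) →L[ℝ] (V × W) →L[ℝ] (V × W)),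
      HasChristoffel nabla φ.toOpenPartialHomeomorph C →
        ∀ c, HasCoords φ θ c → HasCoords φ ϑ (tower (geodesicForm C) (l + 1) c))
    {τ : Jet I A 1 → Jet I A l}
    (hτ : ∀ (φ : DividedChart I F) (C : V × W → (V × W) →L[ℝ] (V × W) →L[ℝ] (V × W)),
      HasChristoffel nabla φ.toOpenPartialHomeomorph C →
        ∀ θ c, HasCoords φ θ c → HasCoords φ (τ θ) (tower (geodesicForm C) l c))
    {D : Module.Dual ℝ (smoothFun I A 1)} (hD : D ∈ geodesicDistribution nabla A θ)
    {D' : Module.Dual ℝ (smoothFun I A l)}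
    (h : ∀ (f : smoothFun I A l) (f' : smoothFun I A 1), (∀ θ, f'.1 θ = f.1 (τ θ)) →
      D' f = D f') : D' ∈ RPlane ϑ := by
  obtain ⟨φ, c, hc⟩ := exists_hasCoords θ
  obtain ⟨C, hCφ⟩ := hC φ
  obtain ⟨v, hv⟩ := (mem_geodesicDistribution hA hCφ hc).1 hD
  rw [RPlane_eq_coordPlane (hϑ φ C hCφ c hc)]
  refine ⟨v, fun f g hg => ?_⟩
  rw [truncJ_tower] at hg ⊢
  rw [h f ⟨_, mem_smoothFun.2 (isSmoothFun_comp_tower hC f hτ)⟩ fun θ => rfl,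
    hv _ _ (hg.comp_tower hCφ hc.mem_target (hτ φ C hCφ)),
    fderiv_comp_tower hCφ hc.mem_target (hg.contDiffAt.differentiableAt (by simp))]

/-- The jet and the value of the Grassmannian structure at its projection have the same coordinates.
-/
theorem RPlane_of_mem_geodesicEquation (hA : IsOpenClass I A)
    (hC : ∀ φ : DividedChart I F, ∃ C, HasChristoffel nabla φ.toOpenPartialHomeomorph C)
    {ϑ : Jet I A 2} (hϑ : ϑ ∈ geodesicEquation nabla A) :
    RPlane ϑ = geodesicDistribution nabla A (Jet.proj (Nat.le_succ 1) ϑ) := by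
  obtain ⟨φ, c, hc⟩ := exists_hasCoords (Jet.proj (Nat.le_succ 1) ϑ)
  obtain ⟨C, hCφ⟩ := hC φ
  rw [RPlane_eq_coordPlane (hasCoords_geodesicEquation hCφ hϑ hc),
    geodesicDistribution_eq hA hCφ hc]

/-- The condition at `l = 1` is the membership on the right. It implies the others: functions of the
`l`-jet are functions of the first order jet, so the vector acts on them through its push-forward,
and the tower preserves total derivatives. -/
theorem mem_infCartan_iff (hA : IsOpenClass I A)
    (hC : ∀ φ : DividedChart I F, ∃ C, HasChristoffel nabla φ.toOpenPartialHomeomorph C)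
    (hint : IsIntegrable V (geodesicDistribution nabla A))
    (w : prolongInf (geodesicEquation nabla A))
    (d : Module.Dual ℝ (infFun (geodesicEquation nabla A))) :
    d ∈ infCartan (geodesicEquation nabla A) w ↔
      d ∘ₗ (pullInf (geodesicEquation nabla A) 1).toLinearMap ∈
        geodesicDistribution nabla A (projInf _ 1 w) := by
  have h2 : RPlane (w.1.1 2) = geodesicDistribution nabla A (projInf _ 1 w) := by
    rw [RPlane_of_mem_geodesicEquation hA hC (w.2 0), w.1.proj_eq]
    rfl
  rw [infCartan, Submodule.mem_iInf]
  constructor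
  · intro h
    have h1 := h 1
    rw [← h2]
    exact h1
  · intro h l
    obtain ⟨τ, hτ, hτc⟩ := exists_section_projInf hA hC hint l
    refine mem_RPlane_of_mem_geodesicDistribution hA hC (θ := projInf _ 1 w) (ϑ := w.1.1 (l + 1))
      (fun φ C hCφ c hc => hasCoords_prolongInf hCφ w hc (l + 1)) hτc h fun f f' hf => ?_
    have e : pullInf (geodesicEquation nabla A) l f = pullInf (geodesicEquation nabla A) 1 f' :=
      Subtype.ext (funext fun w' => by
        change f.1 (projInf _ l w') = f'.1 (projInf _ 1 w')
        rw [hf, hτ])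
    exact congrArg d e

/-- All `R`-planes at `ϑ` project into the `R`-plane determined by `ϑ` itself, so Cartan vectors
project into the distribution. Conversely a third order jet over `ϑ` whose `R`-plane contains the
given vector is required; integrability supplies it as the third order jet of a point of the
infinite prolongation. -/
theorem mem_equationCartan_iff (hA : IsOpenClass I A)
    (hC : ∀ φ : DividedChart I F, ∃ C, HasChristoffel nabla φ.toOpenPartialHomeomorph C)
    (hint : IsIntegrable V (geodesicDistribution nabla A))
    (ϑ : geodesicEquation nabla A)
    (d : Module.Dual ℝ (equationFun (geodesicEquation nabla A))) :
    d ∈ equationCartan (geodesicEquation nabla A) ϑ ↔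
      d ∘ₗ ((restrictEq (geodesicEquation nabla A)).comp
        (pullProj A (Nat.le_succ 1))).toLinearMap ∈
        geodesicDistribution nabla A (Jet.proj (Nat.le_succ 1) ϑ.1) := by
  constructor
  · intro h
    have hle : cartanPlane ϑ.1 ≤ (geodesicDistribution nabla A
        (Jet.proj (Nat.le_succ 1) ϑ.1)).comap
          (Module.Dual.transpose (R := ℝ) (pullProj A (Nat.le_succ 1)).toLinearMap) := by
      refine iSup_le fun ϑ' => iSup_le fun hϑ' => ?_
      intro D hD
      rw [← RPlane_of_mem_geodesicEquation hA hC ϑ.2, ← hϑ']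
      exact RPlane_comp_pullProj (Nat.le_succ 1) hD
    exact hle h
  · intro h
    obtain ⟨w, hw⟩ := surjective_projInf hA hC hint (Jet.proj (Nat.le_succ 1) ϑ.1)
    have h2 : w.1.1 2 = ϑ.1 := by
      have h3 := injective_proj_geodesicEquation hC (a₁ := ⟨w.1.1 2, w.2 0⟩) (a₂ := ϑ)
        ((w.1.proj_eq (Nat.le_succ 1)).trans hw)
      exact congrArg Subtype.val h3
    obtain ⟨τ, hτ, hτc⟩ := exists_section_proj hA hC
    have h3 : d ∘ₗ (restrictEq (geodesicEquation nabla A)).toLinearMap ∈ RPlane (w.1.1 3) := by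
      refine mem_RPlane_of_mem_geodesicDistribution hA hC
        (θ := Jet.proj (Nat.le_succ 1) ϑ.1) (fun φ C hCφ c hc => ?_) hτc h fun f f' hf => ?_
      · rw [← hw] at hc
        exact hasCoords_prolongInf hCφ w hc 3
      · have e : restrictEq (geodesicEquation nabla A) f =
            restrictEq (geodesicEquation nabla A) (pullProj A (Nat.le_succ 1) f') :=
          Subtype.ext (funext fun ϑ' => by
            change f.1 ϑ'.1 = f'.1 (Jet.proj _ ϑ'.1)
            rw [hf, hτ _ ϑ'.2])
        exact congrArg d e
    exact (le_iSup₂_of_le (w.1.1 3) ((w.1.2 2).trans h2) le_rfl :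
      RPlane (w.1.1 3) ≤ cartanPlane ϑ.1) h3

/-- The symmetries of the equation of totally geodesic submanifolds, for an open class of
submanifolds and a connection with smooth symmetric Christoffel forms. -/
theorem symmetryDescription_of_isIntegrable (hA : IsOpenClass I A)
    (hC : ∀ φ : DividedChart I F, ∃ C, HasChristoffel nabla φ.toOpenPartialHomeomorph C)
    (hint : IsIntegrable V (geodesicDistribution nabla A)) : SymmetryDescription nabla A := by
  let ε := AlgEquiv.ofBijective _ (bijective_pullInf hA hC hint)
  let ε' := AlgEquiv.ofBijective _ (bijective_pullEquation (nabla := nabla) hA hC)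
  have hε : ∀ f w, (ε f).1 w = f.1 (projInf (geodesicEquation nabla A) 1 w) := fun f w => rfl
  have hε' : ∀ f (ϑ : geodesicEquation nabla A),
    (ε' f).1 ϑ = f.1 (Jet.proj (Nat.le_succ 1) ϑ.1) := fun f w => rfl
  have hπ := surjective_projInf hA hC hint
  have hπ' := surjective_proj_geodesicEquation (nabla := nabla) hA hC
  have hD : ∀ w d, d ∈ infCartan (geodesicEquation nabla A) w ↔ d ∘ₗ ε.toLinearMap ∈
      geodesicDistribution nabla A (projInf (geodesicEquation nabla A) 1 w) :=
    mem_infCartan_iff hA hC hint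
  have hD' : ∀ ϑ d, d ∈ equationCartan (geodesicEquation nabla A) ϑ ↔ d ∘ₗ ε'.toLinearMap ∈
      geodesicDistribution nabla A (Jet.proj (Nat.le_succ 1) ϑ.1) :=
    mem_equationCartan_iff hA hC hint
  refine ⟨transport ε, transport ε', fun X f w => ?_, fun X f g hg ϑ => ?_, fun X hX => ?_,
    transport_mem_fieldsIn hε hπ hD, transport_mem_symmetries hε hπ hD,
    transport_mem_symmetries hε' hπ' hD', exists_nontrivialSymmetries_equiv hε hπ hD⟩
  · have h1 := hε (ε.symm (X (ε f))) w
    rw [AlgEquiv.apply_symm_apply] at h1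
    exact h1.symm
  · have h1 := hε' (ε'.symm (X (ε' f))) ϑ
    rw [AlgEquiv.apply_symm_apply] at h1
    have e : restrictEq (geodesicEquation nabla A) g = ε' f :=
      Subtype.ext (funext fun ϑ' => hg ϑ'.1)
    rw [e]
    exact h1.symm
  -- On first order jets the claim is the involutivity of the integrable distribution.
  · rw [transport_mem_symmetries hε hπ hD]
    rw [transport_mem_fieldsIn hε hπ hD] at hX
    exact fun Y hY => hint.lie_mem hX hY

end Main

end GeodesicJets

namespace GeodesicJets

/-! ### Openness of the three classes of submanifolds -/

section GraphSets

variable {V W : Type*} [NormedAddCommGroup V] [NormedSpace ℝ V]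
  [NormedAddCommGroup W] [NormedSpace ℝ W]
  {H : Type*} [TopologicalSpace H]
  {I : ModelWithCorners ℝ (V × W) H} {F : Type*} [TopologicalSpace F] [ChartedSpace H F]
  {A : Set (Set F)} {φ : DividedChart I F} {u : V → W} {U : Set V}

/-- The graph of a map in a divided chart. -/
def graphSet (φ : DividedChart I F) (u : V → W) (U : Set V) : Set F :=
  {q | q ∈ φ.source ∧ (φ.toFun q).1 ∈ U ∧ (φ.toFun q).2 = u (φ.toFun q).1}

theorem isGraphAt_graphSet (hU : IsOpen U) (hu : ContDiffOn ℝ ∞ u U) {p : F}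
    (hp : p ∈ graphSet φ u U) : IsGraphAt φ (graphSet φ u U) p u := by
  refine ⟨hp.1, ⟨U, hU.mem_nhds hp.2.1, hu⟩, ?_⟩
  have h1 : ∀ᶠ q in 𝓝 p, (φ.toFun q).1 ∈ U :=
    (continuous_fst.continuousAt.comp (φ.continuousAt hp.1)).eventually_mem (hU.mem_nhds hp.2.1)
  filter_upwards [h1, φ.source_mem_nhds hp.1] with q h2 h3
  exact ⟨fun h => h.2.2, fun h => ⟨h3, h2, h⟩⟩

theorem isSubmanifold_graphSet (hU : IsOpen U) (hu : ContDiffOn ℝ ∞ u U) :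
    IsSubmanifold I (graphSet φ u U) :=
  fun _ hp => ⟨φ, u, isGraphAt_graphSet hU hu hp⟩

/-- Every jet of a map is realized by a submanifold. -/
theorem exists_pointedSub_of_jet {c : JetCoords V W 1} (hc : ptJ c ∈ φ.target)
    (hu : ∃ U ∈ 𝓝 c.1, ContDiffOn ℝ ∞ u U) (hj : jet 1 u c.1 = c) :
    ∃ t : PointedSub I (univ : Set (Set F)), φ.toFun t.pt = ptJ c ∧
      IsGraphAt φ t.carrier t.pt u := by
  obtain ⟨U', hU', hu'⟩ := hu
  obtain ⟨U, hUU', hU, hcU⟩ := mem_nhds_iff.1 hU'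
  have hsm := hu'.mono hUU'
  have e : φ.toFun (φ.invFun (ptJ c)) = ptJ c := φ.toFun_invFun hc
  have hval : u c.1 = val0 c := congrArg val0 hj
  have hmem : φ.invFun (ptJ c) ∈ graphSet φ u U :=
    ⟨φ.inv_mapsTo hc, by rw [e]; exact hcU, by rw [e]; exact hval.symm⟩
  exact ⟨⟨graphSet φ u U, isSubmanifold_graphSet hU hsm, mem_univ _, φ.invFun (ptJ c), hmem⟩, e,
    isGraphAt_graphSet hU hsm hmem⟩

theorem isOpenClass_univ : IsOpenClass I (univ : Set (Set F)) := by
  intro φ θ c hc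
  filter_upwards [(isOpen_ptJ_target φ).mem_nhds hc.mem_target] with c' hc' u hu hj
  exact exists_pointedSub_of_jet hc' hu hj

/-- A class of submanifolds that in suitable charts are the graphs with first derivatives in an
open set is open. -/
theorem isOpenClass_of_charts [FiniteDimensional ℝ V] (ψ : F → DividedChart I F)
    {Q : Set (V →L[ℝ] W)} (hQ : IsOpen Q)
    (h1 : ∀ L ∈ A, ∀ p ∈ L, ∃ w, IsGraphAt (ψ p) L p w ∧ fderiv ℝ w ((ψ p).toFun p).1 ∈ Q)
    (h2 : ∀ (p : F) (w : V → W) (U : Set V), IsOpen U → ContDiffOn ℝ ∞ w U →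
      (∀ x ∈ U, (x, w x) ∈ (ψ p).target ∧ fderiv ℝ w x ∈ Q) → graphSet (ψ p) w U ∈ A) :
    IsOpenClass I A := by
  rintro φ _ _ ⟨s, u, rfl, hu, rfl⟩
  obtain ⟨w, hw, hwQ⟩ := h1 s.carrier s.mem_class s.pt s.pt_mem
  -- Openness is required in the arbitrary chart `φ`, while membership in `A` is read in `ψ₀`. Jets
  -- near that of `s` transfer to `ψ₀` with slope still in `Q`, and the germ is cut down to a graph
  -- whose slopes all lie in `Q`.
  set ψ₀ := ψ s.pt
  have hΩ := isOpen_transitionDomain φ ψ₀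
  have hτ := contDiffOn_transition φ ψ₀
  have hD := hu.mem_changeDomain hw s.pt_mem
  have hDo := isOpen_changeDomain hΩ hτ 1
  have hlin : ContinuousAt (fun c => lin le_rfl (jetMap (transition φ ψ₀) 1 c))
      (jet 1 u (φ.toFun s.pt).1) :=
    (lin (V := V) (W := W) le_rfl).continuous.continuousAt.comp
      ((contDiffOn_jetMap hΩ hτ 1).contDiffAt (hDo.mem_nhds hD)).continuousAt
  have hQ' : lin le_rfl (jetMap (transition φ ψ₀) 1 (jet 1 u (φ.toFun s.pt).1)) ∈ Q := by
    rw [← hu.jet_transition hw s.pt_mem, lin_jet]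
    exact hwQ
  filter_upwards [hDo.mem_nhds hD, hlin.eventually_mem (hQ.mem_nhds hQ'),
    (isOpen_ptJ_target φ).mem_nhds hu.hasCoords.mem_target] with c' k1 k2 k3 v hv hj
  obtain ⟨t, ht, hg⟩ := exists_pointedSub_of_jet k3 hv hj
  have hc' : (φ.toFun t.pt).1 = c'.1 := by rw [ht, fst_ptJ]
  obtain ⟨w', hw'⟩ := hg.exists_transfer (φ := ψ₀) t.pt_mem (by rwa [hc', hj])
  have k4 := hg.jet_transition hw' t.pt_mem 1
  rw [hc', hj] at k4
  rw [← k4, lin_jet] at k2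
  obtain ⟨U, hU, hxU, hsm, hUL⟩ := hw'.exists_nhds t.pt_mem
  have hU' : IsOpen (U ∩ fderiv ℝ w' ⁻¹' Q) :=
    (hsm.continuousOn_fderiv_of_isOpen hU (by simp)).isOpen_inter_preimage hU hQ
  have hsm' := hsm.mono (inter_subset_left (t := fderiv ℝ w' ⁻¹' Q))
  have hmem : t.pt ∈ graphSet ψ₀ w' (U ∩ fderiv ℝ w' ⁻¹' Q) :=
    ⟨hw'.mem_source, ⟨hxU, k2⟩, hw'.apply_eq t.pt_mem⟩
  have hclass := h2 s.pt w' _ hU' hsm' fun x hx => ⟨(hUL x hx.1).1, hx.2⟩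
  refine ⟨⟨_, isSubmanifold_graphSet hU' hsm', hclass, t.pt, hmem⟩, ht, hg.mem_source, hg.smooth, ?_⟩
  filter_upwards [(isGraphAt_graphSet hU' hsm' hmem).graph, hw'.graph, hg.graph] with q m1 m2 m3
  exact m1.trans (m2.symm.trans m3)

end GraphSets

section Sections

variable {V W : Type*} [NormedAddCommGroup V] [NormedSpace ℝ V]
  [NormedAddCommGroup W] [NormedSpace ℝ W]
  {M E : Type*} [TopologicalSpace M] [ChartedSpace V M] [IsManifold 𝓘(ℝ, V) ∞ M]
  [TopologicalSpace E] [ChartedSpace W E] [IsManifold 𝓘(ℝ, W) ∞ E]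

theorem isSmoothChart_chartAt (x : M) : IsSmoothChart 𝓘(ℝ, V) (chartAt V x) :=
  ⟨contMDiffOn_chart, contMDiffOn_chart_symm⟩

/-- The product of charts, as a divided chart. -/
noncomputable def prodChart (p : M × E) : DividedChart (𝓘(ℝ, V).prod 𝓘(ℝ, W)) (M × E) where
  toOpenPartialHomeomorph := (chartAt V p.1).prod (chartAt W p.2)
  contMDiffOn_to := by
    refine ContMDiffOn.prodMk_space ?_ ?_
    · exact (isSmoothChart_chartAt p.1).fwd.comp contMDiffOn_fst fun q hq => hq.1
    · exact (isSmoothChart_chartAt p.2).fwd.comp contMDiffOn_snd fun q hq => hq.2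
  contMDiffOn_inv := by
    refine ContMDiffOn.prodMk ?_ ?_
    · exact (isSmoothChart_chartAt p.1).inv.comp contDiff_fst.contMDiff.contMDiffOn
        fun q hq => hq.1
    · exact (isSmoothChart_chartAt p.2).inv.comp contDiff_snd.contMDiff.contMDiffOn
        fun q hq => hq.2

/-- The graph of a section in a product of charts. -/
theorem isGraphAt_section {U : Set M} {s : M → E} (hU : IsOpen U)
    (hs : ContMDiffOn 𝓘(ℝ, V) 𝓘(ℝ, W) ∞ s U) {m : M} (hm : m ∈ U) :
    IsGraphAt (prodChart (V := V) (W := W) (m, s m)) ((fun x => (x, s x)) '' U) (m, s m)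
      (fun x => chartAt W (s m) (s ((chartAt V m).symm x))) := by
  set e₁ := chartAt V m
  set e₂ := chartAt W (s m)
  have hm₁ : m ∈ e₁.source := mem_chart_source V m
  have hm₂ : s m ∈ e₂.source := mem_chart_source W (s m)
  have hcont : ContinuousAt s m := hs.continuousOn.continuousAt (hU.mem_nhds hm)
  have hev : ∀ᶠ x in 𝓝 m, x ∈ U ∧ x ∈ e₁.source ∧ s x ∈ e₂.source := by
    filter_upwards [hU.mem_nhds hm, e₁.open_source.mem_nhds hm₁,
      hcont.eventually_mem (e₂.open_source.mem_nhds hm₂)] with x h1 h2 h3 using ⟨h1, h2, h3⟩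
  obtain ⟨N, hN, hNo, hmN⟩ := eventually_nhds_iff.1 hev
  refine ⟨⟨hm₁, hm₂⟩, ⟨e₁.target ∩ e₁.symm ⁻¹' N, ?_, ?_⟩, ?_⟩
  · refine (e₁.symm.isOpen_inter_preimage hNo).mem_nhds ⟨e₁.map_source hm₁, ?_⟩
    change e₁.symm (e₁ m) ∈ N
    rw [e₁.left_inv hm₁]
    exact hmN
  · rw [← contMDiffOn_iff_contDiffOn]
    refine (isSmoothChart_chartAt (s m)).fwd.comp (t := e₂.source) (hs.comp (t := U)
      ((isSmoothChart_chartAt m).inv.mono inter_subset_left) fun x hx => (hN _ hx.2).1)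
      fun x hx => (hN _ hx.2).2.2
  · have h1 : ∀ᶠ q : M × E in 𝓝 (m, s m), q.1 ∈ N ∧ q.2 ∈ e₂.source := by
      refine (hNo.prod e₂.open_source).mem_nhds ⟨hmN, hm₂⟩
    filter_upwards [h1] with q ⟨hq1, hq2⟩
    have e : (e₁.symm (e₁ q.1)) = q.1 := e₁.left_inv (hN _ hq1).2.1
    change _ ↔ e₂ q.2 = e₂ (s (e₁.symm (e₁ q.1)))
    rw [e]
    constructor
    · rintro ⟨x, hx, rfl⟩
      rfl
    · intro h
      exact ⟨q.1, (hN _ hq1).1, Prod.ext rfl (e₂.injOn hq2 (hN _ hq1).2.2 h).symm⟩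

/-- A graph in a product of charts is the image of a section. -/
theorem graphSet_prodChart (p : M × E) {w : V → W} {U : Set V}
    (h : ∀ x ∈ U, (x, w x) ∈ (prodChart (V := V) (W := W) p).target) :
    graphSet (prodChart p) w U = (fun x => (x, (chartAt W p.2).symm (w (chartAt V p.1 x)))) ''
      ((chartAt V p.1).source ∩ chartAt V p.1 ⁻¹' U) := by
  ext ⟨x, y⟩
  constructor
  · rintro ⟨⟨h1, h2⟩, h3, h4⟩
    change chartAt W p.2 y = w (chartAt V p.1 x) at h4
    refine ⟨x, ⟨h1, h3⟩, Prod.ext rfl ?_⟩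
    change (chartAt W p.2).symm (w (chartAt V p.1 x)) = y
    rw [← h4]
    exact (chartAt W p.2).left_inv h2
  · rintro ⟨x', ⟨h1, h2⟩, h3⟩
    obtain ⟨rfl, rfl⟩ := Prod.mk.inj h3
    have h4 := (h _ h2).2
    refine ⟨⟨h1, (chartAt W p.2).map_target h4⟩, h2, ?_⟩
    exact (chartAt W p.2).right_inv h4

theorem contMDiffOn_section (p : M × E) {w : V → W} {U : Set V} (hw : ContDiffOn ℝ ∞ w U)
    (h : ∀ x ∈ U, (x, w x) ∈ (prodChart (V := V) (W := W) p).target) :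
    ContMDiffOn 𝓘(ℝ, V) 𝓘(ℝ, W) ∞ (fun x => (chartAt W p.2).symm (w (chartAt V p.1 x)))
      ((chartAt V p.1).source ∩ chartAt V p.1 ⁻¹' U) :=
  (isSmoothChart_chartAt p.2).inv.comp (t := (chartAt W p.2).target)
    (hw.contMDiffOn.comp (t := U) ((isSmoothChart_chartAt p.1).fwd.mono inter_subset_left)
      fun _ hx => hx.2) fun _ hx => (h _ hx.2).2

theorem isOpenClass_sectionClass [FiniteDimensional ℝ V] :
    IsOpenClass (𝓘(ℝ, V).prod 𝓘(ℝ, W)) (sectionClass 𝓘(ℝ, V) 𝓘(ℝ, W) M E) := by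
  refine isOpenClass_of_charts prodChart isOpen_univ ?_ ?_
  · rintro _ ⟨U, s, hU, hs, rfl⟩ _ ⟨m, hm, rfl⟩
    exact ⟨_, isGraphAt_section hU hs hm, mem_univ _⟩
  · intro p w U hU hw h
    refine ⟨_, _, (chartAt V p.1).isOpen_inter_preimage hU,
      contMDiffOn_section p hw fun x hx => (h x hx).1,
      graphSet_prodChart p fun x hx => (h x hx).1⟩

/-- Here `Q` is the set of injective linear maps, which is open because `V` is finite-dimensional.
The differentials of charts being injective, immersions are recognized by the derivative of their
expression in charts. -/
theorem isOpenClass_immersedSectionClass [FiniteDimensional ℝ V] :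
    IsOpenClass (𝓘(ℝ, V).prod 𝓘(ℝ, W)) (immersedSectionClass 𝓘(ℝ, V) 𝓘(ℝ, W) M E) := by
  refine isOpenClass_of_charts prodChart
    (ContinuousLinearMap.isOpen_injective (𝕜 := ℝ) (E := V) (F := W)) ?_ ?_
  · rintro _ ⟨U, s, hU, hs, hinj, rfl⟩ _ ⟨m, hm, rfl⟩
    refine ⟨_, isGraphAt_section hU hs hm, ?_⟩
    have d₁ := (isSmoothChart_chartAt (V := V) m).mdifferentiable
    have d₂ := (isSmoothChart_chartAt (V := W) (s m)).mdifferentiable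
    have hm₁ := mem_chart_source V m
    have hm₂ := mem_chart_source W (s m)
    have k1 := (d₁.mdifferentiableAt_symm ((chartAt V m).map_source hm₁)).hasMFDerivAt
    have el := (chartAt V m).left_inv hm₁
    have k2 : HasMFDerivAt 𝓘(ℝ, V) 𝓘(ℝ, W) s ((chartAt V m).symm (chartAt V m m))
        (mfderiv 𝓘(ℝ, V) 𝓘(ℝ, W) s ((chartAt V m).symm (chartAt V m m))) := by
      refine MDifferentiableAt.hasMFDerivAt ?_
      rw [el]
      exact (hs.contMDiffAt (hU.mem_nhds hm)).mdifferentiableAt (by simp)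
    have k3 : HasMFDerivAt 𝓘(ℝ, W) 𝓘(ℝ, W) (chartAt W (s m))
        (s ((chartAt V m).symm (chartAt V m m)))
        (mfderiv 𝓘(ℝ, W) 𝓘(ℝ, W) (chartAt W (s m)) (s ((chartAt V m).symm (chartAt V m m)))) := by
      refine MDifferentiableAt.hasMFDerivAt ?_
      rw [el]
      exact d₂.mdifferentiableAt hm₂
    have k4 := HasMFDerivAt.comp (g := chartAt W (s m))
      (f := fun x => s ((chartAt V m).symm x)) _ k3 (HasMFDerivAt.comp (g := s) _ k2 k1)
    have k5 := mfderiv_eq_fderiv.symm.trans k4.mfderiv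
    have i1 : Function.Injective (mfderiv 𝓘(ℝ, V) 𝓘(ℝ, V) (chartAt V m).symm (chartAt V m m)) :=
      d₁.symm.mfderiv_injective ((chartAt V m).map_source hm₁)
    have i2 : Function.Injective
        (mfderiv 𝓘(ℝ, V) 𝓘(ℝ, W) s ((chartAt V m).symm (chartAt V m m))) := by
      rw [el]; exact hinj m hm
    have i3 : Function.Injective (mfderiv 𝓘(ℝ, W) 𝓘(ℝ, W) (chartAt W (s m))
        (s ((chartAt V m).symm (chartAt V m m)))) := by
      rw [el]; exact d₂.mfderiv_injective hm₂
    have i4 := Function.Injective.comp i3 (Function.Injective.comp i2 i1)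
    refine (congrArg (fun T : V →L[ℝ] W => Function.Injective (T : V → W)) k5).mpr ?_
    exact i4
  · intro p w U hU hw h
    refine ⟨_, _, (chartAt V p.1).isOpen_inter_preimage hU,
      contMDiffOn_section p hw fun x hx => (h x hx).1, ?_,
      graphSet_prodChart p fun x hx => (h x hx).1⟩
    intro x hx
    have d₁ := (isSmoothChart_chartAt (V := V) p.1).mdifferentiable
    have d₂ := (isSmoothChart_chartAt (V := W) p.2).mdifferentiable
    have k1 := (d₁.mdifferentiableAt hx.1).hasMFDerivAt
    have k2 : HasMFDerivAt 𝓘(ℝ, V) 𝓘(ℝ, W) w (chartAt V p.1 x) (fderiv ℝ w (chartAt V p.1 x)) :=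
      ((hw.contDiffAt (hU.mem_nhds hx.2)).differentiableAt (by simp)).hasFDerivAt.hasMFDerivAt
    have k3 := (d₂.mdifferentiableAt_symm (h _ hx.2).1.2).hasMFDerivAt
    have k4 := (k3.comp x (k2.comp x k1)).mfderiv
    have i1 := d₁.mfderiv_injective hx.1
    have i3 := d₂.symm.mfderiv_injective (h _ hx.2).1.2
    have i4 := Function.Injective.comp i3 (Function.Injective.comp (h _ hx.2).2 i1)
    refine (congrArg (fun T : V →L[ℝ] W => Function.Injective (T : V → W)) k4).mpr ?_
    exact i4

end Sections

end GeodesicJets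

namespace GeodesicJets

/-! ### Christoffel forms of smooth torsion-free connections -/

section Smoothness

variable {B : Type*} [NormedAddCommGroup B] [NormedSpace ℝ B]
  {H : Type*} [TopologicalSpace H] {I : ModelWithCorners ℝ B H}
  {F : Type*} [TopologicalSpace F] [ChartedSpace H F]

theorem chartDinv_sum {ι : Type*} {e : OpenPartialHomeomorph F B} (s : Finset ι) (q : F)
    (v : ι → B) : chartDinv I e q (∑ i ∈ s, v i) = ∑ i ∈ s, chartDinv I e q (v i) :=
  map_sum (mfderiv 𝓘(ℝ, B) I e.symm (e q)) v s

theorem chartD_sum {ι : Type*} {e : OpenPartialHomeomorph F B} (s : Finset ι) (q : F)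
    (v : ι → TangentSpace I q) : chartD I e q (∑ i ∈ s, v i) = ∑ i ∈ s, chartD I e q (v i) :=
  map_sum (mfderiv I 𝓘(ℝ, B) e q) v s

theorem mvfderiv_comp_chart {e : OpenPartialHomeomorph F B} (he : IsSmoothChart I e) {q : F}
    (hq : q ∈ e.source) {g : B → ℝ} (hg : DifferentiableAt ℝ g (e q)) (X : TangentSpace I q) :
    mvfderiv I (fun x => g (e x)) q X = fderiv ℝ g (e q) (chartD I e q X) := by
  have h1 := (he.mdifferentiable.mdifferentiableAt hq).hasMFDerivAt
  have h2 := HasMFDerivAt.comp (g := g) q hg.hasFDerivAt.hasMFDerivAt h1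
  exact congrArg (fun T : TangentSpace I q →L[ℝ] ℝ => T X) h2.mfderiv

variable [IsManifold I ∞ F] {nabla : LinearConnection I F}

theorem LinearConnection.congr_of_eventuallyEq {Y Y' : (q : F) → TangentSpace I q} {p : F}
    (hY : IsSmoothFieldAt Y p) (h : ∀ᶠ q in 𝓝 p, Y q = Y' q) : nabla Y p = nabla Y' p := by
  have hY' : IsSmoothFieldAt Y' p :=
    ContMDiffAt.congr_of_eventuallyEq hY
      (h.mono fun q hq => Bundle.TotalSpace.ext rfl (heq_of_eq hq.symm))
  exact nabla.isCovariantDerivativeOn.congr_of_eventuallyEq (s := univ)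
    hY.mdifferentiableAt hY'.mdifferentiableAt univ_mem h

/-- Covariant derivatives of smooth fields along smooth fields are smooth. -/
theorem isSmoothFieldAt_nabla [FiniteDimensional ℝ B] [T2Space F]
    (hn : CovariantDerivative.ContMDiffCovariantDerivative nabla ∞)
    {Y A : (q : F) → TangentSpace I q} {p : F} (hY : ∀ᶠ q in 𝓝 p, IsSmoothFieldAt Y q)
    (hA : IsSmoothFieldAt A p) : IsSmoothFieldAt (fun q => nabla Y q (A q)) p := by
  obtain ⟨N, hN, hNo, hpN⟩ := eventually_nhds_iff.1 hY
  -- Smoothness of the connection is applied to a globally smooth field; a bump function supported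
  -- where `Y` is smooth makes it global without changing its germ at `p`.
  obtain ⟨f, -, hf⟩ := (SmoothBumpFunction.nhds_basis_tsupport (I := I) p).mem_iff.1
    (hNo.mem_nhds hpN)
  have hYN : ContMDiffOn I I.tangent ∞ (fun q => (⟨q, Y q⟩ : TangentBundle I F)) N :=
    fun q hq => (hN q hq).contMDiffWithinAt
  have h1 : ContMDiff I I.tangent ∞
      (fun q => (⟨q, ((f : F → ℝ) • Y) q⟩ : TangentBundle I F)) :=
    ContMDiffOn.smul_section_of_tsupport f.contMDiff.contMDiffOn hNo hf hYN
  have h2 := hn.contMDiff.contMDiff (σ := (f : F → ℝ) • Y) h1.contMDiffOn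
  have h3 := h2.contMDiffAt (x := p) univ_mem
  have h4 := ContMDiffAt.clm_bundle_apply (b := id) h3 hA
  refine ContMDiffAt.congr_of_eventuallyEq h4 ?_
  filter_upwards [f.eventuallyEq_one.eventually_nhds, hY] with q hq hYq
  refine Bundle.TotalSpace.ext rfl (heq_of_eq ?_)
  refine congrArg (fun T => T (A q)) (LinearConnection.congr_of_eventuallyEq hYq ?_)
  filter_upwards [hq] with x hx
  change Y x = f x • Y x
  rw [hx]
  exact (one_smul ℝ (Y x)).symm

theorem LinearConnection.sum_smul {ι : Type*} (s : Finset ι) {p : F} (g : ι → F → ℝ)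
    (Z : ι → (q : F) → TangentSpace I q) (hg : ∀ i, MDifferentiableAt I 𝓘(ℝ, ℝ) (g i) p)
    (hZ : ∀ i, IsSmoothFieldAt (Z i) p) (X : TangentSpace I p) :
    nabla (fun q => ∑ i ∈ s, g i q • Z i q) p X =
      ∑ i ∈ s, (g i p • nabla (Z i) p X + (mvfderiv I (g i) p X) • Z i p) := by
  classical
  have hgZ (i : ι) : MDifferentiableAt I I.tangent
      (fun q => (⟨q, g i q • Z i q⟩ : TangentBundle I F)) p :=
    MDifferentiableAt.smul_section (hg i) (hZ i).mdifferentiableAt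
  induction s using Finset.induction_on with
  | empty =>
    have h := nabla.isCovariantDerivativeOn.zero (s := univ) (x := p)
    simp only [Finset.sum_empty]
    exact congrArg (fun T => T X) h
  | insert i s hi ih =>
    have h1 := nabla.isCovariantDerivativeOn.add (s := univ) (hgZ i)
      (MDifferentiableAt.sum_section fun j (_ : j ∈ s) => hgZ j)
    have h2 := nabla.isCovariantDerivativeOn.leibniz (s := univ) (hZ i).mdifferentiableAt (hg i)
    have e : (fun q => ∑ j ∈ insert i s, g j q • Z j q) =
        (fun q => g i q • Z i q) + fun q => ∑ j ∈ s, g j q • Z j q := by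
      funext q; exact Finset.sum_insert hi
    rw [e, Finset.sum_insert hi, ← ih]
    have h3 := congrArg (fun T => T X) h1
    have h4 := congrArg (fun T => T X) h2
    exact h3.trans (congrArg₂ (· + ·) h4 rfl)

/-- The Lie bracket of vector fields in a chart. -/
theorem chartD_mlieBracket [CompleteSpace B] {e : OpenPartialHomeomorph F B}
    (he : IsSmoothChart I e) {q : F} (hq : q ∈ e.source) {X Y : (q : F) → TangentSpace I q}
    (hX : IsSmoothFieldAt X q) (hY : IsSmoothFieldAt Y q) :
    chartD I e q (VectorField.mlieBracket I X Y q) =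
      fderiv ℝ (chartField I e Y) (e q) (chartD I e q (X q)) -
        fderiv ℝ (chartField I e X) (e q) (chartD I e q (Y q)) := by
  have hinv {x : F} (hx : x ∈ e.source) (c : B) :
      (mfderiv I 𝓘(ℝ, B) e x).inverse c = chartDinv I e x c :=
    congrArg (fun T => T c)
      (ContinuousLinearMap.inverse_equiv (he.mdifferentiable.mfderiv hx))
  let Z (Y : (q : F) → TangentSpace I q) : (z : B) → TangentSpace 𝓘(ℝ, B) z := chartField I e Y
  -- Near `q` each field is the pull-back of its expression in the chart, and the bracket commutes
  -- with pull-back.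
  have hev (Y : (q : F) → TangentSpace I q) : Y =ᶠ[𝓝 q]
      VectorField.mpullback I 𝓘(ℝ, B) e (Z Y) := by
    filter_upwards [e.open_source.mem_nhds hq] with x hx
    exact (pullField_chartField he hx Y).symm.trans (hinv hx _).symm
  have hm : IsManifold I (minSmoothness ℝ 2) F := by
    rw [minSmoothness_of_isRCLikeNormedField]
    exact IsManifold.of_le (n := ∞) (WithTop.coe_le_coe.2 (le_top (a := (2 : ℕ∞))))
  have hc {Y : (q : F) → TangentSpace I q} (hY : IsSmoothFieldAt Y q) :
      MDifferentiableAt 𝓘(ℝ, B) 𝓘(ℝ, B).tangent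
        (fun z => (⟨z, Z Y z⟩ : TangentBundle 𝓘(ℝ, B) B)) (e q) :=
    ((contMDiffAt_vectorSpace_iff_contDiffAt (n := ∞) (V := Z Y)).2
      (contDiffAt_chartField he hq hY)).mdifferentiableAt (by simp)
  rw [(hev X).mlieBracket_vectorField_eq (hev Y)]
  have h := VectorField.mpullback_mlieBracket (I := I) (I' := 𝓘(ℝ, B)) (f := e) (x₀ := q) (n := ∞)
    (V := Z X) (W := Z Y) (hc hX) (hc hY)
    (he.fwd.contMDiffAt (e.open_source.mem_nhds hq))
    (by rw [minSmoothness_of_isRCLikeNormedField]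
        exact WithTop.coe_le_coe.2 (le_top (a := (2 : ℕ∞))))
  rw [← h]
  refine (congrArg (chartD I e q) (hinv hq _)).trans ((chartD_chartDinv he hq _).trans ?_)
  refine (congrFun (VectorField.mlieBracketWithin_univ (V := Z X) (W := Z Y)) (e q)).symm.trans ?_
  refine (congrFun VectorField.mlieBracketWithin_eq_lieBracketWithin (e q)).trans ?_
  rw [← chartField_apply hq X, ← chartField_apply hq Y]
  refine (congrFun (VectorField.lieBracketWithin_univ (𝕜 := ℝ) (V := chartField I e X)
    (W := chartField I e Y)) (e q)).trans rfl

variable (nabla) in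
/-- A smooth torsion-free connection, in terms of germs of smooth vector fields. -/
structure IsSmoothTorsionFree : Prop where
  smooth : ∀ {Y A : (q : F) → TangentSpace I q} {p : F}, (∀ᶠ q in 𝓝 p, IsSmoothFieldAt Y q) →
    IsSmoothFieldAt A p → IsSmoothFieldAt (fun q => nabla Y q (A q)) p
  torsion : ∀ {X Y : (q : F) → TangentSpace I q} {p : F}, IsSmoothFieldAt X p →
    IsSmoothFieldAt Y p →
      nabla Y p (X p) - nabla X p (Y p) = VectorField.mlieBracket I X Y p

theorem isSmoothTorsionFree_of_torsion_eq_zero [FiniteDimensional ℝ B] [T2Space F]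
    (hn : CovariantDerivative.ContMDiffCovariantDerivative nabla ∞) (ht : nabla.torsion = 0) :
    IsSmoothTorsionFree nabla :=
  ⟨isSmoothFieldAt_nabla hn, fun hX hY => (CovariantDerivative.torsion_eq_zero_iff nabla).1 ht
    hX.mdifferentiableAt hY.mdifferentiableAt⟩

/-- A connection with smooth symmetric Christoffel forms in suitable charts is smooth and
torsion-free. -/
theorem isSmoothTorsionFree_of_hasChristoffel [CompleteSpace B]
    (h : ∀ p : F, ∃ (e : OpenPartialHomeomorph F B) (C : B → B →L[ℝ] B →L[ℝ] B),
      p ∈ e.source ∧ IsSmoothChart I e ∧ HasChristoffel nabla e C) : IsSmoothTorsionFree nabla := by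
  refine ⟨fun {Y A p} hY hA => ?_, fun {X Y p} hX hY => ?_⟩ <;>
    obtain ⟨e, C, hp, he, hC⟩ := h p
  · have h1 := contDiffAt_chartField he hp hY.self_of_nhds
    have h2 := contDiffAt_chartField he hp hA
    have h3 := hC.smooth.contDiffAt (e.open_target.mem_nhds (e.map_source hp))
    have h4 : ContDiffAt ℝ ∞ (fun z => fderiv ℝ (chartField I e Y) z (chartField I e A z) +
        C z (chartField I e A z) (chartField I e Y z)) (e p) :=
      ((h1.fderiv_right (m := ∞) (by norm_cast)).clm_apply h2).add
        ((h3.clm_apply h2).clm_apply h1)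
    refine ContMDiffAt.congr_of_eventuallyEq (isSmoothFieldAt_pullField he hp h4) ?_
    filter_upwards [hY, e.open_source.mem_nhds hp] with q hq hs
    refine Bundle.TotalSpace.ext rfl (heq_of_eq (chartD_injective he hs ?_))
    rw [hC.eq q hs Y hq, chartD_pullField he hs, chartField_apply hs, chartField_apply hs]
  · refine chartD_injective he hp ?_
    rw [chartD_sub, hC.eq p hp Y hY, hC.eq p hp X hX, chartD_mlieBracket he hp hX hY,
      hC.symm _ (e.map_source hp)]
    abel

variable (nabla) in
/-- The covariant derivative of the field with constant expression `c` in a chart. -/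
noncomputable def coordNabla [FiniteDimensional ℝ B] (e : OpenPartialHomeomorph F B) (c : B)
    (z : B) : B →L[ℝ] B :=
  LinearMap.toContinuousLinearMap
    { toFun := fun a => chartD I e (e.symm z)
        (nabla (pullField I e fun _ => c) (e.symm z) (chartDinv I e (e.symm z) a))
      map_add' := fun a b => by
        rw [chartDinv_add, map_add, chartD_add]
      map_smul' := fun t a => by
        rw [chartDinv_smul, map_smul, chartD_smul]; rfl }

theorem coordNabla_apply [FiniteDimensional ℝ B] {e : OpenPartialHomeomorph F B} {q : F}
    (hq : q ∈ e.source) (c a : B) : coordNabla nabla e c (e q) a =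
      chartD I e q (nabla (pullField I e fun _ => c) q (chartDinv I e q a)) :=
  chartField_apply hq fun q => nabla (pullField I e fun _ => c) q (chartDinv I e q a)

theorem contDiffOn_coordNabla [FiniteDimensional ℝ B] (hn : IsSmoothTorsionFree nabla)
    {e : OpenPartialHomeomorph F B} (he : IsSmoothChart I e) (c a : B) :
    ContDiffOn ℝ ∞ (fun z => coordNabla nabla e c z a) e.target := by
  intro z hz
  have hs := e.map_target hz
  have h1 : ∀ᶠ q in 𝓝 (e.symm z), IsSmoothFieldAt (pullField I e fun _ => c) q := by
    filter_upwards [e.open_source.mem_nhds hs] with q hq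
    exact isSmoothFieldAt_pullField he hq contDiffAt_const
  have h2 := contDiffAt_chartField he hs
    (hn.smooth h1 (isSmoothFieldAt_pullField he hs (contDiffAt_const (c := a))))
  rw [e.right_inv hz] at h2
  exact h2.contDiffWithinAt

/-- A smooth torsion-free connection has smooth symmetric Christoffel forms. -/
theorem exists_hasChristoffel [FiniteDimensional ℝ B] (hn : IsSmoothTorsionFree nabla)
    {e : OpenPartialHomeomorph F B} (he : IsSmoothChart I e) :
    ∃ C, HasChristoffel nabla e C := by
  let b := Module.finBasis ℝ B
  -- The second argument is expanded in a basis; the coefficients are the covariant derivatives of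
  -- the fields with constant expression in the chart.
  let C (z : B) : B →L[ℝ] B →L[ℝ] B := ∑ i,
    ((b.coord i).toContinuousLinearMap.smulRight (coordNabla nabla e (b i) z)).flip
  have hC (z x y : B) : C z x y = ∑ i, b.repr y i • coordNabla nabla e (b i) z x := by
    simp [C, sum_apply]
  have heq : ∀ q ∈ e.source, ChristoffelAt nabla e q (C (e q)) := by
    intro q hq Y hY X
    set y := chartField I e Y with hy
    have hys := contDiffAt_chartField he hq hY
    have hg (i) : DifferentiableAt ℝ (fun z => b.coord i (y z)) (e q) :=
      ((b.coord i).toContinuousLinearMap.differentiableAt).comp (e q)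
        (hys.differentiableAt (by simp))
    have h1 : nabla Y q = nabla (fun x => ∑ i, b.coord i (y (e x)) •
        pullField I e (fun _ => b i) x) q := by
      refine LinearConnection.congr_of_eventuallyEq hY ?_
      filter_upwards [e.open_source.mem_nhds hq] with x hx
      rw [← pullField_chartField he hx Y, ← hy, pullField]
      conv_lhs => rw [← b.sum_repr (y (e x)), chartDinv_sum]
      simp only [chartDinv_smul]
      rfl
    have h2 := LinearConnection.sum_smul (nabla := nabla) Finset.univ
      (fun i x => b.coord i (y (e x))) (fun i => pullField I e fun _ => b i)
      (fun i => MDifferentiableAt.comp (g := fun z => b.coord i (y z)) q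
        (hg i).mdifferentiableAt (he.mdifferentiable.mdifferentiableAt hq))
      (fun i => isSmoothFieldAt_pullField he hq contDiffAt_const) X
    rw [h1, h2, chartD_sum, hC, ← b.sum_repr (fderiv ℝ y (e q) (chartD I e q X)),
      ← Finset.sum_add_distrib]
    refine Finset.sum_congr rfl fun i _ => ?_
    rw [chartD_add, chartD_smul, chartD_smul, chartD_pullField he hq, coordNabla_apply hq,
      chartDinv_chartD he hq, mvfderiv_comp_chart he hq (hg i), hy, chartField_apply hq, add_comm]
    refine congrArg₂ (· + ·) (congrArg (· • b i) ?_) rfl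
    have h3 := ((b.coord i).toContinuousLinearMap.hasFDerivAt).comp (e q)
      (hys.differentiableAt (by simp)).hasFDerivAt
    exact congrArg (fun T : B →L[ℝ] ℝ => T (chartD I e q X)) h3.fderiv
  have h0 {z : B} (hz : z ∈ e.target) (c : B) :
      chartField I e (pullField I e fun _ => c) =ᶠ[𝓝 z] fun _ => c := by
    filter_upwards [e.open_target.mem_nhds hz] with w hw
    exact chartField_pullField he hw _
  refine ⟨C, ?_, ?_, heq⟩
  · refine contDiffOn_clm_apply.2 fun x => contDiffOn_clm_apply.2 fun y => ?_
    simp only [hC]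
    exact ContDiffOn.sum fun i _ => contDiffOn_const.smul (contDiffOn_coordNabla hn he _ _)
  · intro z hz x y
    have hs := e.map_target hz
    have hsm (c : B) : IsSmoothFieldAt (pullField I e fun _ => c) (e.symm z) :=
      isSmoothFieldAt_pullField he hs contDiffAt_const
    -- On fields with constant expression the derivative term vanishes and so does their bracket,
    -- hence symmetry of `C` is exactly vanishing of the torsion on them.
    have key (a c : B) : C z a c = chartD I e (e.symm z)
        (nabla (pullField I e fun _ => c) (e.symm z) (pullField I e (fun _ => a) (e.symm z))) := by
      have h := heq _ hs _ (hsm c) (pullField I e (fun _ => a) (e.symm z))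
      rw [e.right_inv hz, (h0 hz c).fderiv_eq, chartD_pullField he hs, chartD_pullField he hs] at h
      simpa using h.symm
    rw [key, key, ← sub_eq_zero, ← chartD_sub, hn.torsion (hsm x) (hsm y),
      chartD_mlieBracket he hs (hsm x) (hsm y), e.right_inv hz, (h0 hz x).fderiv_eq,
      (h0 hz y).fderiv_eq]
    simp

end Smoothness
end GeodesicJets

namespace GeodesicJets

/-! ### The direct sum of two connections -/

section ProductCharts

variable {V₁ V₂ : Type*} [NormedAddCommGroup V₁] [NormedSpace ℝ V₁]
  [NormedAddCommGroup V₂] [NormedSpace ℝ V₂]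
  {H₁ H₂ : Type*} [TopologicalSpace H₁] [TopologicalSpace H₂]
  {I₁ : ModelWithCorners ℝ V₁ H₁} {I₂ : ModelWithCorners ℝ V₂ H₂}
  {M E : Type*} [TopologicalSpace M] [ChartedSpace H₁ M]
  [TopologicalSpace E] [ChartedSpace H₂ E]
  {e₁ : OpenPartialHomeomorph M V₁} {e₂ : OpenPartialHomeomorph E V₂}

theorem chartD_prod (h₁ : IsSmoothChart I₁ e₁) (h₂ : IsSmoothChart I₂ e₂) {q : M × E}
    (hq : q ∈ (e₁.prod e₂).source) (X : TangentSpace (I₁.prod I₂) q) :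
    chartD (I₁.prod I₂) (e₁.prod e₂) q X = (chartD I₁ e₁ q.1 X.1, chartD I₂ e₂ q.2 X.2) := by
  have k1 := HasMFDerivAt.comp (g := e₁) q
    (h₁.mdifferentiable.mdifferentiableAt hq.1).hasMFDerivAt (hasMFDerivAt_fst (I := I₁) (I' := I₂) q)
  have k2 := HasMFDerivAt.comp (g := e₂) q
    (h₂.mdifferentiable.mdifferentiableAt hq.2).hasMFDerivAt (hasMFDerivAt_snd (I := I₁) (I' := I₂) q)
  have k3 : HasMFDerivAt (I₁.prod I₂) 𝓘(ℝ, V₁ × V₂) (e₁.prod e₂) q _ :=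
    ⟨k1.1.prodMk k2.1, k1.2.prodMk k2.2⟩
  exact congrArg (fun T : V₁ × V₂ →L[ℝ] V₁ × V₂ => T X) k3.mfderiv

/-- The derivative of a function with values in a fixed tangent space, in charts. -/
theorem chartD_mvfderiv (h₂ : IsSmoothChart I₂ e₂) {x : M} {y : E}
    (hy : y ∈ e₂.source) {v : E → TangentSpace I₁ x} {w : V₂ → V₁}
    (hv : MDifferentiableAt I₂ 𝓘(ℝ, V₁) (M' := V₁) v y) (hw : DifferentiableAt ℝ w (e₂ y))
    (h : ∀ᶠ t in 𝓝 y, chartD I₁ e₁ x (v t) = w (e₂ t)) (b : TangentSpace I₂ y) :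
    chartD I₁ e₁ x (mvfderiv I₂ (F := V₁) v y b) = fderiv ℝ w (e₂ y) (chartD I₂ e₂ y b) := by
  let T : V₁ →L[ℝ] V₁ := mfderiv I₁ 𝓘(ℝ, V₁) e₁ x
  have k1 := HasMFDerivAt.comp (g := T) y (T.hasFDerivAt (x := v y)).hasMFDerivAt hv.hasMFDerivAt
  have k2 := HasMFDerivAt.comp (g := w) y hw.hasFDerivAt.hasMFDerivAt
    (h₂.mdifferentiable.mdifferentiableAt hy).hasMFDerivAt
  have k3 := hasMFDerivAt_unique k1 (k2.congr_of_eventuallyEq h)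
  exact congrArg (fun T : V₂ →L[ℝ] V₁ => T b) k3

variable [IsManifold I₁ ∞ M] [IsManifold I₂ ∞ E]

theorem IsSmoothFieldAt.slice_left {Y : (q : M × E) → TangentSpace (I₁.prod I₂) q} {p : M × E}
    (hY : IsSmoothFieldAt Y p) :
    IsSmoothFieldAt (I := I₁) (fun x => (Y (x, p.2)).1) p.1 := by
  have h : ContMDiff (I₁.prod I₂).tangent I₁.tangent ∞
      (tangentMap (I₁.prod I₂) I₁ (Prod.fst : M × E → M)) :=
    (contMDiff_fst (n := ∞)).contMDiff_tangentMap le_rfl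
  have h2 : ContMDiffAt I₁ (I₁.prod I₂) ∞ (fun x => (x, p.2)) p.1 :=
    contMDiffAt_id.prodMk contMDiffAt_const
  refine ContMDiffAt.congr_of_eventuallyEq (ContMDiffAt.comp p.1 (h _) (ContMDiffAt.comp
    (g := fun q => (⟨q, Y q⟩ : TangentBundle (I₁.prod I₂) (M × E))) (f := fun x => (x, p.2)) p.1 hY h2)) ?_
  refine Eventually.of_forall fun q => ?_
  simp [tangentMap, mfderiv_fst]
  rfl

theorem IsSmoothFieldAt.slice_right {Y : (q : M × E) → TangentSpace (I₁.prod I₂) q} {p : M × E}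
    (hY : IsSmoothFieldAt Y p) :
    IsSmoothFieldAt (I := I₂) (fun x => (Y (p.1, x)).2) p.2 := by
  have h : ContMDiff (I₁.prod I₂).tangent I₂.tangent ∞
      (tangentMap (I₁.prod I₂) I₂ (Prod.snd : M × E → E)) :=
    (contMDiff_snd (n := ∞)).contMDiff_tangentMap le_rfl
  have h2 : ContMDiffAt I₂ (I₁.prod I₂) ∞ (fun x => (p.1, x)) p.2 :=
    contMDiffAt_const.prodMk contMDiffAt_id
  refine ContMDiffAt.congr_of_eventuallyEq (ContMDiffAt.comp p.2 (h _) (ContMDiffAt.comp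
    (g := fun q => (⟨q, Y q⟩ : TangentBundle (I₁.prod I₂) (M × E))) (f := fun x => (p.1, x)) p.2 hY h2)) ?_
  refine Eventually.of_forall fun q => ?_
  simp [tangentMap, mfderiv_snd]
  rfl

/-- The Christoffel form of a direct sum. -/
noncomputable def prodForm (c₁ : V₁ →L[ℝ] V₁ →L[ℝ] V₁) (c₂ : V₂ →L[ℝ] V₂ →L[ℝ] V₂) :
    V₁ × V₂ →L[ℝ] V₁ × V₂ →L[ℝ] V₁ × V₂ :=
  (ContinuousLinearMap.compL ℝ _ _ _ (ContinuousLinearMap.inl ℝ V₁ V₂)).comp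
      (c₁.bilinearComp (ContinuousLinearMap.fst ℝ V₁ V₂) (ContinuousLinearMap.fst ℝ V₁ V₂)) +
    (ContinuousLinearMap.compL ℝ _ _ _ (ContinuousLinearMap.inr ℝ V₁ V₂)).comp
      (c₂.bilinearComp (ContinuousLinearMap.snd ℝ V₁ V₂) (ContinuousLinearMap.snd ℝ V₁ V₂))

theorem prodForm_apply (c₁ : V₁ →L[ℝ] V₁ →L[ℝ] V₁) (c₂ : V₂ →L[ℝ] V₂ →L[ℝ] V₂) (a b : V₁ × V₂) :
    prodForm c₁ c₂ a b = (c₁ a.1 b.1, c₂ a.2 b.2) := by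
  simp [prodForm]

/-- In a product chart the mixed terms of the direct sum are plain partial derivatives (`m1`, `m2`),
so Christoffel terms occur only in the two diagonal blocks (`n1`, `n2`), and the four partial
derivatives add up to the derivative of the field. -/
theorem hasChristoffel_prodConnection [FiniteDimensional ℝ V₁] [FiniteDimensional ℝ V₂]
    {Θ : LinearConnection I₁ M} {Γ : LinearConnection I₂ E}
    {C₁ : V₁ → V₁ →L[ℝ] V₁ →L[ℝ] V₁} {C₂ : V₂ → V₂ →L[ℝ] V₂ →L[ℝ] V₂}
    (he : IsSmoothChart (I₁.prod I₂) (e₁.prod e₂))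
    (h₁ : IsSmoothChart I₁ e₁) (h₂ : IsSmoothChart I₂ e₂)
    (hC₁ : HasChristoffel Θ e₁ C₁) (hC₂ : HasChristoffel Γ e₂ C₂) :
    HasChristoffel (prodConnection Θ Γ) (e₁.prod e₂) (fun z => prodForm (C₁ z.1) (C₂ z.2)) where
  smooth := by
    refine contDiffOn_clm_apply.2 fun a => contDiffOn_clm_apply.2 fun b => ?_
    simp only [prodForm_apply]
    exact ((((hC₁.smooth.comp contDiffOn_fst fun z hz => hz.1).clm_apply
      contDiffOn_const).clm_apply contDiffOn_const)).prodMk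
        (((hC₂.smooth.comp contDiffOn_snd fun z hz => hz.2).clm_apply
          contDiffOn_const).clm_apply contDiffOn_const)
  symm z hz a b := by
    rw [prodForm_apply, prodForm_apply, hC₁.symm _ hz.1, hC₂.symm _ hz.2]
  eq q hq Y hY X := by
    set e := e₁.prod e₂
    set y := chartField (I₁.prod I₂) e Y
    have hy : HasFDerivAt y (fderiv ℝ y (e q)) (e₁ q.1, e₂ q.2) :=
      ((contDiffAt_chartField he hq hY).differentiableAt (by simp)).hasFDerivAt
    have hl : HasFDerivAt (fun x => y (x, e₂ q.2))
        ((fderiv ℝ y (e q)).comp (ContinuousLinearMap.inl ℝ V₁ V₂)) (e₁ q.1) :=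
      HasFDerivAt.comp (g := y) (f := fun x => (x, e₂ q.2)) (e₁ q.1) hy
        (hasFDerivAt_prodMk_left (e₁ q.1) (e₂ q.2))
    have hr : HasFDerivAt (fun x => y (e₁ q.1, x))
        ((fderiv ℝ y (e q)).comp (ContinuousLinearMap.inr ℝ V₁ V₂)) (e₂ q.2) :=
      HasFDerivAt.comp (g := y) (f := fun x => (e₁ q.1, x)) (e₂ q.2) hy
        (hasFDerivAt_prodMk_right (e₁ q.1) (e₂ q.2))
    have hyq {t : M × E} (ht : t ∈ e.source) :
        y (e₁ t.1, e₂ t.2) = (chartD I₁ e₁ t.1 (Y t).1, chartD I₂ e₂ t.2 (Y t).2) :=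
      (chartField_apply ht Y).trans (chartD_prod h₁ h₂ ht _)
    have el : chartField I₁ e₁ (fun x => (Y (x, q.2)).1) =ᶠ[𝓝 (e₁ q.1)]
        fun x => (y (x, e₂ q.2)).1 := by
      filter_upwards [e₁.open_target.mem_nhds (e₁.map_source hq.1)] with x hx
      exact (congrArg Prod.fst (hyq (t := (e₁.symm x, q.2)) ⟨e₁.map_target hx, hq.2⟩)).symm.trans
        (congrArg (fun t => (y (t, e₂ q.2)).1) (e₁.right_inv hx))
    have er : chartField I₂ e₂ (fun x => (Y (q.1, x)).2) =ᶠ[𝓝 (e₂ q.2)]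
        fun x => (y (e₁ q.1, x)).2 := by
      filter_upwards [e₂.open_target.mem_nhds (e₂.map_source hq.2)] with x hx
      exact (congrArg Prod.snd (hyq (t := (q.1, e₂.symm x)) ⟨hq.1, e₂.map_target hx⟩)).symm.trans
        (congrArg (fun t => (y (e₁ q.1, t)).2) (e₂.right_inv hx))
    have m1 := chartD_mvfderiv (e₁ := e₁) h₂ (x := q.1) hq.2
      (mdiff_slice_fst_right hY.mdifferentiableAt) hr.fst.differentiableAt (by
        filter_upwards [e₂.open_source.mem_nhds hq.2] with t ht
        exact (congrArg Prod.fst (hyq (t := (q.1, t)) ⟨hq.1, ht⟩)).symm) X.2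
    have m2 := chartD_mvfderiv (e₁ := e₂) h₁ (x := q.2) hq.1
      (mdiff_slice_snd_left hY.mdifferentiableAt) hl.snd.differentiableAt (by
        filter_upwards [e₁.open_source.mem_nhds hq.1] with t ht
        exact (congrArg Prod.snd (hyq (t := (t, q.2)) ⟨ht, hq.2⟩)).symm) X.1
    have n1 := hC₁.eq q.1 hq.1 _ hY.slice_left X.1
    have n2 := hC₂.eq q.2 hq.2 _ hY.slice_right X.2
    rw [el.fderiv_eq, hl.fst.fderiv] at n1
    rw [er.fderiv_eq, hr.snd.fderiv] at n2
    rw [hr.fst.fderiv] at m1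
    rw [hl.snd.fderiv] at m2
    have hL (α : V₁) (β : V₂) : fderiv ℝ y (e q) (α, β) =
        fderiv ℝ y (e q) (α, 0) + fderiv ℝ y (e q) (0, β) := by
      rw [← map_add]; simp
    rw [chartD_prod h₁ h₂ hq, chartD_prod h₁ h₂ hq, chartD_prod h₁ h₂ hq, prodForm_apply, hL]
    refine Prod.ext ?_ ?_
    · refine (chartD_add (I := I₁) (e := e₁) q.1 _ _).trans ((congrArg₂ (· + ·) n1 m1).trans ?_)
      exact add_right_comm _ _ _
    · refine (chartD_add (I := I₂) (e := e₂) q.2 _ _).trans ((congrArg₂ (· + ·) m2 n2).trans ?_)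
      exact (add_assoc _ _ _).symm

end ProductCharts
-- Christoffel forms of the direct sum are computed in product charts, but they are required in
-- every divided chart of `M × E`. Being smooth and torsion-free makes no reference to charts and
-- serves as the bridge: it is deduced from product charts and gives back forms in all charts.
theorem isSmoothTorsionFree_prodConnection {V W : Type*} [NormedAddCommGroup V] [NormedSpace ℝ V]
    [FiniteDimensional ℝ V] [NormedAddCommGroup W] [NormedSpace ℝ W] [FiniteDimensional ℝ W]
    {M E : Type*} [TopologicalSpace M] [ChartedSpace V M] [IsManifold 𝓘(ℝ, V) ∞ M]
    [TopologicalSpace E] [ChartedSpace W E] [IsManifold 𝓘(ℝ, W) ∞ E]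
    {Θ : LinearConnection 𝓘(ℝ, V) M} {Γ : LinearConnection 𝓘(ℝ, W) E}
    (hΘ : IsSmoothTorsionFree Θ) (hΓ : IsSmoothTorsionFree Γ) :
    IsSmoothTorsionFree (prodConnection Θ Γ) := by
  have : CompleteSpace (V × W) := FiniteDimensional.complete ℝ (V × W)
  refine isSmoothTorsionFree_of_hasChristoffel fun p => ?_
  have h₁ := isSmoothChart_chartAt (V := V) p.1
  have h₂ := isSmoothChart_chartAt (V := W) p.2
  obtain ⟨C₁, hC₁⟩ := exists_hasChristoffel hΘ h₁
  obtain ⟨C₂, hC₂⟩ := exists_hasChristoffel hΓ h₂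
  have he := (prodChart (V := V) (W := W) p).isSmoothChart
  exact ⟨(chartAt V p.1).prod (chartAt W p.2), _, ⟨mem_chart_source V p.1, mem_chart_source W p.2⟩, he,
    hasChristoffel_prodConnection he h₁ h₂ hC₁ hC₂⟩

end GeodesicJets

/-! ### The theorem in the three situations -/

theorem mainTheorem7 (n m : ℕ)
    {E : Type*} [TopologicalSpace E] [T2Space E] [SecondCountableTopology E]
    [ChartedSpace (EuclideanSpace ℝ (Fin n) × EuclideanSpace ℝ (Fin m)) E]
    [IsManifold 𝓘(ℝ, EuclideanSpace ℝ (Fin n) × EuclideanSpace ℝ (Fin m)) ∞ E]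
    (Γ : GeodesicJets.LinearConnection
      𝓘(ℝ, EuclideanSpace ℝ (Fin n) × EuclideanSpace ℝ (Fin m)) E)
    (hΓ : CovariantDerivative.ContMDiffCovariantDerivative Γ ∞)
    (hΓ_tors : Γ.torsion = 0)
    {M : Type*} [TopologicalSpace M] [T2Space M] [SecondCountableTopology M]
    [ChartedSpace (EuclideanSpace ℝ (Fin n)) M]
    [IsManifold 𝓘(ℝ, EuclideanSpace ℝ (Fin n)) ∞ M]
    (Θ : GeodesicJets.LinearConnection 𝓘(ℝ, EuclideanSpace ℝ (Fin n)) M)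
    (hΘ : CovariantDerivative.ContMDiffCovariantDerivative Θ ∞)
    (hΘ_tors : Θ.torsion = 0) :
    -- unparametrized totally geodesic submanifolds of `E`
    (GeodesicJets.IsIntegrable (EuclideanSpace ℝ (Fin n))
        (GeodesicJets.geodesicDistribution Γ univ) →
      GeodesicJets.SymmetryDescription Γ univ) ∧
    -- parametrized ones, in the jets of sections of `M × E → M`
    (GeodesicJets.IsIntegrable (EuclideanSpace ℝ (Fin n))
        (GeodesicJets.geodesicDistribution (GeodesicJets.prodConnection Θ Γ)
          (GeodesicJets.sectionClass 𝓘(ℝ, EuclideanSpace ℝ (Fin n))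
            𝓘(ℝ, EuclideanSpace ℝ (Fin n) × EuclideanSpace ℝ (Fin m)) M E)) →
      GeodesicJets.SymmetryDescription (GeodesicJets.prodConnection Θ Γ)
        (GeodesicJets.sectionClass 𝓘(ℝ, EuclideanSpace ℝ (Fin n))
          𝓘(ℝ, EuclideanSpace ℝ (Fin n) × EuclideanSpace ℝ (Fin m)) M E)) ∧
    -- parametrized ones, in the jets of immersed sections of `M × E → M`
    (GeodesicJets.IsIntegrable (EuclideanSpace ℝ (Fin n))
        (GeodesicJets.geodesicDistribution (GeodesicJets.prodConnection Θ Γ)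
          (GeodesicJets.immersedSectionClass 𝓘(ℝ, EuclideanSpace ℝ (Fin n))
            𝓘(ℝ, EuclideanSpace ℝ (Fin n) × EuclideanSpace ℝ (Fin m)) M E)) →
      GeodesicJets.SymmetryDescription (GeodesicJets.prodConnection Θ Γ)
        (GeodesicJets.immersedSectionClass 𝓘(ℝ, EuclideanSpace ℝ (Fin n))
          𝓘(ℝ, EuclideanSpace ℝ (Fin n) × EuclideanSpace ℝ (Fin m)) M E)) := by
  have hV := fun (φ : GeodesicJets.DividedChart
      𝓘(ℝ, EuclideanSpace ℝ (Fin n) × EuclideanSpace ℝ (Fin m)) E) =>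
    GeodesicJets.exists_hasChristoffel
      (GeodesicJets.isSmoothTorsionFree_of_torsion_eq_zero hΓ hΓ_tors) φ.isSmoothChart
  have hP := GeodesicJets.isSmoothTorsionFree_prodConnection
    (GeodesicJets.isSmoothTorsionFree_of_torsion_eq_zero hΘ hΘ_tors)
    (GeodesicJets.isSmoothTorsionFree_of_torsion_eq_zero hΓ hΓ_tors)
  refine ⟨fun h => ?_, fun h => ?_, fun h => ?_⟩
  · exact GeodesicJets.symmetryDescription_of_isIntegrable GeodesicJets.isOpenClass_univ hV h
  · exact GeodesicJets.symmetryDescription_of_isIntegrable GeodesicJets.isOpenClass_sectionClass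
      (fun φ => GeodesicJets.exists_hasChristoffel hP φ.isSmoothChart) h
  · exact GeodesicJets.symmetryDescription_of_isIntegrable
      GeodesicJets.isOpenClass_immersedSectionClass
      (fun φ => GeodesicJets.exists_hasChristoffel hP φ.isSmoothChart) h
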